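/- Let $n\ge 1$, $\tau>0$, $m\in\mathbb R$; write $x=(x',x_n)\in\mathbb R^n$, $\overline{\mathbb R^n_+}=\{x_n\ge 0\}$, $\langle\xi\rangle=(1+|\xi|^2)^{1/2}$, $d\bar{}\,\xi'=(2\pi)^{-(n-1)}d\xi'$, and let $\mathcal S(\overline{\mathbb R^n_+})$ be the set of restrictions to $\overline{\mathbb R^n_+}$ of Schwartz functions on $\mathbb R^n$. For $U=\mathbb R^N$ or $U=\overline{\mathbb R^N_+}$ and a Banach space $X$, $C^\tau(U;X)$ consists of the $[\tau]$ times continuously differentiable functions on $U$ with bounded derivatives up to order $[\tau]$ (up to the boundary) whose derivatives of order $[\tau]$ are Hölder continuous of degree $\tau-[\tau]$, with the usual norm. **Classes.** For $\mu\in\mathbb R$: - $C^\tau S^\mu_{1,0}(\mathbb R^N\times\mathbb R^N)$: functions $p(x,\xi)$, smooth in $\xi$, with $\|\partial_\xi^\alpha p(\cdot,\xi)\|_{C^\tau(\mathbb R^N)}\le C_\alpha\langle\xi\rangle^{\mu-|\alpha|}$ for all $\alpha$, $\xi$. - $C^\tau S^\mu_{1,0}(U\times\mathbb R^{n-1};\mathcal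 S_+)$, $U=\overline{\mathbb R^n_+}$ or $\mathbb R^{n-1}$: functions $h(x,\xi',y_n)$, smooth in $(\xi',y_n)\in\mathbb R^{n-1}\times[0,\infty)$ and $C^\tau$ in $x\in U$, with $\|y_n^l\partial_{y_n}^{l'}\partial_{\xi'}^\alpha h(\cdot,\xi',\cdot)\|_{C^\tau(U;L^2(\mathbb R_+))}\le C_{\alpha,l,l'}\langle\xi'\rangle^{\mu+\frac12-l+l'-|\alpha|}$ for all $\alpha,l,l',\xi'$. - $C^\tau S^\mu_{1,0}(\overline{\mathbb R^n_+}\times\mathbb R^{n-1};\mathcal S_{++})$: functions $g(x,\xi',y_n,w_n)$, smooth in $(\xi',y_n,w_n)\in\mathbb R^{n-1}\times[0,\infty)^2$ and $C^\tau$ in $x$, with $\|y_n^k\partial_{y_n}^{k'}w_n^l\partial_{w_n}^{l'}\partial_{\xi'}^\alpha g(\cdot,\xi',\cdot,\cdot)\|_{C^\tau(\overline{\mathbb R^n_+};L^2(\mathbb R_+^2))}\le C_{\alpha,k,k',l,l'}\langle\xi'\rangle^{\mu+1-k+k'-l+l'-|\alpha|}$ for all $\alpha,k,k',l,l',\xi'$.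 The classes of order $-\infty$ are the intersections over all $\mu\in\mathbb R$. **Green operators.** A Green operator with $C^\tau$-coefficients of order $m$ and class $0$, $$a(x,D_x)=\begin{pmatrix}p(x,D_x)_++g(x,D_x)&k(x,D_{x'})\\ t(x',D_x)&s(x',D_{x'})\end{pmatrix},$$ is given by $p\in C^\tau S^m_{1,0}(\mathbb R^n\times\mathbb R^n)$, $g\in C^\tau S^{m-1}_{1,0}(\overline{\mathbb R^n_+}\times\mathbb R^{n-1};\mathcal S_{++})$, $k\in C^\tau S^{m-1}_{1,0}(\overline{\mathbb R^n_+}\times\mathbb R^{n-1};\mathcal S_+)$, $t\in C^\tau S^m_{1,0}(\mathbb R^{n-1}\times\mathbb R^{n-1};\mathcal S_+)$, $s\in C^\tau S^m_{1,0}(\mathbb R^{n-1}\times\mathbb R^{n-1})$. Here $p(x,D_x)u(x)=(2\pi)^{-n}\int e^{ix\cdot\xi}p(x,\xi)\hat u(\xi)\,d\xi$ for $u\in\mathcal S(\mathbb R^n)$, similarly $s(x',D_{x'})$ on $\mathbb R^{n-1}$; the truncation $p(x,D_x)_+f$ is $p(x,D_x)$ (as an oscillatory integral in $\xi$) applied to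 the extension $e_+f$ of $f\in\mathcal S(\overline{\mathbb R^n_+})$ by zero, restricted to $\overline{\mathbb R^n_+}$; and, with $\mathcal F$ the Fourier transform in the tangential variables, for $x\in\overline{\mathbb R^n_+}$, $x'\in\mathbb R^{n-1}$, $v\in\mathcal S(\mathbb R^{n-1})$, $f\in\mathcal S(\overline{\mathbb R^n_+})$, $$k(x,D_{x'})v(x)=\int e^{ix'\cdot\xi'}k(x,\xi',x_n)\mathcal F[v](\xi')\,d\bar{}\,\xi',\qquad t(x',D_x)f(x')=\int e^{ix'\cdot\xi'}\int_0^\infty t(x',\xi',y_n)\mathcal F[f(\cdot,y_n)](\xi')\,dy_n\,d\bar{}\,\xi',$$ $$g(x,D_x)f(x)=\int e^{ix'\cdot\xi'}\int_0^\infty g(x,\xi',x_n,w_n)\mathcal F[f(\cdot,w_n)](\xi')\,dw_n\,d\bar{}\,\xi'.$$ *Order $-\infty$.* $a(x,D_x)$ is of order $-\infty$ if $p$, $t$, $s$ belong to the respective classes of order $-\infty$, and the operators $g(x,D_x)$ and $k(x,D_{x'})$ are the operators of symbol-kernels $g_0$, $k_0$ in the respective classes of order $-\infty$. (An operator $g(x,D_x)$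 or $k(x,D_{x'})$ determines its symbol-kernel only at $y_n=x_n$.) *$C^\tau$–$C^\infty$-kernel.* $a(x,D_x)$ has a $C^\tau$–$C^\infty$-kernel if there are functions $K_p,K_g,K_t,K_k,K_s$, smooth in all variables but the first, such that: 1. $p(x,D_x)f(x)=\int_{\mathbb R^n}K_p(x,x-y)f(y)\,dy$ for all $f\in\mathcal S(\mathbb R^n)$, $x\in\mathbb R^n$, and $\sup_z\|z^\beta\partial_z^\alpha K_p(\cdot,z)\|_{C^\tau(\mathbb R^n)}<\infty$ for all $\alpha,\beta$; the truncation is given by $p(x,D_x)_+f(x)=\int_{\overline{\mathbb R^n_+}}K_p(x,x-y)f(y)\,dy$ for all $f\in\mathcal S(\overline{\mathbb R^n_+})$, $x\in\overline{\mathbb R^n_+}$; 2. $g(x,D_x)f(x)=\int_{\mathbb R^{n-1}}\int_0^\infty K_g(x,x'-w',x_n,w_n)f(w',w_n)\,dw_n\,dw'$ for all $f\in\mathcal S(\overline{\mathbb R^n_+})$, $x\in\overline{\mathbb R^n_+}$, and $\sup_{z',\,y_n,w_n\ge0}\|(z')^\beta\partial_{z'}^\alpha y_n^k\partial_{y_n}^{k'}w_n^l\partial_{w_n}^{l'}K_g(\cdot,z',y_n,w_n)\|_{C^\tau(\overline{\mathbb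 R^n_+})}<\infty$ for all $\alpha,\beta,k,k',l,l'$; 3. $t(x',D_x)f(x')=\int_{\mathbb R^{n-1}}\int_0^\infty K_t(x',x'-y',y_n)f(y',y_n)\,dy_n\,dy'$ for all $f\in\mathcal S(\overline{\mathbb R^n_+})$, $x'\in\mathbb R^{n-1}$, and $\sup_{z',\,y_n\ge0}\|(z')^\beta\partial_{z'}^\alpha y_n^l\partial_{y_n}^{l'}K_t(\cdot,z',y_n)\|_{C^\tau(\mathbb R^{n-1})}<\infty$ for all $\alpha,\beta,l,l'$; 4. $k(x,D_{x'})v(x)=\int_{\mathbb R^{n-1}}K_k(x,x'-y',x_n)v(y')\,dy'$ for all $v\in\mathcal S(\mathbb R^{n-1})$, $x\in\overline{\mathbb R^n_+}$, and $K_k$ satisfies the estimates in 3 with $C^\tau(\overline{\mathbb R^n_+})$ in place of $C^\tau(\mathbb R^{n-1})$; 5. $s(x',D_{x'})v(x')=\int_{\mathbb R^{n-1}}K_s(x',x'-y')v(y')\,dy'$ for all $v\in\mathcal S(\mathbb R^{n-1})$, $x'\in\mathbb R^{n-1}$, and $\sup_{z'}\|(z')^\beta\partial_{z'}^\alpha K_s(\cdot,z')\|_{C^\tau(\mathbb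 R^{n-1})}<\infty$ for all $\alpha,\beta$. **Lemma.** A Green operator $a(x,D_x)$ with $C^\tau$-coefficients of order $m$ and class $0$ is of order $-\infty$ if and only if it has a $C^\tau$–$C^\infty$-kernel. -/

import Mathlib

open MeasureTheory Set Filter Topology
open scoped ContDiff

noncomputable section

namespace NonsmoothGreen

/-! ### Points, half-space, partial derivatives -/

/-- `ℝⁿ` with its Euclidean norm. -/
abbrev Eu (n : ℕ) : Type := EuclideanSpace ℝ (Fin n)

/-- The tangential part `x' ∈ ℝⁿ⁻¹` of `x = (x', xₙ) ∈ ℝⁿ`, where `n = d + 1`. -/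
def tang {d : ℕ} (x : Eu (d + 1)) : Eu d := WithLp.toLp 2 fun i => x i.castSucc

/-- The normal coordinate `xₙ` of `x = (x', xₙ)`. -/
def nrm {d : ℕ} (x : Eu (d + 1)) : ℝ := x (Fin.last d)

/-- The point `(x', t) ∈ ℝⁿ`. -/
def pt {d : ℕ} (x' : Eu d) (t : ℝ) : Eu (d + 1) :=
  WithLp.toLp 2 (Fin.snoc (α := fun _ => ℝ) (fun i => x' i) t)

/-- The closed half-space `xₙ ≥ 0`. -/
def halfSpace (d : ℕ) : Set (Eu (d + 1)) := {x | 0 ≤ nrm x}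

/-- The Japanese bracket `⟨ξ⟩ = (1 + |ξ|²)^{1/2}`. -/
def bracket {n : ℕ} (ξ : Eu n) : ℝ := Real.sqrt (1 + ‖ξ‖ ^ 2)

/-- The partial derivative `∂_{a 0} ⋯ ∂_{a (r-1)} f`. As `a` ranges over all tuples of indices of
length `r`, these are the derivatives `∂^α f` with `|α| = r`. -/
def partialD {n r : ℕ} (a : Fin r → Fin n) (f : Eu n → ℂ) (ξ : Eu n) : ℂ :=
  iteratedFDeriv ℝ r f ξ fun i => EuclideanSpace.single (a i) (1 : ℝ)

/-- The monomial `z^β`. -/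
def monom {n : ℕ} (β : Fin n → ℕ) (z : Eu n) : ℝ := ∏ i, z i ^ β i

/-! ### Hölder spaces -/

/-- `f ∈ C^τ(U; F)` with norm bounded by `B`: `f` is `[τ]` times continuously differentiable on `U`
(up to the boundary if `U` is a closed half-space), its derivatives of order at most `[τ]` are bounded
by `B`, and those of order `[τ]` are Hölder continuous of degree `τ - [τ]` with constant `B`.
(Up to a factor which depends only on `[τ]` and the dimension, this is a bound on the usual norm.) -/
def HolderBoundOn {E F : Type*} [NormedAddCommGroup E] [NormedSpace ℝ E]
    [NormedAddCommGroup F] [NormedSpace ℝ F] (τ : ℝ) (U : Set E) (f : E → F) (B : ℝ) : Prop :=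
  ContDiffOn ℝ (⌊τ⌋₊ : ℕ) f U ∧
  (∀ j ≤ ⌊τ⌋₊, ∀ x ∈ U, ‖iteratedFDerivWithin ℝ j f U x‖ ≤ B) ∧
  (∀ x ∈ U, ∀ y ∈ U,
    ‖iteratedFDerivWithin ℝ ⌊τ⌋₊ f U x - iteratedFDerivWithin ℝ ⌊τ⌋₊ f U y‖
      ≤ B * ‖x - y‖ ^ (τ - ⌊τ⌋₊))

/-- `x ↦ φ x ·` is in `C^τ(U; L²(μ))` with norm bounded by `B`. -/
def HolderL2BoundOn {E Y : Type*} [NormedAddCommGroup E] [NormedSpace ℝ E] [MeasurableSpace Y]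
    (τ : ℝ) (U : Set E) (μ : Measure Y) (φ : E → Y → ℂ) (B : ℝ) : Prop :=
  ∃ Φ : E → Lp ℂ 2 μ, (∀ x ∈ U, Φ x =ᵐ[μ] φ x) ∧ HolderBoundOn τ U Φ B

/-! ### Symbols and symbol-kernels -/

/-- `p ∈ C^τ S^m_{1,0}(ℝⁿ × ℝⁿ)`. -/
def IsSymbol {n : ℕ} (τ m : ℝ) (p : Eu n → Eu n → ℂ) : Prop :=
  (∀ x, ContDiff ℝ ∞ (p x)) ∧
  ∀ (r : ℕ) (a : Fin r → Fin n), ∃ C : ℝ, ∀ ξ : Eu n,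
    HolderBoundOn τ univ (fun x => partialD a (p x) ξ) (C * bracket ξ ^ (m - r))

/-- `∂_{ξ'}^a ∂_y^{l'} h(ξ', y)` for `y ≥ 0` (one-sided derivatives at `y = 0`). -/
def mixedD {d r : ℕ} (a : Fin r → Fin d) (l' : ℕ) (h : Eu d → ℝ → ℂ) (ξ : Eu d) (y : ℝ) : ℂ :=
  partialD a (fun η => iteratedDerivWithin l' (h η) (Ici 0) y) ξ

/-- `∂_{ξ'}^a ∂_y^{k'} ∂_w^{l'} g(ξ', y, w)` for `y, w ≥ 0` (one-sided derivatives at `0`). -/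
def mixedD2 {d r : ℕ} (a : Fin r → Fin d) (k' l' : ℕ) (g : Eu d → ℝ → ℝ → ℂ)
    (ξ : Eu d) (y w : ℝ) : ℂ :=
  partialD a (fun η =>
    iteratedDerivWithin k' (fun y₁ => iteratedDerivWithin l' (g η y₁) (Ici 0) w) (Ici 0) y) ξ

/-- `h ∈ C^τ S^m_{1,0}(U × ℝⁿ⁻¹; 𝒮₊)`: symbol-kernels `h(x, ξ', yₙ)` of Poisson operators
(`U` the closed half-space of `ℝⁿ`) and of trace operators (`U = ℝⁿ⁻¹`). -/
def IsSymbolKernel {d N : ℕ} (τ m : ℝ) (U : Set (Eu N)) (h : Eu N → Eu d → ℝ → ℂ) : Prop :=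
  (∀ x ∈ U, ContDiffOn ℝ ∞ (fun q : Eu d × ℝ => h x q.1 q.2) (univ ×ˢ Ici 0)) ∧
  (∀ ξ, ∀ y ≥ (0 : ℝ), ∃ B : ℝ, HolderBoundOn τ U (fun x => h x ξ y) B) ∧
  ∀ (r : ℕ) (a : Fin r → Fin d) (l l' : ℕ), ∃ C : ℝ, ∀ ξ : Eu d,
    HolderL2BoundOn τ U (volume.restrict (Ioi (0 : ℝ)))
      (fun x y => (y : ℂ) ^ l * mixedD a l' (h x) ξ y)
      (C * bracket ξ ^ (m + 1 / 2 - l + l' - r))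

/-- `g ∈ C^τ S^m_{1,0}(U × ℝⁿ⁻¹; 𝒮₊₊)`: symbol-kernels `g(x, ξ', yₙ, wₙ)` of singular Green
operators (`U` the closed half-space of `ℝⁿ`). -/
def IsSymbolKernel2 {d N : ℕ} (τ m : ℝ) (U : Set (Eu N)) (g : Eu N → Eu d → ℝ → ℝ → ℂ) : Prop :=
  (∀ x ∈ U, ContDiffOn ℝ ∞ (fun q : Eu d × ℝ × ℝ => g x q.1 q.2.1 q.2.2)
    (univ ×ˢ (Ici 0 ×ˢ Ici 0))) ∧
  (∀ ξ, ∀ y ≥ (0 : ℝ), ∀ w ≥ (0 : ℝ), ∃ B : ℝ, HolderBoundOn τ U (fun x => g x ξ y w) B) ∧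
  ∀ (r : ℕ) (a : Fin r → Fin d) (k k' l l' : ℕ), ∃ C : ℝ, ∀ ξ : Eu d,
    HolderL2BoundOn τ U (volume.restrict (Ioi (0 : ℝ) ×ˢ Ioi (0 : ℝ)))
      (fun x q => (q.1 : ℂ) ^ k * (q.2 : ℂ) ^ l * mixedD2 a k' l' (g x) ξ q.1 q.2)
      (C * bracket ξ ^ (m + 1 - k + k' - l + l' - r))

/-! ### The operators

`𝒮` of the closed half-space is the space of restrictions of Schwartz functions on `ℝⁿ`; its elements
are represented by Schwartz functions `f` on `ℝⁿ`, of which only the values for `yₙ ≥ 0` enter. -/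

/-- The character `e^{i x·ξ}`. -/
def char {n : ℕ} (x ξ : Eu n) : ℂ := Complex.exp (Complex.I * (inner ℝ x ξ : ℝ))

/-- The Fourier transform `∫ e^{-i y·ξ} u(y) dy`. -/
def fourier {n : ℕ} (u : Eu n → ℂ) (ξ : Eu n) : ℂ := ∫ y, char (-y) ξ * u y

/-- The factor `(2π)^{-n}` of the normalized measure in the frequency variable. -/
def nfac (n : ℕ) : ℂ := ((2 * Real.pi : ℝ) : ℂ)⁻¹ ^ n

/-- The pseudodifferential operator `p(x, D_x)`. -/
def opPsi {n : ℕ} (p : Eu n → Eu n → ℂ) (u : SchwartzMap (Eu n) ℂ) (x : Eu n) : ℂ :=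
  nfac n * ∫ ξ, char x ξ * p x ξ * fourier u ξ

/-- Extension `e₊ f` by zero from the closed half-space to `ℝⁿ`. -/
def extZero {d : ℕ} (f : Eu (d + 1) → ℂ) : Eu (d + 1) → ℂ := (halfSpace d).indicator f

/-- The truncation `p(x, D_x)₊ f = r₊ p(x, D_x) e₊ f` has the value `c` at `x`. As the Fourier
transform of `e₊ f` need not decay fast, `p(x, D_x) e₊ f` is an oscillatory integral, i.e. the
limit of the integrals cut off by `χ(ε ξ)` as `ε → 0`, for every Schwartz function `χ` with
`χ(0) = 1`. -/
def HasTruncValue {d : ℕ} (p : Eu (d + 1) → Eu (d + 1) → ℂ) (f : Eu (d + 1) → ℂ)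
    (x : Eu (d + 1)) (c : ℂ) : Prop :=
  ∀ χ : SchwartzMap (Eu (d + 1)) ℂ, χ 0 = 1 →
    Tendsto (fun ε : ℝ =>
      nfac (d + 1) * ∫ ξ, χ (ε • ξ) * (char x ξ * p x ξ * fourier (extZero f) ξ)) (𝓝[>] 0) (𝓝 c)

/-- The Poisson operator `k(x, D_{x'})`. -/
def opPoisson {d : ℕ} (k : Eu (d + 1) → Eu d → ℝ → ℂ) (v : SchwartzMap (Eu d) ℂ)
    (x : Eu (d + 1)) : ℂ :=
  nfac d * ∫ ξ, char (tang x) ξ * k x ξ (nrm x) * fourier v ξ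

/-- The trace operator `t(x', D_x)` of class `0`. -/
def opTrace {d : ℕ} (t : Eu d → Eu d → ℝ → ℂ) (f : SchwartzMap (Eu (d + 1)) ℂ) (x : Eu d) : ℂ :=
  nfac d * ∫ ξ, char x ξ *
    ∫ y in Ioi (0 : ℝ), t x ξ y * fourier (fun y' => f (pt y' y)) ξ

/-- The singular Green operator `g(x, D_x)` of class `0`. -/
def opGreen {d : ℕ} (g : Eu (d + 1) → Eu d → ℝ → ℝ → ℂ) (f : SchwartzMap (Eu (d + 1)) ℂ)
    (x : Eu (d + 1)) : ℂ :=
  nfac d * ∫ ξ, char (tang x) ξ *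
    ∫ w in Ioi (0 : ℝ), g x ξ (nrm x) w * fourier (fun w' => f (pt w' w)) ξ

/-! ### Estimates of `C^τ`-`C^∞`-kernels -/

/-- `sup_z ‖z^β ∂_z^α K(·, z)‖_{C^τ(ℝⁿ)} < ∞` for all `α`, `β`. -/
def KernelBound {n : ℕ} (τ : ℝ) (K : Eu n → Eu n → ℂ) : Prop :=
  (∀ x, ContDiff ℝ ∞ (K x)) ∧
  ∀ (r : ℕ) (a : Fin r → Fin n) (β : Fin n → ℕ), ∃ C : ℝ, ∀ z : Eu n,
    HolderBoundOn τ univ (fun x => (monom β z : ℂ) * partialD a (K x) z) C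

/-- `sup_{z', y} ‖z'^β ∂_{z'}^α y^l ∂_y^{l'} K(·, z', y)‖_{C^τ(U)} < ∞` for all
`α`, `β`, `l`, `l'`. -/
def KernelBound1 {d N : ℕ} (τ : ℝ) (U : Set (Eu N)) (K : Eu N → Eu d → ℝ → ℂ) : Prop :=
  (∀ x ∈ U, ContDiffOn ℝ ∞ (fun q : Eu d × ℝ => K x q.1 q.2) (univ ×ˢ Ici 0)) ∧
  ∀ (r : ℕ) (a : Fin r → Fin d) (β : Fin d → ℕ) (l l' : ℕ), ∃ C : ℝ,
    ∀ z : Eu d, ∀ y ≥ (0 : ℝ),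
      HolderBoundOn τ U (fun x => (monom β z : ℂ) * (y : ℂ) ^ l * mixedD a l' (K x) z y) C

/-- `sup_{z', y, w} ‖z'^β ∂_{z'}^α y^k ∂_y^{k'} w^l ∂_w^{l'} K(·, z', y, w)‖_{C^τ(U)} < ∞` for all
`α`, `β`, `k`, `k'`, `l`, `l'`. -/
def KernelBound2 {d N : ℕ} (τ : ℝ) (U : Set (Eu N)) (K : Eu N → Eu d → ℝ → ℝ → ℂ) : Prop :=
  (∀ x ∈ U, ContDiffOn ℝ ∞ (fun q : Eu d × ℝ × ℝ => K x q.1 q.2.1 q.2.2)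
    (univ ×ˢ (Ici 0 ×ˢ Ici 0))) ∧
  ∀ (r : ℕ) (a : Fin r → Fin d) (β : Fin d → ℕ) (k k' l l' : ℕ), ∃ C : ℝ,
    ∀ z : Eu d, ∀ y ≥ (0 : ℝ), ∀ w ≥ (0 : ℝ),
      HolderBoundOn τ U
        (fun x => (monom β z : ℂ) * (y : ℂ) ^ k * (w : ℂ) ^ l * mixedD2 a k' l' (K x) z y w) C

/-- `K` is a `C^τ`-`C^∞`-kernel of the pseudodifferential operator `p(x, D_x)`. -/
def IsPsiKernel {n : ℕ} (τ : ℝ) (p : Eu n → Eu n → ℂ) (K : Eu n → Eu n → ℂ) : Prop :=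
  KernelBound τ K ∧
  ∀ (f : SchwartzMap (Eu n) ℂ) (x : Eu n), opPsi p f x = ∫ y, K x (x - y) * f y

/-! ### Green operators -/

/-- A Green operator with `C^τ`-coefficients on the closed half-space of `ℝⁿ`, `n = d + 1`, of
order `m` and class `0`, given by its five constituents: the operator matrix with rows
`(p(x, D_x)₊ + g(x, D_x), k(x, D_{x'}))` and `(t(x', D_x), s(x', D_{x'}))`. -/
structure GreenOperator (d : ℕ) (τ m : ℝ) where
  /-- symbol of the pseudodifferential operator on `ℝⁿ` that is truncated -/
  p : Eu (d + 1) → Eu (d + 1) → ℂ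
  /-- symbol-kernel of the singular Green operator -/
  g : Eu (d + 1) → Eu d → ℝ → ℝ → ℂ
  /-- symbol-kernel of the Poisson operator -/
  k : Eu (d + 1) → Eu d → ℝ → ℂ
  /-- symbol-kernel of the trace operator -/
  t : Eu d → Eu d → ℝ → ℂ
  /-- symbol of the pseudodifferential operator on the boundary `ℝⁿ⁻¹` -/
  s : Eu d → Eu d → ℂ
  p_mem : IsSymbol τ m p
  g_mem : IsSymbolKernel2 τ (m - 1) (halfSpace d) g
  k_mem : IsSymbolKernel τ (m - 1) (halfSpace d) k
  t_mem : IsSymbolKernel τ m univ t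
  s_mem : IsSymbol τ m s

namespace GreenOperator

variable {d : ℕ} {τ m : ℝ}

/-- The Green operator is of order `-∞`: each of its constituents is the operator of a symbol or
symbol-kernel in the class of order `-∞`, the intersection of the classes of all real orders.
The operators `p(x, D_x)`, `t(x', D_x)`, `s(x', D_{x'})` determine `p`, `t`, `s`. But only the values
of `g(x, ξ', yₙ, wₙ)` and `k(x, ξ', yₙ)` at `yₙ = xₙ` enter into `g(x, D_x)` and `k(x, D_{x'})`, so
that these operators are of order `-∞` if they have some symbol-kernel of order `-∞`. -/
def IsOrderNegInfty (A : GreenOperator d τ m) : Prop :=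
  (∀ μ : ℝ, IsSymbol τ μ A.p) ∧
  (∃ g₀ : Eu (d + 1) → Eu d → ℝ → ℝ → ℂ, (∀ μ : ℝ, IsSymbolKernel2 τ μ (halfSpace d) g₀) ∧
    ∀ (f : SchwartzMap (Eu (d + 1)) ℂ), ∀ x ∈ halfSpace d, opGreen A.g f x = opGreen g₀ f x) ∧
  (∃ k₀ : Eu (d + 1) → Eu d → ℝ → ℂ, (∀ μ : ℝ, IsSymbolKernel τ μ (halfSpace d) k₀) ∧
    ∀ (v : SchwartzMap (Eu d) ℂ), ∀ x ∈ halfSpace d, opPoisson A.k v x = opPoisson k₀ v x) ∧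
  (∀ μ : ℝ, IsSymbolKernel τ μ univ A.t) ∧
  (∀ μ : ℝ, IsSymbol τ μ A.s)

/-- The Green operator has a `C^τ`-`C^∞`-kernel. -/
def HasKernel (A : GreenOperator d τ m) : Prop :=
  (∃ Kp : Eu (d + 1) → Eu (d + 1) → ℂ, IsPsiKernel τ A.p Kp ∧
    ∀ (f : SchwartzMap (Eu (d + 1)) ℂ), ∀ x ∈ halfSpace d,
      HasTruncValue A.p f x (∫ y in halfSpace d, Kp x (x - y) * f y)) ∧
  (∃ Kg : Eu (d + 1) → Eu d → ℝ → ℝ → ℂ, KernelBound2 τ (halfSpace d) Kg ∧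
    ∀ (f : SchwartzMap (Eu (d + 1)) ℂ), ∀ x ∈ halfSpace d,
      opGreen A.g f x =
        ∫ w', ∫ w in Ioi (0 : ℝ), Kg x (tang x - w') (nrm x) w * f (pt w' w)) ∧
  (∃ Kt : Eu d → Eu d → ℝ → ℂ, KernelBound1 τ univ Kt ∧
    ∀ (f : SchwartzMap (Eu (d + 1)) ℂ) (x : Eu d),
      opTrace A.t f x = ∫ y', ∫ y in Ioi (0 : ℝ), Kt x (x - y') y * f (pt y' y)) ∧
  (∃ Kk : Eu (d + 1) → Eu d → ℝ → ℂ, KernelBound1 τ (halfSpace d) Kk ∧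
    ∀ (v : SchwartzMap (Eu d) ℂ), ∀ x ∈ halfSpace d,
      opPoisson A.k v x = ∫ y', Kk x (tang x - y') (nrm x) * v y') ∧
  (∃ Ks : Eu d → Eu d → ℂ, IsPsiKernel τ A.s Ks)

end GreenOperator

end NonsmoothGreen

end

/-! Once an estimate holds for every order, the exact power of ⟨ξ⟩ no longer matters. A symbol of
order -∞ is a function which decreases rapidly in ξ together with all its derivatives, uniformly in
the C^τ norm in x. This is the condition on a kernel with ξ in place of z. The two sides are
therefore exchanged by the Fourier transform in the covariable, with x as a parameter. It turns
derivatives into multiplications by coordinates and conversely, hence preserves rapid decrease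
(`RapidFam.four`, `KernelBound2.four`, `KernelBound1.four`). By Fubini's theorem the operator of a
rapidly decreasing symbol has the inverse Fourier transform of the symbol, times the power of 2π, as
its kernel; conversely the Fourier transform of a kernel is a symbol of order -∞ with the same
operator.

Four points need work.

Hölder regularity in x has to survive integration. A function with pointwise Hölder bounds b(y),
where b is in L^p, is a Hölder map into L^p with bound ‖b‖ (`holderOn_lp`). Composition with the
integral, a functional on L¹, gives `HolderOn.integral`.

Symbol-kernels are measured in L² of the normal variables, kernels in the supremum. From the
supremum to L² one spends a factor (1 + y²)⁻¹, paid for by the weight y²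
(`KernelBound2.isSymbolKernel2`). From L² to the supremum, y^k u(y) is a combination of pairings of
s^k u and s^k u' with functions of L² norm at most one (`eval_identity`). Such pairings keep Hölder
bounds.

The truncation is an oscillatory integral, but for rapidly decreasing p it converges absolutely
(`hasTruncValue_integral`).

In the direction from kernels to symbols, p, s and t themselves must be of order -∞. They coincide
with the Fourier transforms of their kernels, since the operators determine them
(`symbol_eq_of_opPsi_eq`, `symbolKernel_eq_of_opTrace_eq`). For g and k only some symbol-kernel of
order -∞ is required, and the Fourier transform of the kernel is one. -/

noncomputable section

namespace NonsmoothGreen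

set_option linter.unusedSectionVars false

/-! ### Hölder classes with integer order k and exponent θ -/

section Holder

variable {E F G : Type} [NormedAddCommGroup E] [NormedSpace ℝ E]
  [NormedAddCommGroup F] [NormedSpace ℝ F] [NormedAddCommGroup G] [NormedSpace ℝ G]

/-- Functions of class `C^{k, θ}` on `U` with bound `B`, for an integer `k`. -/
def HolderOn (k : ℕ) (θ : ℝ) (U : Set E) (f : E → F) (B : ℝ) : Prop :=
  ContDiffOn ℝ k f U ∧
  (∀ j ≤ k, ∀ x ∈ U, ‖iteratedFDerivWithin ℝ j f U x‖ ≤ B) ∧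
  (∀ x ∈ U, ∀ y ∈ U,
    ‖iteratedFDerivWithin ℝ k f U x - iteratedFDerivWithin ℝ k f U y‖ ≤ B * ‖x - y‖ ^ θ)

theorem holderOn_zero_iff {θ : ℝ} {U : Set E} {f : E → F} {B : ℝ} :
    HolderOn 0 θ U f B ↔ ContinuousOn f U ∧ (∀ x ∈ U, ‖f x‖ ≤ B) ∧
      ∀ x ∈ U, ∀ y ∈ U, ‖f x - f y‖ ≤ B * ‖x - y‖ ^ θ := by
  have key : ∀ x y, ‖iteratedFDerivWithin ℝ 0 f U x - iteratedFDerivWithin ℝ 0 f U y‖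
      = ‖f x - f y‖ := fun x y => by
    simp only [iteratedFDerivWithin_zero_eq_comp, Function.comp_apply, ← map_sub,
      LinearIsometryEquiv.norm_map]
  simp only [HolderOn, Nat.cast_zero, contDiffOn_zero, Nat.le_zero, forall_eq,
    norm_iteratedFDerivWithin_zero, key]

/-- Currying is an isometry between the derivative of order j + 1 of f and the derivative of order j
of its first derivative. The constant B is thus the same on both sides, and inductions on k lose
nothing. -/
theorem holderOn_succ_iff {k : ℕ} {θ : ℝ} {U : Set E} (hU : UniqueDiffOn ℝ U) {f : E → F}
    {B : ℝ} : HolderOn (k + 1) θ U f B ↔ (∀ x ∈ U, ‖f x‖ ≤ B) ∧ DifferentiableOn ℝ f U ∧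
      HolderOn k θ U (fderivWithin ℝ f U) B := by
  have hn : ∀ j, ∀ x ∈ U, ‖iteratedFDerivWithin ℝ (j + 1) f U x‖
      = ‖iteratedFDerivWithin ℝ j (fderivWithin ℝ f U) U x‖ := fun j x hx =>
    (norm_iteratedFDerivWithin_fderivWithin hU hx).symm
  have hd : ∀ x ∈ U, ∀ y ∈ U,
      ‖iteratedFDerivWithin ℝ (k + 1) f U x - iteratedFDerivWithin ℝ (k + 1) f U y‖
      = ‖iteratedFDerivWithin ℝ k (fderivWithin ℝ f U) U x
          - iteratedFDerivWithin ℝ k (fderivWithin ℝ f U) U y‖ := fun x hx y hy => by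
    rw [iteratedFDerivWithin_succ_eq_comp_right hU hx, iteratedFDerivWithin_succ_eq_comp_right hU hy,
      Function.comp_apply, Function.comp_apply, ← dist_eq_norm, ← dist_eq_norm]
    exact LinearIsometryEquiv.dist_map _ _ _
  constructor
  · rintro ⟨h1, h2, h3⟩
    rw [Nat.cast_add, Nat.cast_one, contDiffOn_succ_iff_fderivWithin hU] at h1
    refine ⟨fun x hx => ?_, h1.1, h1.2.2, fun j hj x hx => ?_, fun x hx y hy => ?_⟩
    · simpa using h2 0 (Nat.zero_le _) x hx
    · rw [← hn j x hx]; exact h2 (j + 1) (by omega) x hx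
    · rw [← hd x hx y hy]; exact h3 x hx y hy
  · rintro ⟨h0, h1, h2, h3, h4⟩
    refine ⟨?_, fun j hj x hx => ?_, fun x hx y hy => ?_⟩
    · rw [Nat.cast_add, Nat.cast_one, contDiffOn_succ_iff_fderivWithin hU]
      exact ⟨h1, by simp, h2⟩
    · rcases j with _ | j
      · simpa using h0 x hx
      · rw [hn j x hx]; exact h3 j (by omega) x hx
    · rw [hd x hx y hy]; exact h4 x hx y hy

theorem HolderOn.congr {k : ℕ} {θ : ℝ} {U : Set E} {f g : E → F} {B : ℝ}
    (h : HolderOn k θ U f B) (hfg : EqOn g f U) : HolderOn k θ U g B := by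
  refine ⟨h.1.congr hfg, fun j hj x hx => ?_, fun x hx y hy => ?_⟩
  · rw [iteratedFDerivWithin_congr hfg hx]; exact h.2.1 j hj x hx
  · rw [iteratedFDerivWithin_congr hfg hx, iteratedFDerivWithin_congr hfg hy]; exact h.2.2 x hx y hy

theorem HolderOn.mono {k : ℕ} {θ : ℝ} {U : Set E} {f : E → F} {B B' : ℝ}
    (h : HolderOn k θ U f B) (hB : B ≤ B') : HolderOn k θ U f B' := by
  refine ⟨h.1, fun j hj x hx => (h.2.1 j hj x hx).trans hB, fun x hx y hy => ?_⟩
  exact (h.2.2 x hx y hy).trans (by gcongr)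

theorem HolderOn.norm_le {k : ℕ} {θ : ℝ} {U : Set E} {f : E → F} {B : ℝ}
    (h : HolderOn k θ U f B) {x : E} (hx : x ∈ U) : ‖f x‖ ≤ B := by
  simpa using h.2.1 0 (Nat.zero_le _) x hx

theorem HolderOn.clm_comp {k : ℕ} {θ : ℝ} {U : Set E} (hU : UniqueDiffOn ℝ U) {f : E → F} {B : ℝ}
    (h : HolderOn k θ U f B) (L : F →L[ℝ] G) :
    HolderOn k θ U (fun x => L (f x)) (‖L‖ * B) := by
  have hc : ∀ j ≤ k, ∀ x ∈ U, iteratedFDerivWithin ℝ j (fun x => L (f x)) U x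
      = L.compContinuousMultilinearMap (iteratedFDerivWithin ℝ j f U x) := fun j hj x hx =>
    L.iteratedFDerivWithin_comp_left (h.1 x hx) hU hx (by exact_mod_cast hj)
  refine ⟨L.contDiff.comp_contDiffOn h.1, fun j hj x hx => ?_, fun x hx y hy => ?_⟩
  · rw [hc j hj x hx]
    exact (L.norm_compContinuousMultilinearMap_le _).trans
      (mul_le_mul_of_nonneg_left (h.2.1 j hj x hx) (norm_nonneg _))
  · rw [hc k le_rfl x hx, hc k le_rfl y hy]
    have : L.compContinuousMultilinearMap (iteratedFDerivWithin ℝ k f U x)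
        - L.compContinuousMultilinearMap (iteratedFDerivWithin ℝ k f U y)
        = L.compContinuousMultilinearMap
          (iteratedFDerivWithin ℝ k f U x - iteratedFDerivWithin ℝ k f U y) := by
      ext v; simp
    rw [this, mul_assoc]
    exact (L.norm_compContinuousMultilinearMap_le _).trans
      (mul_le_mul_of_nonneg_left (h.2.2 x hx y hy) (norm_nonneg _))

theorem HolderOn.add {k : ℕ} {θ : ℝ} {U : Set E} (hU : UniqueDiffOn ℝ U) {f g : E → F} {B B' : ℝ}
    (hf : HolderOn k θ U f B) (hg : HolderOn k θ U g B') :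
    HolderOn k θ U (fun x => f x + g x) (B + B') := by
  have hc : ∀ j ≤ k, ∀ x ∈ U, iteratedFDerivWithin ℝ j (fun x => f x + g x) U x
      = iteratedFDerivWithin ℝ j f U x + iteratedFDerivWithin ℝ j g U x := fun j hj x hx =>
    fun_iteratedFDerivWithin_add_apply ((hf.1 x hx).of_le (by exact_mod_cast hj))
      ((hg.1 x hx).of_le (by exact_mod_cast hj)) hU hx
  refine ⟨hf.1.add hg.1, fun j hj x hx => ?_, fun x hx y hy => ?_⟩
  · rw [hc j hj x hx]
    exact norm_add_le_of_le (hf.2.1 j hj x hx) (hg.2.1 j hj x hx)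
  · rw [hc k le_rfl x hx, hc k le_rfl y hy, add_sub_add_comm, add_mul]
    exact norm_add_le_of_le (hf.2.2 x hx y hy) (hg.2.2 x hx y hy)

theorem HolderOn.const_mul {k : ℕ} {θ : ℝ} {U : Set E} (hU : UniqueDiffOn ℝ U) {f : E → ℂ} {B : ℝ}
    (hf : HolderOn k θ U f B) (c : ℂ) (hB : 0 ≤ B) :
    HolderOn k θ U (fun x => c * f x) (‖c‖ * B) := by
  refine (hf.clm_comp hU (ContinuousLinearMap.mul ℝ ℂ c)).mono ?_
  gcongr
  exact ContinuousLinearMap.opNorm_mul_apply_le ℝ ℂ c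

end Holder

/-! ### From pointwise Hölder bounds to Hölder maps into L^p -/

section Lift

variable {E F : Type} [NormedAddCommGroup E] [NormedSpace ℝ E]
  [NormedAddCommGroup F] [NormedSpace ℝ F] {Y : Type} [MeasurableSpace Y] {μ : Measure Y}
  {p : ENNReal}

/-- Dominated convergence for the p-th powers of the norms, for a general countably generated filter
such as the neighbourhoods of a point within U. -/
theorem tendsto_eLpNorm_zero_of_dominated {ι : Type*} {l : Filter ι} [l.IsCountablyGenerated]
    (hp0 : p ≠ 0) (hp : p ≠ ⊤) {G : ι → Y → F} {g : Y → ℝ}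
    (hG : ∀ᶠ i in l, AEStronglyMeasurable (G i) μ) (hg : MemLp g p μ)
    (hle : ∀ᶠ i in l, ∀ᵐ y ∂μ, ‖G i y‖ ≤ g y)
    (hlim : ∀ᵐ y ∂μ, Tendsto (fun i => G i y) l (𝓝 0)) :
    Tendsto (fun i => eLpNorm (G i) p μ) l (𝓝 0) := by
  have hpp : 0 < p.toReal := ENNReal.toReal_pos hp0 hp
  have key : Tendsto (fun i => ∫⁻ y, ‖G i y‖ₑ ^ p.toReal ∂μ) l (𝓝 (∫⁻ _, 0 ∂μ)) := by
    refine tendsto_lintegral_filter_of_dominated_convergence' (fun y => ‖g y‖ₑ ^ p.toReal) ?_ ?_ ?_ ?_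
    · filter_upwards [hG] with i hi using hi.enorm.pow_const _
    · filter_upwards [hle] with i hi
      filter_upwards [hi] with y hy
      gcongr
      exact enorm_le_iff_norm_le.2 (hy.trans (le_abs_self _))
    · exact (lintegral_rpow_enorm_lt_top_of_eLpNorm_lt_top hp0 hp hg.2).ne
    · filter_upwards [hlim] with y hy
      have h1 : Tendsto (fun i => ‖G i y‖ₑ) l (𝓝 0) := by simpa using hy.enorm
      have := (ENNReal.continuous_rpow_const (y := p.toReal)).continuousAt.tendsto.comp h1
      simpa [Function.comp_def, ENNReal.zero_rpow_of_pos hpp] using this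
  simp only [lintegral_zero] at key
  have := (ENNReal.continuous_rpow_const (y := 1 / p.toReal)).continuousAt.tendsto.comp key
  rw [ENNReal.zero_rpow_of_pos (by positivity)] at this
  refine this.congr fun i => ?_
  rw [eLpNorm_eq_lintegral_rpow_enorm_toReal hp0 hp, Function.comp_apply]

/-- If x + v lies in U, then the derivative in direction v is a limit of difference quotients at the
points x + v/(n+1), which stay in U by convexity. Other directions are reduced to these by
linearity. -/
theorem aestronglyMeasurable_fderivWithin_apply {U : Set E} (hconv : Convex ℝ U)
    (hint : (interior U).Nonempty) {f : E → Y → F}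
    (hm : ∀ x ∈ U, AEStronglyMeasurable (f x) μ)
    (hd : ∀ᵐ y ∂μ, DifferentiableOn ℝ (fun x => f x y) U) {x : E} (hx : x ∈ U) (v : E) :
    AEStronglyMeasurable (fun y => fderivWithin ℝ (fun x => f x y) U x v) μ := by
  have seg : ∀ v : E, x + v ∈ U →
      AEStronglyMeasurable (fun y => fderivWithin ℝ (fun x => f x y) U x v) μ := by
    intro v hv
    have hmem : ∀ n : ℕ, x + ((n : ℝ) + 1)⁻¹ • v ∈ U := fun n => by
      have h1 : ((n : ℝ) + 1)⁻¹ ≤ 1 := inv_le_one_of_one_le₀ (by linarith [n.cast_nonneg (α := ℝ)])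
      exact hconv.add_smul_mem hx hv ⟨by positivity, h1⟩
    refine aestronglyMeasurable_of_tendsto_ae atTop
      (f := fun (n : ℕ) y => ((n : ℝ) + 1) • (f (x + ((n : ℝ) + 1)⁻¹ • v) y - f x y))
      (fun n => ((hm _ (hmem n)).sub (hm x hx)).const_smul _) ?_
    filter_upwards [hd] with y hy
    refine (hy x hx).hasFDerivWithinAt.lim (c := fun n : ℕ => (n : ℝ) + 1)
      (d := fun n : ℕ => ((n : ℝ) + 1)⁻¹ • v) (l := atTop) ?_ (Eventually.of_forall hmem) ?_
    · simpa using (tendsto_one_div_add_atTop_nhds_zero_nat (𝕜 := ℝ)).smul_const v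
    · refine tendsto_const_nhds.congr fun n => ?_
      rw [smul_smul, mul_inv_cancel₀ (by positivity), one_smul]
  -- For arbitrary v and an interior point c, the point c + v/(n+1) is in U for some n. Then v is n
  -- + 1 times the difference of the admissible directions c + v/(n+1) - x and c - x.
  obtain ⟨c, hc⟩ := hint
  have hcU : U ∈ 𝓝 c := mem_interior_iff_mem_nhds.1 hc
  have : Tendsto (fun n : ℕ => c + ((n : ℝ) + 1)⁻¹ • v) atTop (𝓝 c) := by
    have h := (tendsto_one_div_add_atTop_nhds_zero_nat (𝕜 := ℝ)).smul_const v
    simpa using h.const_add c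
  obtain ⟨n, hn⟩ := (this.eventually hcU).exists
  have h1 := seg (c - x) (by simpa using mem_of_mem_nhds hcU)
  have h2 := seg (c + ((n : ℝ) + 1)⁻¹ • v - x) (by rw [add_sub_cancel]; exact hn)
  refine ((h2.sub h1).const_smul ((n : ℝ) + 1)).congr (Eventually.of_forall fun y => ?_)
  simp only [Pi.smul_apply, Pi.sub_apply]
  rw [← map_sub, show c + ((n : ℝ) + 1)⁻¹ • v - x - (c - x) = ((n : ℝ) + 1)⁻¹ • v by abel, map_smul,
    smul_smul, mul_inv_cancel₀ (by positivity), one_smul]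

/-- In finite dimension D y is a finite sum of rank-one maps built from its values on a basis, which
depend continuously on these values. -/
theorem aestronglyMeasurable_clm_of_apply [FiniteDimensional ℝ E] {D : Y → E →L[ℝ] F}
    (h : ∀ v, AEStronglyMeasurable (fun y => D y v) μ) : AEStronglyMeasurable D μ := by
  let b := Module.finBasis ℝ E
  have hD : D = fun y => ∑ i, (LinearMap.toContinuousLinearMap (b.coord i)).smulRight (D y (b i)) := by
    ext y v
    conv_lhs => rw [← b.sum_repr v, map_sum]
    simp
  rw [hD]
  refine Finset.aestronglyMeasurable_fun_sum _ fun i _ => ?_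
  exact (ContinuousLinearMap.smulRightL ℝ E F
    (LinearMap.toContinuousLinearMap (b.coord i))).continuous.comp_aestronglyMeasurable (h (b i))

variable [Fact (1 ≤ p)]

variable (E F μ p) in
/-- The canonical map `L^p(μ; Hom(E, F)) → Hom(E, L^p(μ; F))`. -/
def lpFlip : Lp (E →L[ℝ] F) p μ →L[ℝ] E →L[ℝ] Lp F p μ :=
  ((ContinuousLinearMap.apply ℝ F).compLpL₂ p μ).flip

theorem norm_lpFlip_le : ‖lpFlip E F μ p‖ ≤ 1 := by
  rw [lpFlip, ContinuousLinearMap.opNorm_flip]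
  refine (ContinuousLinearMap.norm_compLpL₂_le _).trans ?_
  rw [ContinuousLinearMap.apply, ContinuousLinearMap.opNorm_flip]
  exact ContinuousLinearMap.norm_id_le

theorem coeFn_lpFlip (Ψ : Lp (E →L[ℝ] F) p μ) (v : E) :
    lpFlip E F μ p Ψ v =ᵐ[μ] fun y => Ψ y v := by
  exact (ContinuousLinearMap.apply ℝ F v).coeFn_compLp Ψ

theorem norm_lp_le_of_ae_bound {Φ : Lp F p μ} {b : Y → ℝ} (hb : MemLp b p μ) {c : ℝ} (hc : 0 ≤ c)
    (h : ∀ᵐ y ∂μ, ‖Φ y‖ ≤ c * b y) : ‖Φ‖ ≤ (eLpNorm b p μ).toReal * c := by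
  rw [Lp.norm_def, mul_comm]
  have := eLpNorm_le_mul_eLpNorm_of_ae_le_mul (p := p) (f := Φ) (g := b) (μ := μ) (c := c)
    (h.mono fun y hy => hy.trans (mul_le_mul_of_nonneg_left (le_abs_self _) hc))
  refine (ENNReal.toReal_mono (ENNReal.mul_ne_top ENNReal.ofReal_ne_top hb.2.ne) this).trans_eq ?_
  rw [ENNReal.toReal_mul, ENNReal.toReal_ofReal hc]

/-- Differentiation of a map into `L^p` under domination of the derivatives. -/
theorem hasFDerivWithinAt_lp {U : Set E} (hp : p ≠ ⊤) (hconv : Convex ℝ U)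
    {f : E → Y → F} {b : Y → ℝ} (hb : MemLp b p μ)
    (hd : ∀ᵐ y ∂μ, DifferentiableOn ℝ (fun x => f x y) U ∧
      ∀ x ∈ U, ‖fderivWithin ℝ (fun x => f x y) U x‖ ≤ b y)
    {Φ : E → Lp F p μ} (hΦ : ∀ x ∈ U, Φ x =ᵐ[μ] f x) {x₀ : E} (hx₀ : x₀ ∈ U)
    {Ψ : Lp (E →L[ℝ] F) p μ} (hΨ : Ψ =ᵐ[μ] fun y => fderivWithin ℝ (fun x => f x y) U x₀) :
    HasFDerivWithinAt Φ (lpFlip E F μ p Ψ) U x₀ := by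
  have hp0 : p ≠ 0 := (zero_lt_one.trans_le Fact.out).ne'
  rw [hasFDerivWithinAt_iff_tendsto]
  let R : E → Lp F p μ := fun x => ‖x - x₀‖⁻¹ • (Φ x - Φ x₀ - lpFlip E F μ p Ψ (x - x₀))
  have hR : ∀ x ∈ U, R x =ᵐ[μ] fun y => ‖x - x₀‖⁻¹ •
      (f x y - f x₀ y - fderivWithin ℝ (fun x => f x y) U x₀ (x - x₀)) := by
    intro x hx
    filter_upwards [Lp.coeFn_smul (‖x - x₀‖⁻¹) (Φ x - Φ x₀ - lpFlip E F μ p Ψ (x - x₀)),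
      Lp.coeFn_sub (Φ x - Φ x₀) (lpFlip E F μ p Ψ (x - x₀)), Lp.coeFn_sub (Φ x) (Φ x₀),
      coeFn_lpFlip Ψ (x - x₀), hΦ x hx, hΦ x₀ hx₀, hΨ] with y h1 h2 h3 h4 h5 h6 h7
    rw [h1, Pi.smul_apply, h2, Pi.sub_apply, h3, Pi.sub_apply, h4, h5, h6, h7]
  have hlim : Tendsto (fun x => eLpNorm (fun y => ‖x - x₀‖⁻¹ •
      (f x y - f x₀ y - fderivWithin ℝ (fun x => f x y) U x₀ (x - x₀))) p μ) (𝓝[U] x₀) (𝓝 0) := by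
    -- The majorant is 2b: the mean value inequality on the convex set U bounds the increment by b
    -- ‖x - x₀‖, and the linear term has the same bound.
    refine tendsto_eLpNorm_zero_of_dominated hp0 hp (g := fun y => 2 * b y) ?_ (hb.const_mul 2) ?_ ?_
    · filter_upwards [self_mem_nhdsWithin] with x hx
      exact (Lp.aestronglyMeasurable (R x)).congr (hR x hx)
    · filter_upwards [self_mem_nhdsWithin] with x hx
      filter_upwards [hd] with y hy
      have h1 := hconv.norm_image_sub_le_of_norm_fderivWithin_le hy.1 hy.2 hx₀ hx
      have h2 := (fderivWithin ℝ (fun x => f x y) U x₀).le_of_opNorm_le (hy.2 x₀ hx₀) (x - x₀)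
      rw [norm_smul, norm_inv, norm_norm]
      have h3 : ‖f x y - f x₀ y - fderivWithin ℝ (fun x => f x y) U x₀ (x - x₀)‖
          ≤ 2 * b y * ‖x - x₀‖ := (norm_sub_le _ _).trans (by linarith)
      rcases eq_or_ne x x₀ with rfl | hne
      · have : 0 ≤ b y := (norm_nonneg _).trans (hy.2 x hx)
        simpa using this
      · have : 0 < ‖x - x₀‖ := norm_pos_iff.2 (sub_ne_zero.2 hne)
        rw [inv_mul_le_iff₀ this]; linarith
    · filter_upwards [hd] with y hy
      have := hasFDerivWithinAt_iff_tendsto.1 (hy.1 x₀ hx₀).hasFDerivWithinAt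
      rw [tendsto_zero_iff_norm_tendsto_zero]
      simpa [norm_smul] using this
  have h2 := (ENNReal.tendsto_toReal ENNReal.zero_ne_top).comp hlim
  refine (h2.congr' ?_)
  filter_upwards [self_mem_nhdsWithin] with x hx
  rw [Function.comp_apply, ← eLpNorm_congr_ae (hR x hx), ← Lp.norm_def, norm_smul, norm_inv, norm_norm]

/-- A function which is uniformly Hölder in `x`, with bounds in `L^p`, is Hölder as a map to
`L^p`. -/
theorem holderOn_lp [FiniteDimensional ℝ E] {U : Set E} (hp : p ≠ ⊤) (hconv : Convex ℝ U)
    (hint : (interior U).Nonempty) {k : ℕ} {θ : ℝ} {f : E → Y → F} {b : Y → ℝ} (hb : MemLp b p μ)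
    (hm : ∀ x ∈ U, AEStronglyMeasurable (f x) μ)
    (hf : ∀ᵐ y ∂μ, HolderOn k θ U (fun x => f x y) (b y))
    {Φ : E → Lp F p μ} (hΦ : ∀ x ∈ U, Φ x =ᵐ[μ] f x) :
    HolderOn k θ U Φ (eLpNorm b p μ).toReal := by
  have hU : UniqueDiffOn ℝ U := uniqueDiffOn_convex hconv hint
  have hp0 : p ≠ 0 := (zero_lt_one.trans_le Fact.out).ne'
  -- Stated for every target space, because the induction on k replaces F by the space of linear
  -- maps from E to F.
  have hbd : ∀ {k : ℕ} {F : Type} [NormedAddCommGroup F] [NormedSpace ℝ F] {f : E → Y → F}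
      {Φ : E → Lp F p μ}, (∀ x ∈ U, Φ x =ᵐ[μ] f x) →
      (∀ᵐ y ∂μ, HolderOn k θ U (fun x => f x y) (b y)) →
      ∀ x ∈ U, ‖Φ x‖ ≤ (eLpNorm b p μ).toReal := by
    intro k F _ _ f Φ hΦ hf x hx
    have := norm_lp_le_of_ae_bound (Φ := Φ x) hb zero_le_one (by
      filter_upwards [hΦ x hx, hf] with y h1 h2
      rw [h1, one_mul]; exact h2.norm_le hx)
    simpa using this
  induction k generalizing F with
  | zero =>
    rw [holderOn_zero_iff]
    refine ⟨fun x₀ hx₀ => ?_, hbd hΦ hf, fun x hx z hz => ?_⟩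
    · rw [ContinuousWithinAt, Lp.tendsto_Lp_iff_tendsto_eLpNorm']
      have hsub : ∀ x ∈ U, (⇑(Φ x) - ⇑(Φ x₀)) =ᵐ[μ] fun y => f x y - f x₀ y := fun x hx =>
        (hΦ x hx).sub (hΦ x₀ hx₀)
      have : Tendsto (fun x => eLpNorm (fun y => f x y - f x₀ y) p μ) (𝓝[U] x₀) (𝓝 0) := by
        refine tendsto_eLpNorm_zero_of_dominated hp0 hp (g := fun y => 2 * b y) ?_ (hb.const_mul 2) ?_ ?_
        · filter_upwards [self_mem_nhdsWithin] with x hx using (hm x hx).sub (hm x₀ hx₀)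
        · filter_upwards [self_mem_nhdsWithin] with x hx
          filter_upwards [hf] with y hy
          refine (norm_sub_le _ _).trans ?_
          linarith [hy.norm_le hx, hy.norm_le hx₀]
        · filter_upwards [hf] with y hy
          have := ((holderOn_zero_iff.1 hy).1 x₀ hx₀).sub_const (f x₀ y)
          simpa [ContinuousWithinAt] using this
      refine this.congr' ?_
      filter_upwards [self_mem_nhdsWithin] with x hx using (eLpNorm_congr_ae (hsub x hx)).symm
    · refine norm_lp_le_of_ae_bound hb (by positivity) ?_
      filter_upwards [Lp.coeFn_sub (Φ x) (Φ z), hΦ x hx, hΦ z hz, hf] with y h1 h2 h3 h4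
      rw [h1, Pi.sub_apply, h2, h3, mul_comm]
      exact (holderOn_zero_iff.1 h4).2.2 x hx z hz
  | succ k ih =>
    have hf' : ∀ᵐ y ∂μ, (∀ x ∈ U, ‖f x y‖ ≤ b y) ∧ DifferentiableOn ℝ (fun x => f x y) U ∧
        HolderOn k θ U (fderivWithin ℝ (fun x => f x y) U) (b y) := by
      filter_upwards [hf] with y hy using (holderOn_succ_iff hU).1 hy
    have hd : ∀ᵐ y ∂μ, DifferentiableOn ℝ (fun x => f x y) U ∧
        ∀ x ∈ U, ‖fderivWithin ℝ (fun x => f x y) U x‖ ≤ b y := by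
      filter_upwards [hf'] with y hy using ⟨hy.2.1, fun x hx => hy.2.2.norm_le hx⟩
    have hDm : ∀ x ∈ U, AEStronglyMeasurable (fun y => fderivWithin ℝ (fun x => f x y) U x) μ :=
      fun x hx => aestronglyMeasurable_clm_of_apply fun v =>
        aestronglyMeasurable_fderivWithin_apply hconv hint hm (hd.mono fun y hy => hy.1) hx v
    have hmem : ∀ x ∈ U, MemLp (fun y => fderivWithin ℝ (fun x => f x y) U x) p μ := fun x hx =>
      hb.mono (hDm x hx) (by
        filter_upwards [hd] with y hy using (hy.2 x hx).trans (le_abs_self _))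
    classical
    let Ψ : E → Lp (E →L[ℝ] F) p μ := fun x => if hx : x ∈ U then (hmem x hx).toLp else 0
    have hΨ : ∀ x ∈ U, Ψ x =ᵐ[μ] fun y => fderivWithin ℝ (fun x => f x y) U x := fun x hx => by
      simp only [Ψ, hx, dif_pos]
      exact MemLp.coeFn_toLp _
    -- The derivatives in x, viewed as an L^p class of linear maps, form a family with the same
    -- majorant b. The map `lpFlip`, of norm at most one, turns this class into the derivative of Φ.
    have ih' := ih (f := fun x y => fderivWithin ℝ (fun x => f x y) U x) hDm
      (hf'.mono fun y hy => hy.2.2) hΨ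
    have hder : ∀ x ∈ U, HasFDerivWithinAt Φ (lpFlip E F μ p (Ψ x)) U x := fun x hx =>
      hasFDerivWithinAt_lp hp hconv hb hd hΦ hx (hΨ x hx)
    rw [holderOn_succ_iff hU]
    refine ⟨hbd hΦ hf, fun x hx => (hder x hx).differentiableWithinAt, ?_⟩
    refine ((ih'.clm_comp hU (lpFlip E F μ p)).mono ?_).congr fun x hx =>
      (hder x hx).fderivWithin (hU x hx)
    calc _ ≤ 1 * (eLpNorm b p μ).toReal := by gcongr; exact norm_lpFlip_le
      _ = _ := one_mul _

end Lift

/-! ### Integrals depending on a parameter -/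

section Integral

variable {E F : Type} [NormedAddCommGroup E] [NormedSpace ℝ E] [FiniteDimensional ℝ E]
  [NormedAddCommGroup F] [NormedSpace ℝ F] [CompleteSpace F]
  {Y : Type} [MeasurableSpace Y] {μ : Measure Y}

theorem exists_lp_lift {U : Set E} {p : ENNReal} {f : E → Y → F}
    (h : ∀ x ∈ U, MemLp (f x) p μ) : ∃ Φ : E → Lp F p μ, ∀ x ∈ U, Φ x =ᵐ[μ] f x := by
  classical
  refine ⟨fun x => if hx : x ∈ U then (h x hx).toLp else 0, fun x hx => ?_⟩
  simp only [hx, dif_pos]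
  exact MemLp.coeFn_toLp _

/-- The integral is a continuous linear functional on L¹ of norm at most one; it is applied to the
Hölder map into L¹ that lifts f. -/
theorem HolderOn.integral {U : Set E} (hconv : Convex ℝ U)
    (hint : (interior U).Nonempty) {k : ℕ} {θ : ℝ} {f : E → Y → F} {b : Y → ℝ}
    (hb : Integrable b μ) (hm : ∀ x ∈ U, AEStronglyMeasurable (f x) μ)
    (hf : ∀ᵐ y ∂μ, HolderOn k θ U (fun x => f x y) (b y)) :
    HolderOn k θ U (fun x => ∫ y, f x y ∂μ) (∫ y, ‖b y‖ ∂μ) := by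
  have hU : UniqueDiffOn ℝ U := uniqueDiffOn_convex hconv hint
  have hb1 : MemLp b 1 μ := memLp_one_iff_integrable.2 hb
  obtain ⟨Φ, hΦ⟩ := exists_lp_lift (U := U) (p := 1) (μ := μ) (f := f) fun x hx =>
    hb1.mono (hm x hx) (by
      filter_upwards [hf] with y hy using (hy.norm_le hx).trans (le_abs_self _))
  have h1 := holderOn_lp ENNReal.one_ne_top hconv hint hb1 hm hf hΦ
  have h2 := (h1.clm_comp hU (L1.integralCLM (E := F) (μ := μ))).congr
    (g := fun x => ∫ y, f x y ∂μ) fun x hx => by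
      change _ = L1.integralCLM (Φ x)
      rw [← L1.integral_eq, L1.integral_eq_integral]
      exact integral_congr_ae (hΦ x hx).symm
  refine h2.mono ?_
  have h3 : (eLpNorm b 1 μ).toReal = ∫ y, ‖b y‖ ∂μ := by
    rw [eLpNorm_one_eq_lintegral_enorm, integral_norm_eq_lintegral_enorm hb.1]
  rw [h3]
  calc _ ≤ 1 * ∫ y, ‖b y‖ ∂μ := by
        gcongr
        exact L1.norm_Integral_le_one
    _ = _ := one_mul _

/-- Differentiation under the integral sign on a convex set. -/
theorem hasFDerivWithinAt_integral {U : Set E} (hconv : Convex ℝ U)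
    (hint : (interior U).Nonempty) {f : E → Y → F} {D : E → Y → E →L[ℝ] F} {b : Y → ℝ}
    (hb : Integrable b μ) (hi : ∀ x ∈ U, Integrable (f x) μ)
    (hd : ∀ y, ∀ x ∈ U, HasFDerivWithinAt (fun x => f x y) (D x y) U x)
    (hD : ∀ y, ∀ x ∈ U, ‖D x y‖ ≤ b y)
    {x₀ : E} (hx₀ : x₀ ∈ U) {L : E →L[ℝ] F} (hL : ∀ v, L v = ∫ y, D x₀ y v ∂μ) :
    HasFDerivWithinAt (fun x => ∫ y, f x y ∂μ) L U x₀ := by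
  have hU : UniqueDiffOn ℝ U := uniqueDiffOn_convex hconv hint
  have hb1 : MemLp b 1 μ := memLp_one_iff_integrable.2 hb
  have hfd : ∀ y, ∀ x ∈ U, fderivWithin ℝ (fun x => f x y) U x = D x y := fun y x hx =>
    (hd y x hx).fderivWithin (hU x hx)
  have hdiff : ∀ y, DifferentiableOn ℝ (fun x => f x y) U := fun y x hx =>
    (hd y x hx).differentiableWithinAt
  obtain ⟨Φ, hΦ⟩ := exists_lp_lift (U := U) (p := 1) (μ := μ) (f := f) fun x hx =>
    memLp_one_iff_integrable.2 (hi x hx)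
  have hDm : AEStronglyMeasurable (fun y => fderivWithin ℝ (fun x => f x y) U x₀) μ :=
    aestronglyMeasurable_clm_of_apply fun v =>
      aestronglyMeasurable_fderivWithin_apply hconv hint (fun x hx => (hi x hx).1)
        (Eventually.of_forall hdiff) hx₀ v
  have hmem : MemLp (fun y => fderivWithin ℝ (fun x => f x y) U x₀) 1 μ :=
    hb1.mono hDm (Eventually.of_forall fun y => by
      rw [hfd y x₀ hx₀]; exact (hD y x₀ hx₀).trans (le_abs_self _))
  have h1 := hasFDerivWithinAt_lp ENNReal.one_ne_top hconv hb1
    (Eventually.of_forall fun y => ⟨hdiff y, fun x hx => by rw [hfd y x hx]; exact hD y x hx⟩)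
    hΦ hx₀ (MemLp.coeFn_toLp hmem)
  have h2 := ((L1.integralCLM (E := F) (μ := μ)).hasFDerivAt.comp_hasFDerivWithinAt x₀ h1)
  have h3 : (L1.integralCLM (E := F) (μ := μ)).comp (lpFlip E F μ 1 hmem.toLp) = L := by
    ext v
    rw [ContinuousLinearMap.comp_apply, hL, ← L1.integral_eq, L1.integral_eq_integral]
    refine integral_congr_ae ?_
    filter_upwards [coeFn_lpFlip hmem.toLp v, MemLp.coeFn_toLp hmem] with y hy hy2
    rw [hy, hy2, hfd y x₀ hx₀]
  rw [h3] at h2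
  refine h2.congr (fun x hx => ?_) ?_
  · rw [Function.comp_apply, ← L1.integral_eq, L1.integral_eq_integral]
    exact integral_congr_ae (hΦ x hx).symm
  · rw [Function.comp_apply, ← L1.integral_eq, L1.integral_eq_integral]
    exact integral_congr_ae (hΦ x₀ hx₀).symm

end Integral

/-! ### Partial derivatives of smooth functions on a quarter space -/

theorem partialD_zero {n : ℕ} (a : Fin 0 → Fin n) (f : Eu n → ℂ) (ξ : Eu n) :
    partialD a f ξ = f ξ := by
  simp [partialD]

/-- The last index is differentiated first. Inductions on r peel it off and continue with the
derivative of f, so they have to be general in f. -/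
theorem partialD_succ {n r : ℕ} (a : Fin (r + 1) → Fin n) {f : Eu n → ℂ} (hf : ContDiff ℝ ∞ f)
    (ξ : Eu n) : partialD a f ξ = partialD (Fin.init a)
      (fun η => fderiv ℝ f η (EuclideanSpace.single (a (Fin.last r)) 1)) ξ := by
  have h1 : ContDiff ℝ ∞ (fderiv ℝ f) := hf.fderiv_right (by simp)
  have h2 := (ContinuousLinearMap.apply ℝ ℂ
    (EuclideanSpace.single (a (Fin.last r)) (1 : ℝ))).iteratedFDeriv_comp_left
      (x := ξ) (i := r) h1.contDiffAt (by exact_mod_cast le_top)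
  rw [partialD, partialD, iteratedFDeriv_succ_apply_right]
  exact (congrArg (fun M => M fun i => EuclideanSpace.single (Fin.init a i) (1 : ℝ)) h2).symm

theorem partialD_congr {n r : ℕ} (a : Fin r → Fin n) {f g : Eu n → ℂ} (h : ∀ ξ, f ξ = g ξ)
    (ξ : Eu n) : partialD a f ξ = partialD a g ξ := by
  rw [funext h]

/-- The quarter space of points `(ξ, y, w)` with `y, w ≥ 0`. -/
def quad (d : ℕ) : Set (Eu d × ℝ × ℝ) := univ ×ˢ (Ici 0 ×ˢ Ici 0)

theorem mem_quad {d : ℕ} {q : Eu d × ℝ × ℝ} : q ∈ quad d ↔ 0 ≤ q.2.1 ∧ 0 ≤ q.2.2 := by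
  rw [quad, mem_prod, mem_prod]
  simp

theorem convex_quad (d : ℕ) : Convex ℝ (quad d) :=
  convex_univ.prod ((convex_Ici 0).prod (convex_Ici 0))

theorem interior_quad_nonempty (d : ℕ) : (interior (quad d)).Nonempty := by
  refine ⟨(0, 1, 1), ?_⟩
  rw [quad, interior_prod_eq, interior_prod_eq]
  simp only [interior_univ, interior_Ici, mem_prod, mem_univ, true_and, mem_Ioi]
  norm_num

theorem uniqueDiffOn_quad (d : ℕ) : UniqueDiffOn ℝ (quad d) :=
  uniqueDiffOn_convex (convex_quad d) (interior_quad_nonempty d)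

/-- Functions on the quarter space that are smooth up to the boundary. -/
@[ext]
structure Smooth (d : ℕ) where
  /-- the underlying function -/
  fn : Eu d × ℝ × ℝ → ℂ
  smooth : ContDiffOn ℝ ∞ fn (quad d)

namespace Smooth

variable {d : ℕ}

/-- The derivative of a smooth function in the direction `v`. -/
def D (v : Eu d × ℝ × ℝ) (G : Smooth d) : Smooth d :=
  -- The value zero off the quarter space makes the commutation rules equalities of functions on the
  -- whole space. They can then be used for rewriting and iterated as commuting self-maps of `Smooth
  -- d`.
  ⟨(quad d).indicator fun q => fderivWithin ℝ G.1 (quad d) q v, by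
    have h1 : ContDiffOn ℝ ∞ (fderivWithin ℝ G.1 (quad d)) (quad d) :=
      G.2.fderivWithin (uniqueDiffOn_quad d) (by simp)
    exact (h1.clm_apply contDiffOn_const).congr fun q hq => by rw [indicator_of_mem hq]⟩

theorem D_apply (v : Eu d × ℝ × ℝ) (G : Smooth d) {q : Eu d × ℝ × ℝ} (hq : q ∈ quad d) :
    (D v G).1 q = fderivWithin ℝ G.1 (quad d) q v := by
  simp only [D]
  rw [indicator_of_mem hq]

theorem D_apply_of_notMem (v : Eu d × ℝ × ℝ) (G : Smooth d) {q : Eu d × ℝ × ℝ} (hq : q ∉ quad d) :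
    (D v G).1 q = 0 := by
  simp only [D]
  rw [indicator_of_notMem hq]

theorem hasFDerivWithinAt (G : Smooth d) {q : Eu d × ℝ × ℝ} (hq : q ∈ quad d) :
    HasFDerivWithinAt G.1 (fderivWithin ℝ G.1 (quad d) q) (quad d) q :=
  (G.2.differentiableOn (by simp) q hq).hasFDerivWithinAt

theorem D_comm (v w : Eu d × ℝ × ℝ) (G : Smooth d) : D v (D w G) = D w (D v G) := by
  have h1 : ContDiffOn ℝ ∞ (fderivWithin ℝ G.1 (quad d)) (quad d) :=
    G.2.fderivWithin (uniqueDiffOn_quad d) (by simp)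
  have key : ∀ v w : Eu d × ℝ × ℝ, ∀ q ∈ quad d, (D v (D w G)).1 q
      = fderivWithin ℝ (fderivWithin ℝ G.1 (quad d)) (quad d) q v w := fun v w q hq => by
    rw [D_apply _ _ hq, fderivWithin_congr (fun q hq => D_apply w G hq) (D_apply w G hq)]
    have h2 := ((h1.differentiableOn (by simp) q hq).hasFDerivWithinAt.clm_apply
      (hasFDerivWithinAt_const w q (quad d))).fderivWithin (uniqueDiffOn_quad d q hq)
    rw [h2]
    simp
  refine Smooth.ext (funext fun q => ?_)
  by_cases hq : q ∈ quad d
  · rw [key v w q hq, key w v q hq]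
    -- Symmetry of second derivatives within a set holds at points in the closure of its interior.
    -- For a convex set with interior points these include all of its points, also the boundary
    -- ones.
    refine (G.2 q hq).isSymmSndFDerivWithinAt (by
      rw [minSmoothness_of_isRCLikeNormedField]; exact WithTop.coe_le_coe.2 (OrderTop.le_top _)) (uniqueDiffOn_quad d) ?_ hq v w
    rw [(convex_quad d).closure_interior_eq_closure_of_nonempty_interior (interior_quad_nonempty d)]
    exact subset_closure hq
  · rw [D_apply_of_notMem _ _ hq, D_apply_of_notMem _ _ hq]

variable (d) in
/-- The first normal direction. -/
def ey : Eu d × ℝ × ℝ := (0, 1, 0)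

variable (d) in
/-- The second normal direction. -/
def ew : Eu d × ℝ × ℝ := (0, 0, 1)

/-- The tangential directions. -/
def ex (j : Fin d) : Eu d × ℝ × ℝ := (EuclideanSpace.single j 1, 0, 0)

theorem hasDerivWithinAt_y (G : Smooth d) (ξ : Eu d) {y w : ℝ} (hy : 0 ≤ y) (hw : 0 ≤ w) :
    HasDerivWithinAt (fun s => G.1 (ξ, s, w)) ((D (ey d) G).1 (ξ, y, w)) (Ici 0) y := by
  have hq : (ξ, y, w) ∈ quad d := mem_quad.2 ⟨hy, hw⟩
  rw [D_apply _ _ hq]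
  refine (G.hasFDerivWithinAt hq).comp_hasDerivWithinAt (f := fun s => (ξ, s, w)) y ?_ ?_
  · exact (hasDerivWithinAt_const y (Ici 0) ξ).prodMk
      ((hasDerivWithinAt_id y (Ici 0)).prodMk (hasDerivWithinAt_const y (Ici 0) w))
  · exact fun s hs => mem_quad.2 ⟨hs, hw⟩

theorem hasDerivWithinAt_w (G : Smooth d) (ξ : Eu d) {y w : ℝ} (hy : 0 ≤ y) (hw : 0 ≤ w) :
    HasDerivWithinAt (fun s => G.1 (ξ, y, s)) ((D (ew d) G).1 (ξ, y, w)) (Ici 0) w := by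
  have hq : (ξ, y, w) ∈ quad d := mem_quad.2 ⟨hy, hw⟩
  rw [D_apply _ _ hq]
  refine (G.hasFDerivWithinAt hq).comp_hasDerivWithinAt (f := fun s => (ξ, y, s)) w ?_ ?_
  · exact (hasDerivWithinAt_const w (Ici 0) ξ).prodMk
      ((hasDerivWithinAt_const w (Ici 0) y).prodMk (hasDerivWithinAt_id w (Ici 0)))
  · exact fun s hs => mem_quad.2 ⟨hy, hs⟩

theorem hasFDerivAt_x (G : Smooth d) (ξ : Eu d) {y w : ℝ} (hy : 0 ≤ y) (hw : 0 ≤ w) :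
    HasFDerivAt (fun η => G.1 (η, y, w)) ((fderivWithin ℝ G.1 (quad d) (ξ, y, w)).comp
      (ContinuousLinearMap.inl ℝ (Eu d) (ℝ × ℝ))) ξ := by
  have hq : (ξ, y, w) ∈ quad d := mem_quad.2 ⟨hy, hw⟩
  rw [← hasFDerivWithinAt_univ]
  refine (G.hasFDerivWithinAt hq).comp (f := fun η => (η, y, w)) ξ ?_ ?_
  · exact (hasFDerivAt_prodMk_left ξ (y, w)).hasFDerivWithinAt
  · exact fun s _ => mem_quad.2 ⟨hy, hw⟩

theorem contDiff_x (G : Smooth d) {y w : ℝ} (hy : 0 ≤ y) (hw : 0 ≤ w) :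
    ContDiff ℝ ∞ fun η => G.1 (η, y, w) := by
  rw [← contDiffOn_univ]
  exact G.2.comp (t := quad d) (f := fun η => (η, y, w))
    ((contDiff_id.prodMk contDiff_const).contDiffOn) fun s _ => mem_quad.2 ⟨hy, hw⟩

/-- Iterated tangential derivatives. -/
def Dtan : {r : ℕ} → (Fin r → Fin d) → Smooth d → Smooth d
  | 0, _, G => G
  | _ + 1, a, G => Dtan (Fin.init a) (D (ex (a (Fin.last _))) G)

/-- Mixed derivatives. -/
def mix {r : ℕ} (a : Fin r → Fin d) (k l : ℕ) (G : Smooth d) : Smooth d :=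
  Dtan a ((D (ey d))^[k] ((D (ew d))^[l] G))

theorem D_Dtan (v : Eu d × ℝ × ℝ) {r : ℕ} (a : Fin r → Fin d) (G : Smooth d) :
    D v (Dtan a G) = Dtan a (D v G) := by
  induction r generalizing G with
  | zero => rfl
  | succ r ih => rw [Dtan, ih, D_comm, ← Dtan]

theorem D_iterate_comm (v w : Eu d × ℝ × ℝ) (k : ℕ) (G : Smooth d) :
    D v ((D w)^[k] G) = (D w)^[k] (D v G) :=
  Function.Commute.iterate_right (f := D v) (g := D w) (fun G => D_comm v w G) k G

theorem D_ey_mix {r : ℕ} (a : Fin r → Fin d) (k l : ℕ) (G : Smooth d) :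
    D (ey d) (mix a k l G) = mix a (k + 1) l G := by
  rw [mix, D_Dtan, mix, Function.iterate_succ_apply']

theorem D_ew_mix {r : ℕ} (a : Fin r → Fin d) (k l : ℕ) (G : Smooth d) :
    D (ew d) (mix a k l G) = mix a k (l + 1) G := by
  rw [mix, D_Dtan, D_iterate_comm, mix, Function.iterate_succ_apply']

theorem partialD_eq {r : ℕ} (a : Fin r → Fin d) (G : Smooth d) (ξ : Eu d) {y w : ℝ}
    (hy : 0 ≤ y) (hw : 0 ≤ w) : partialD a (fun η => G.1 (η, y, w)) ξ = (Dtan a G).1 (ξ, y, w) := by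
  induction r generalizing G with
  | zero => rw [partialD_zero, Dtan]
  | succ r ih =>
    rw [partialD_succ a (G.contDiff_x hy hw), Dtan, ← ih]
    refine partialD_congr _ (fun η => ?_) ξ
    rw [(G.hasFDerivAt_x η hy hw).fderiv, D_apply _ _ (mem_quad.2 ⟨hy, hw⟩)]
    rfl

theorem iteratedDerivWithin_y (k : ℕ) (G : Smooth d) (ξ : Eu d) {y w : ℝ} (hy : 0 ≤ y)
    (hw : 0 ≤ w) :
    iteratedDerivWithin k (fun s => G.1 (ξ, s, w)) (Ici 0) y = ((D (ey d))^[k] G).1 (ξ, y, w) := by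
  induction k generalizing y with
  | zero => simp
  | succ k ih =>
    rw [iteratedDerivWithin_succ, derivWithin_congr (𝕜 := ℝ) (s := Ici 0)
      (f := fun s => ((D (ey d))^[k] G).fn (ξ, s, w)) (fun s hs => ih hs) (ih hy),
      Function.iterate_succ_apply']
    exact (hasDerivWithinAt_y _ ξ hy hw).derivWithin (uniqueDiffOn_Ici 0 y hy)

theorem iteratedDerivWithin_w (k : ℕ) (G : Smooth d) (ξ : Eu d) {y w : ℝ} (hy : 0 ≤ y)
    (hw : 0 ≤ w) :
    iteratedDerivWithin k (fun s => G.1 (ξ, y, s)) (Ici 0) w = ((D (ew d))^[k] G).1 (ξ, y, w) := by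
  induction k generalizing w with
  | zero => simp
  | succ k ih =>
    rw [iteratedDerivWithin_succ, derivWithin_congr (𝕜 := ℝ) (s := Ici 0)
      (f := fun s => ((D (ew d))^[k] G).fn (ξ, y, s)) (fun s hs => ih hs) (ih hw),
      Function.iterate_succ_apply']
    exact (hasDerivWithinAt_w _ ξ hy hw).derivWithin (uniqueDiffOn_Ici 0 w hw)

/-- One-sided derivatives on [0, ∞) see only nonnegative arguments, so agreement of g with G there
suffices. -/
theorem mixedD2_inner_eq (G : Smooth d) {g : Eu d → ℝ → ℝ → ℂ}
    (hg : ∀ ξ, ∀ y ≥ 0, ∀ w ≥ 0, g ξ y w = G.1 (ξ, y, w))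
    (k l : ℕ) (ξ : Eu d) {y w : ℝ} (hy : 0 ≤ y) (hw : 0 ≤ w) :
    iteratedDerivWithin k (fun y₁ => iteratedDerivWithin l (g ξ y₁) (Ici 0) w) (Ici 0) y
      = ((D (ey d))^[k] ((D (ew d))^[l] G)).1 (ξ, y, w) := by
  rw [← iteratedDerivWithin_y k _ ξ hy hw]
  refine iteratedDerivWithin_congr (fun s hs => ?_) hy
  rw [← iteratedDerivWithin_w l _ ξ hs hw]
  exact iteratedDerivWithin_congr (fun u hu => hg ξ s hs u hu) hw

theorem mixedD2_eq (G : Smooth d) {g : Eu d → ℝ → ℝ → ℂ}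
    (hg : ∀ ξ, ∀ y ≥ 0, ∀ w ≥ 0, g ξ y w = G.1 (ξ, y, w))
    {r : ℕ} (a : Fin r → Fin d) (k l : ℕ) (ξ : Eu d) {y w : ℝ} (hy : 0 ≤ y) (hw : 0 ≤ w) :
    mixedD2 a k l g ξ y w = (mix a k l G).1 (ξ, y, w) := by
  rw [mix, ← partialD_eq a _ ξ hy hw, mixedD2]
  exact partialD_congr a (fun η => G.mixedD2_inner_eq hg k l η hy hw) ξ

end Smooth

/-- Functions of one normal variable are functions of two that are constant in w. The calculus on
the quarter space then serves both cases. -/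
theorem mixedD_eq_mixedD2 {d r : ℕ} (a : Fin r → Fin d) (l : ℕ) (h : Eu d → ℝ → ℂ) (ξ : Eu d)
    (y w : ℝ) : mixedD a l h ξ y = mixedD2 a l 0 (fun ξ y _ => h ξ y) ξ y w := by
  simp [mixedD, mixedD2]

/-- The smooth function given by a curried function. -/
def Smooth.of {d : ℕ} {g : Eu d → ℝ → ℝ → ℂ}
    (h : ContDiffOn ℝ ∞ (fun q : Eu d × ℝ × ℝ => g q.1 q.2.1 q.2.2) (univ ×ˢ (Ici 0 ×ˢ Ici 0))) :
    Smooth d := ⟨_, h⟩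

theorem contDiffOn_const_extension {d : ℕ} {h : Eu d → ℝ → ℂ}
    (hh : ContDiffOn ℝ ∞ (fun q : Eu d × ℝ => h q.1 q.2) (univ ×ˢ Ici 0)) :
    ContDiffOn ℝ ∞ (fun q : Eu d × ℝ × ℝ => h q.1 q.2.1) (univ ×ˢ (Ici 0 ×ˢ Ici 0)) := by
  refine hh.comp (f := fun q : Eu d × ℝ × ℝ => (q.1, q.2.1)) (by fun_prop) ?_
  rintro ⟨ξ, y, w⟩ ⟨-, hy, -⟩
  exact ⟨trivial, hy⟩

theorem mixedD2_congr {d r : ℕ} (a : Fin r → Fin d) (k l : ℕ) {g g' : Eu d → ℝ → ℝ → ℂ}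
    (h : ∀ ξ, ∀ y ≥ 0, ∀ w ≥ 0, g ξ y w = g' ξ y w) (ξ : Eu d) {y w : ℝ} (hy : 0 ≤ y) (hw : 0 ≤ w) :
    mixedD2 a k l g ξ y w = mixedD2 a k l g' ξ y w := by
  refine partialD_congr a (fun η => ?_) ξ
  refine iteratedDerivWithin_congr (fun s hs => ?_) hy
  exact iteratedDerivWithin_congr (fun u hu => h η s hs u hu) hw

theorem mixedD_congr {d r : ℕ} (a : Fin r → Fin d) (l : ℕ) {g g' : Eu d → ℝ → ℂ}
    (h : ∀ ξ, ∀ y ≥ 0, g ξ y = g' ξ y) (ξ : Eu d) {y : ℝ} (hy : 0 ≤ y) :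
    mixedD a l g ξ y = mixedD a l g' ξ y := by
  rw [mixedD_eq_mixedD2 a l g ξ y 0, mixedD_eq_mixedD2 a l g' ξ y 0]
  exact mixedD2_congr a l 0 (fun ξ y hy _ _ => h ξ y hy) ξ hy le_rfl

/-! ### Monomials, weights and derivatives -/

theorem monom_zero {n : ℕ} (z : Eu n) : monom 0 z = 1 := by simp [monom]

theorem monom_add {n : ℕ} (β γ : Fin n → ℕ) (z : Eu n) :
    monom (β + γ) z = monom β z * monom γ z := by
  simp [monom, pow_add, Finset.prod_mul_distrib]

theorem monom_single {n : ℕ} (j : Fin n) (m : ℕ) (z : Eu n) : monom (Pi.single j m) z = z j ^ m := by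
  rw [monom, Finset.prod_eq_single j]
  · simp
  · intro i _ hi
    simp [hi]
  · simp

/-- Induction on the total degree. Raising one exponent by one corresponds to one integration by
parts in the Fourier integral. -/
theorem monom_induction {n : ℕ} {P : (Fin n → ℕ) → Prop} (h0 : P 0)
    (hs : ∀ β j, P β → P (β + Pi.single j 1)) (β : Fin n → ℕ) : P β := by
  obtain ⟨m, hm⟩ : ∃ m, ∑ i, β i = m := ⟨_, rfl⟩
  induction m generalizing β with
  | zero =>
    have : β = 0 := by
      funext i
      exact Finset.sum_eq_zero_iff.1 hm i (Finset.mem_univ i)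
    rwa [this]
  | succ m ih =>
    obtain ⟨j, hj⟩ : ∃ j, β j ≠ 0 := by
      by_contra! h
      simp [h] at hm
    have hle : (Pi.single j 1 : Fin n → ℕ) ≤ β := by
      intro i
      by_cases hi : i = j
      · subst hi; simp; omega
      · simp [hi]
    rw [← tsub_add_cancel_of_le hle]
    refine hs _ j (ih _ ?_)
    have h1 : ∑ i, (β - Pi.single j 1 + Pi.single j 1 : Fin n → ℕ) i = m + 1 := by
      rw [tsub_add_cancel_of_le hle]; exact hm
    simp only [Pi.add_apply, Finset.sum_add_distrib, Finset.sum_pi_single', Finset.mem_univ,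
      if_true] at h1
    have h2 : ∑ i, (Pi.single j 1 : Fin n → ℕ) i = 1 := by simp
    omega

/-- The weight `1 + |ξ|²`. -/
def wt {n : ℕ} (ξ : Eu n) : ℝ := 1 + ‖ξ‖ ^ 2

theorem one_le_wt {n : ℕ} (ξ : Eu n) : 1 ≤ wt ξ := by
  rw [wt]; linarith [sq_nonneg ‖ξ‖]

theorem wt_pos {n : ℕ} (ξ : Eu n) : 0 < wt ξ := zero_lt_one.trans_le (one_le_wt ξ)

theorem norm_le_wt {n : ℕ} (ξ : Eu n) : ‖ξ‖ ≤ wt ξ := by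
  rw [wt]; nlinarith [sq_nonneg (‖ξ‖ - 1)]

theorem abs_coord_le_norm {n : ℕ} (ξ : Eu n) (j : Fin n) : |ξ j| ≤ ‖ξ‖ := by
  simpa using PiLp.norm_apply_le ξ j

theorem abs_monom_le {n : ℕ} (β : Fin n → ℕ) (ξ : Eu n) : |monom β ξ| ≤ wt ξ ^ ∑ i, β i := by
  rw [monom, Finset.abs_prod, ← Finset.prod_pow_eq_pow_sum]
  refine Finset.prod_le_prod (fun _ _ => abs_nonneg _) fun i _ => ?_
  rw [abs_pow]
  have := (abs_coord_le_norm ξ i).trans (norm_le_wt ξ)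
  gcongr

/-- The decay is of order 2(n + 1), which exceeds the dimension n. -/
theorem integrable_inv_wt_pow (n : ℕ) :
    Integrable fun ξ : Eu n => (wt ξ ^ (n + 1))⁻¹ := by
  have h : (Module.finrank ℝ (Eu n) : ℝ) < 2 * ((n + 1 : ℕ) : ℝ) := by
    rw [finrank_euclideanSpace_fin]; push_cast; linarith [n.cast_nonneg (α := ℝ)]
  refine (integrable_rpow_neg_one_add_norm_sq h).congr (Eventually.of_forall fun ξ => ?_)
  change (wt ξ) ^ (-(2 * ((n + 1 : ℕ) : ℝ)) / 2) = _
  rw [show -(2 * ((n + 1 : ℕ) : ℝ)) / 2 = -((n + 1 : ℕ) : ℝ) by ring,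
    Real.rpow_neg (wt_pos ξ).le, Real.rpow_natCast]

theorem partialD_add {n r : ℕ} (a : Fin r → Fin n) {f g : Eu n → ℂ} (hf : ContDiff ℝ ∞ f)
    (hg : ContDiff ℝ ∞ g) (ξ : Eu n) :
    partialD a (fun η => f η + g η) ξ = partialD a f ξ + partialD a g ξ := by
  rw [partialD, fun_iteratedFDeriv_add_apply ((hf.of_le (by exact_mod_cast le_top)).contDiffAt)
    ((hg.of_le (by exact_mod_cast le_top)).contDiffAt)]
  rfl

theorem partialD_const_mul {n r : ℕ} (a : Fin r → Fin n) (c : ℂ) {f : Eu n → ℂ}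
    (hf : ContDiff ℝ ∞ f) (ξ : Eu n) :
    partialD a (fun η => c * f η) ξ = c * partialD a f ξ := by
  have := iteratedFDeriv_const_smul_apply' (a := c)
    ((hf.of_le (m := r) (by exact_mod_cast le_top)).contDiffAt (x := ξ))
  simp only [smul_eq_mul] at this
  rw [partialD, this]
  rfl

/-! ### Families of rapidly decreasing functions with Hölder dependence on a parameter -/

/-- A convex set with interior points. -/
structure Body {N : ℕ} (U : Set (Eu N)) : Prop where
  convex : Convex ℝ U
  int : (interior U).Nonempty

theorem Body.unique {N : ℕ} {U : Set (Eu N)} (hU : Body U) : UniqueDiffOn ℝ U :=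
  uniqueDiffOn_convex hU.convex hU.int

theorem body_univ (N : ℕ) : Body (univ : Set (Eu N)) := ⟨convex_univ, by simp⟩

/-- Families of functions that decrease rapidly, uniformly in the Hölder sense. -/
def RapidFam {ι : Type*} {N n : ℕ} (τ : ℝ) (U : Set (Eu N)) (q : ι → Eu N → Eu n → ℂ) : Prop :=
  (∀ i, ∀ x ∈ U, ContDiff ℝ ∞ (q i x)) ∧
  ∀ (r : ℕ) (a : Fin r → Fin n) (β : Fin n → ℕ), ∃ C : ℝ, ∀ i ξ,
    HolderBoundOn τ U (fun x => (monom β ξ : ℂ) * partialD a (q i x) ξ) C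

section Algebra

variable {ι : Type*} {N n : ℕ} {τ : ℝ} {U : Set (Eu N)}

theorem HolderBoundOn.congr {f g : Eu N → ℂ} {B : ℝ}
    (h : HolderBoundOn τ U f B) (hfg : ∀ x ∈ U, g x = f x) : HolderBoundOn τ U g B :=
  HolderOn.congr (k := ⌊τ⌋₊) (θ := τ - ⌊τ⌋₊) h hfg

theorem HolderBoundOn.mono {f : Eu N → ℂ} {B B' : ℝ}
    (h : HolderBoundOn τ U f B) (hB : B ≤ B') : HolderBoundOn τ U f B' :=
  HolderOn.mono (k := ⌊τ⌋₊) (θ := τ - ⌊τ⌋₊) h hB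

theorem HolderBoundOn.norm_le {f : Eu N → ℂ} {B : ℝ}
    (h : HolderBoundOn τ U f B) {x : Eu N} (hx : x ∈ U) : ‖f x‖ ≤ B :=
  HolderOn.norm_le (k := ⌊τ⌋₊) (θ := τ - ⌊τ⌋₊) h hx

theorem HolderBoundOn.add (hU : Body U) {f g : Eu N → ℂ} {B B' : ℝ}
    (h : HolderBoundOn τ U f B) (h' : HolderBoundOn τ U g B') :
    HolderBoundOn τ U (fun x => f x + g x) (B + B') :=
  HolderOn.add (k := ⌊τ⌋₊) (θ := τ - ⌊τ⌋₊) hU.unique h h'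

theorem HolderBoundOn.nonneg (hU : Body U) {f : Eu N → ℂ} {B : ℝ} (h : HolderBoundOn τ U f B) :
    0 ≤ B := by
  obtain ⟨x, hx⟩ := hU.int
  exact (norm_nonneg _).trans (h.norm_le (interior_subset hx))

theorem HolderBoundOn.const_mul (hU : Body U) {f : Eu N → ℂ} {B : ℝ}
    (h : HolderBoundOn τ U f B) (c : ℂ) : HolderBoundOn τ U (fun x => c * f x) (‖c‖ * B) :=
  HolderOn.const_mul (k := ⌊τ⌋₊) (θ := τ - ⌊τ⌋₊) hU.unique h c (h.nonneg hU)

theorem HolderBoundOn.sum (hU : Body U) {κ : Type*} (s : Finset κ) (hs : s.Nonempty)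
    {f : κ → Eu N → ℂ} {B : κ → ℝ} (h : ∀ j ∈ s, HolderBoundOn τ U (f j) (B j)) :
    HolderBoundOn τ U (fun x => ∑ j ∈ s, f j x) (∑ j ∈ s, B j) := by
  classical
  induction hs using Finset.Nonempty.cons_induction with
  | singleton j => simpa using h j (by simp)
  | cons j s hj hs ih =>
    simp only [Finset.sum_cons]
    exact (h j (by simp)).add hU (ih fun i hi => h i (by simp [hi]))

theorem RapidFam.deriv {q : ι → Eu N → Eu n → ℂ} (h : RapidFam τ U q) (j : Fin n) :
    RapidFam τ U fun i x ξ => fderiv ℝ (q i x) ξ (EuclideanSpace.single j 1) := by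
  refine ⟨fun i x hx => ((h.1 i x hx).fderiv_right (by simp)).clm_apply contDiff_const,
    fun r a β => ?_⟩
  obtain ⟨C, hC⟩ := h.2 (r + 1) (Fin.snoc a j) β
  refine ⟨C, fun i ξ => (hC i ξ).congr fun x hx => ?_⟩
  rw [partialD_succ _ (h.1 i x hx)]
  simp

theorem RapidFam.const_mul (hU : Body U) {q : ι → Eu N → Eu n → ℂ} (h : RapidFam τ U q) (c : ℂ) :
    RapidFam τ U fun i x ξ => c * q i x ξ := by
  refine ⟨fun i x hx => contDiff_const.mul (h.1 i x hx), fun r a β => ?_⟩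
  obtain ⟨C, hC⟩ := h.2 r a β
  refine ⟨‖c‖ * C, fun i ξ => ((hC i ξ).const_mul hU c).congr fun x hx => ?_⟩
  rw [partialD_const_mul _ _ (h.1 i x hx)]
  ring

/-- The coordinate `ξ ↦ ξ_j` as a complex valued linear map. -/
def coordC (n : ℕ) (j : Fin n) : Eu n →L[ℝ] ℂ :=
  Complex.ofRealCLM.comp (EuclideanSpace.proj j : Eu n →L[ℝ] ℝ)

theorem coordC_apply {n : ℕ} (j : Fin n) (ξ : Eu n) : coordC n j ξ = (ξ j : ℂ) := rfl

theorem contDiff_coord {n : ℕ} (j : Fin n) : ContDiff ℝ ∞ fun ξ : Eu n => ((ξ j : ℝ) : ℂ) :=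
  (coordC n j).contDiff

theorem hasFDerivAt_coord {n : ℕ} (j : Fin n) (ξ : Eu n) :
    HasFDerivAt (fun ξ : Eu n => ((ξ j : ℝ) : ℂ)) (coordC n j) ξ :=
  (coordC n j).hasFDerivAt

theorem fderiv_coord_mul {f : Eu n → ℂ} (hf : ContDiff ℝ ∞ f) (j l : Fin n) (ξ : Eu n) :
    fderiv ℝ (fun η : Eu n => ((η j : ℝ) : ℂ) * f η) ξ (EuclideanSpace.single l 1)
      = (if j = l then f ξ else 0) + (ξ j : ℂ) * fderiv ℝ f ξ (EuclideanSpace.single l 1) := by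
  have h1 := (hasFDerivAt_coord j ξ).mul (hf.differentiable (by simp) ξ).hasFDerivAt
  have h2 : HasFDerivAt (fun η : Eu n => ((η j : ℝ) : ℂ) * f η) _ ξ := h1
  rw [h2.fderiv]
  by_cases hjl : j = l
  · subst hjl; simp [add_comm, coordC_apply]
  · simp [hjl, coordC_apply]

/-- Leibniz rule: differentiating ξ_j q in direction l gives ξ_j times a derivative of q, plus q
itself if l = j. Derivatives of rapid families are rapid, hence the induction on r over all
families. -/
theorem RapidFam.coord_mul (hU : Body U) {q : ι → Eu N → Eu n → ℂ} (h : RapidFam τ U q)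
    (j : Fin n) : RapidFam τ U fun i x ξ => (ξ j : ℂ) * q i x ξ := by
  refine ⟨fun i x hx => (contDiff_coord j).mul (h.1 i x hx), fun r => ?_⟩
  induction r generalizing q with
  | zero =>
    intro a β
    obtain ⟨C, hC⟩ := h.2 0 a (β + Pi.single j 1)
    refine ⟨C, fun i ξ => (hC i ξ).congr fun x hx => ?_⟩
    rw [partialD_zero, partialD_zero, monom_add, monom_single]
    push_cast
    ring
  | succ r ih =>
    intro a β
    obtain ⟨C, hC⟩ := ih (h.deriv (a (Fin.last r))) (Fin.init a) β
    obtain ⟨C', hC'⟩ := h.2 r (Fin.init a) β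
    have hsm : ∀ i, ∀ x ∈ U, ContDiff ℝ ∞ fun ξ : Eu n =>
        (ξ j : ℂ) * fderiv ℝ (q i x) ξ (EuclideanSpace.single (a (Fin.last r)) 1) :=
      fun i x hx => (contDiff_coord j).mul ((h.deriv (a (Fin.last r))).1 i x hx)
    by_cases hj : j = a (Fin.last r)
    · refine ⟨C' + C, fun i ξ => ((hC' i ξ).add hU (hC i ξ)).congr fun x hx => ?_⟩
      rw [partialD_succ _ ((contDiff_coord j).mul (h.1 i x hx)),
        partialD_congr _ (fderiv_coord_mul (h.1 i x hx) j _)]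
      simp only [if_pos hj]
      rw [partialD_add _ (h.1 i x hx) (hsm i x hx)]
      ring
    · refine ⟨C, fun i ξ => (hC i ξ).congr fun x hx => ?_⟩
      rw [partialD_succ _ ((contDiff_coord j).mul (h.1 i x hx)),
        partialD_congr _ (fderiv_coord_mul (h.1 i x hx) j _)]
      simp only [if_neg hj, zero_add]

/-- Bounds for all monomials give bounds for all powers of the weight. -/
theorem exists_weight_bound (hU : Body U) {φ : ι → Eu N → Eu n → ℂ}
    (h : ∀ β : Fin n → ℕ, ∃ C : ℝ, ∀ i ξ, HolderBoundOn τ U (fun x => (monom β ξ : ℂ) * φ i x ξ) C)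
    (M : ℕ) : ∃ C : ℝ, 0 ≤ C ∧ ∀ i ξ, HolderBoundOn τ U (fun x => φ i x ξ) (C * (wt ξ ^ M)⁻¹) := by
  -- Each factor 1 + Σ ξ_j² of the weight is expanded, and the term ξ_j² raises the exponent of ξ_j
  -- in the monomial by two. The induction therefore runs over all β at once.
  have key : ∀ M : ℕ, ∀ β : Fin n → ℕ, ∃ C : ℝ, ∀ i ξ,
      HolderBoundOn τ U (fun x => ((wt ξ ^ M : ℝ) : ℂ) * ((monom β ξ : ℂ) * φ i x ξ)) C := by
    intro M
    induction M with
    | zero => intro β; simpa using h β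
    | succ M ih =>
      intro β
      choose C hC using fun j => ih (β + Pi.single j 2)
      obtain ⟨C0, hC0⟩ := ih β
      -- In dimension zero the sum over j is empty and the weight is 1.
      rcases isEmpty_or_nonempty (Fin n) with he | hne
      · refine ⟨C0, fun i ξ => (hC0 i ξ).congr fun x hx => ?_⟩
        have : wt ξ = 1 := by rw [wt, EuclideanSpace.norm_sq_eq]; simp
        simp [this]
      · refine ⟨C0 + ∑ j, C j, fun i ξ => ((hC0 i ξ).add hU (HolderBoundOn.sum hU Finset.univ
          Finset.univ_nonempty fun j _ => hC j i ξ)).congr fun x hx => ?_⟩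
        have hw : ((wt ξ : ℝ) : ℂ) = 1 + ∑ j, (ξ j : ℂ) ^ 2 := by
          rw [wt, EuclideanSpace.norm_sq_eq]; simp
        simp only [monom_add, monom_single]
        push_cast
        rw [pow_succ, hw, mul_add, mul_one, add_mul]
        congr 1
        rw [Finset.mul_sum, Finset.sum_mul]
        exact Finset.sum_congr rfl fun j _ => by ring
  obtain ⟨C, hC⟩ := key M 0
  refine ⟨|C|, abs_nonneg C, fun i ξ => ?_⟩
  have hw : (0 : ℝ) < wt ξ ^ M := pow_pos (wt_pos ξ) M
  refine (((hC i ξ).const_mul hU ((wt ξ ^ M : ℝ) : ℂ)⁻¹).congr fun x hx => ?_).mono ?_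
  · rw [monom_zero, ← mul_assoc, inv_mul_cancel₀ (by exact_mod_cast hw.ne')]
    simp
  · rw [norm_inv, Complex.norm_real, Real.norm_of_nonneg hw.le, mul_comm]
    gcongr
    exact le_abs_self C

/-- Converse of `exists_weight_bound`: the monomial is at most the power |β| of the weight. -/
theorem exists_monom_bound (hU : Body U) {φ : ι → Eu N → Eu n → ℂ}
    (h : ∀ M : ℕ, ∃ C : ℝ, ∀ i ξ, HolderBoundOn τ U (fun x => φ i x ξ) (C * (wt ξ ^ M)⁻¹))
    (β : Fin n → ℕ) :
    ∃ C : ℝ, ∀ i ξ, HolderBoundOn τ U (fun x => (monom β ξ : ℂ) * φ i x ξ) C := by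
  obtain ⟨C, hC⟩ := h (∑ i, β i)
  refine ⟨C, fun i ξ => ((hC i ξ).const_mul hU (monom β ξ)).mono ?_⟩
  have h0 := (hC i ξ).nonneg hU
  have hw : (0 : ℝ) < wt ξ ^ ∑ i, β i := pow_pos (wt_pos ξ) _
  rw [Complex.norm_real, Real.norm_eq_abs]
  calc |monom β ξ| * (C * (wt ξ ^ ∑ i, β i)⁻¹)
      ≤ wt ξ ^ (∑ i, β i) * (C * (wt ξ ^ ∑ i, β i)⁻¹) :=
        mul_le_mul_of_nonneg_right (abs_monom_le β ξ) h0
    _ = C := by field_simp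

theorem RapidFam.weight_bound (hU : Body U) {q : ι → Eu N → Eu n → ℂ} (h : RapidFam τ U q)
    (M : ℕ) : ∃ C : ℝ, 0 ≤ C ∧ ∀ i ξ, HolderBoundOn τ U (fun x => q i x ξ) (C * (wt ξ ^ M)⁻¹) := by
  refine exists_weight_bound hU (fun β => ?_) M
  obtain ⟨C, hC⟩ := h.2 0 Fin.elim0 β
  refine ⟨C, fun i ξ => (hC i ξ).congr fun x hx => by rw [partialD_zero]⟩

end Algebra

/-! ### Fourier integrals of rapidly decreasing functions on the quarter space -/

theorem norm_char {n : ℕ} (x ξ : Eu n) : ‖char x ξ‖ = 1 := by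
  rw [char, mul_comm, Complex.norm_exp_ofReal_mul_I]

theorem continuous_char {n : ℕ} : Continuous fun q : Eu n × Eu n => char q.1 q.2 := by
  unfold char; fun_prop

@[fun_prop]
theorem Continuous.char {X : Type*} [TopologicalSpace X] {n : ℕ} {f g : X → Eu n}
    (hf : Continuous f) (hg : Continuous g) : Continuous fun x => char (f x) (g x) :=
  continuous_char.comp (hf.prodMk hg)

/-- The Fourier integral with character `e^{i s z·ξ}`. -/
def four {n : ℕ} (s : ℝ) (q : Eu n → ℂ) (z : Eu n) : ℂ := ∫ ξ, char (s • z) ξ * q ξ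

/-- A class of functions that is closed under differentiation consists of smooth functions. -/
theorem contDiffOn_of_closed_class {V F : Type*} [NormedAddCommGroup V] [NormedSpace ℝ V]
    [NormedAddCommGroup F] [NormedSpace ℝ F] {S : Set V} (hS : UniqueDiffOn ℝ S)
    {𝓕 : Set (V → F)}
    (h : ∀ f ∈ 𝓕, ∃ D : V → V →L[ℝ] F, (∀ q ∈ S, HasFDerivWithinAt f (D q) S q) ∧
      ∀ n : ℕ, (∀ g ∈ 𝓕, ContDiffOn ℝ n g S) → ContDiffOn ℝ n D S) {f : V → F} (hf : f ∈ 𝓕) :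
    ContDiffOn ℝ ∞ f S := by
  rw [contDiffOn_infty]
  intro n
  induction n generalizing f with
  | zero =>
    obtain ⟨D, hD, -⟩ := h f hf
    exact contDiffOn_zero.2 fun q hq => (hD q hq).continuousWithinAt
  | succ n ih =>
    obtain ⟨D, hD, hn⟩ := h f hf
    rw [Nat.cast_add, Nat.cast_one, contDiffOn_succ_iff_hasFDerivWithinAt_of_uniqueDiffOn hS]
    exact ⟨by simp, D, hn n fun g hg => ih hg, hD⟩

namespace Smooth

variable {d : ℕ}

/-- All normal derivatives decrease rapidly in the tangential variable. -/
def Rapid (G : Smooth d) : Prop :=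
  ∀ M k l : ℕ, ∃ C : ℝ, ∀ q ∈ quad d,
    ‖((D (ey d))^[k] ((D (ew d))^[l] G)).fn q‖ ≤ C * (wt q.1 ^ M)⁻¹

theorem Rapid.D_ey {G : Smooth d} (h : Rapid G) : Rapid (D (ey d) G) := fun M k l => by
  obtain ⟨C, hC⟩ := h M (k + 1) l
  refine ⟨C, fun q hq => ?_⟩
  rw [← D_iterate_comm, ← Function.iterate_succ_apply]
  exact hC q hq

theorem Rapid.D_ew {G : Smooth d} (h : Rapid G) : Rapid (D (ew d) G) := fun M k l => by
  obtain ⟨C, hC⟩ := h M k (l + 1)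
  refine ⟨C, fun q hq => ?_⟩
  rw [← Function.iterate_succ_apply]
  exact hC q hq

theorem Rapid.bound {G : Smooth d} (h : Rapid G) (M : ℕ) : ∃ C : ℝ, 0 ≤ C ∧ ∀ q ∈ quad d,
    ‖G.fn q‖ ≤ C * (wt q.1 ^ M)⁻¹ := by
  obtain ⟨C, hC⟩ := h M 0 0
  refine ⟨|C|, abs_nonneg C, fun q hq => (hC q hq).trans ?_⟩
  have := wt_pos q.1
  gcongr
  exact le_abs_self C

/-- Multiplication by the tangential coordinate `ξ_j`. -/
def mulX (j : Fin d) (G : Smooth d) : Smooth d :=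
  ⟨fun q => coordC d j q.1 * G.fn q,
    (((coordC d j).contDiff.comp contDiff_fst).contDiffOn).mul G.smooth⟩

theorem D_ey_mulX (j : Fin d) (G : Smooth d) : D (ey d) (mulX j G) = mulX j (D (ey d) G) := by
  refine Smooth.ext (funext fun q => ?_)
  by_cases hq : q ∈ quad d
  · obtain ⟨ξ, y, w⟩ := q
    have h := mem_quad.1 hq
    have h1 := (mulX j G).hasDerivWithinAt_y ξ h.1 h.2
    have h2 := (G.hasDerivWithinAt_y ξ h.1 h.2).const_mul (coordC d j ξ)
    exact (uniqueDiffOn_Ici 0 y h.1).eq_deriv _ h1 h2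
  · rw [D_apply_of_notMem _ _ hq]
    simp only [mulX]
    rw [D_apply_of_notMem _ _ hq, mul_zero]

theorem D_ew_mulX (j : Fin d) (G : Smooth d) : D (ew d) (mulX j G) = mulX j (D (ew d) G) := by
  refine Smooth.ext (funext fun q => ?_)
  by_cases hq : q ∈ quad d
  · obtain ⟨ξ, y, w⟩ := q
    have h := mem_quad.1 hq
    have h1 := (mulX j G).hasDerivWithinAt_w ξ h.1 h.2
    have h2 := (G.hasDerivWithinAt_w ξ h.1 h.2).const_mul (coordC d j ξ)
    exact (uniqueDiffOn_Ici 0 w h.2).eq_deriv _ h1 h2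
  · rw [D_apply_of_notMem _ _ hq]
    simp only [mulX]
    rw [D_apply_of_notMem _ _ hq, mul_zero]

theorem Rapid.mulX {G : Smooth d} (h : Rapid G) (j : Fin d) : Rapid (mulX j G) := fun M k l => by
  obtain ⟨C, hC⟩ := h (M + 1) k l
  refine ⟨C, fun q hq => ?_⟩
  have h1 : (D (ey d))^[k] ((D (ew d))^[l] (Smooth.mulX j G))
      = Smooth.mulX j ((D (ey d))^[k] ((D (ew d))^[l] G)) := by
    rw [Function.Commute.iterate_left (f := D (ew d)) (g := Smooth.mulX j) (D_ew_mulX j) l G,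
      Function.Commute.iterate_left (f := D (ey d)) (g := Smooth.mulX j) (D_ey_mulX j) k _]
  rw [h1, Smooth.mulX, norm_mul, coordC_apply, Complex.norm_real, Real.norm_eq_abs]
  have hw := wt_pos q.1
  calc _ ≤ wt q.1 * (C * (wt q.1 ^ (M + 1))⁻¹) := by
        gcongr
        · exact (abs_coord_le_norm _ _).trans (norm_le_wt _)
        · exact hC q hq
    _ = C * (wt q.1 ^ M)⁻¹ := by rw [pow_succ]; field_simp

/-- The partial Fourier integral. -/
def fourFn (s : ℝ) (G : Smooth d) (q : Eu d × ℝ × ℝ) : ℂ :=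
  four s (fun ξ => G.fn (ξ, q.2)) q.1

theorem integrable_slice {G : Smooth d} (hG : Rapid G) {y w : ℝ} (hy : 0 ≤ y) (hw : 0 ≤ w) :
    Integrable fun ξ => G.fn (ξ, y, w) := by
  obtain ⟨C, -, hC⟩ := hG.bound (d + 1)
  exact ((integrable_inv_wt_pow d).const_mul C).mono' (G.contDiff_x hy hw).continuous.aestronglyMeasurable
    (Eventually.of_forall fun ξ => hC _ (mem_quad.2 ⟨hy, hw⟩))

theorem integrable_char_mul {n : ℕ} {f : Eu n → ℂ} (hf : Integrable f) (z : Eu n) :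
    Integrable fun ξ => char z ξ * f ξ :=
  hf.bdd_mul (c := 1) (by fun_prop) (Eventually.of_forall fun ξ => (norm_char _ _).le)

variable (d) in
/-- The first normal coordinate. -/
def pY : Eu d × ℝ × ℝ →L[ℝ] ℂ :=
  Complex.ofRealCLM.comp ((ContinuousLinearMap.fst ℝ ℝ ℝ).comp (ContinuousLinearMap.snd ℝ (Eu d) (ℝ × ℝ)))

variable (d) in
/-- The second normal coordinate. -/
def pW : Eu d × ℝ × ℝ →L[ℝ] ℂ :=
  Complex.ofRealCLM.comp ((ContinuousLinearMap.snd ℝ ℝ ℝ).comp (ContinuousLinearMap.snd ℝ (Eu d) (ℝ × ℝ)))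

/-- The tangential coordinates. -/
def pX (j : Fin d) : Eu d × ℝ × ℝ →L[ℝ] ℂ :=
  (coordC d j).comp (ContinuousLinearMap.fst ℝ (Eu d) (ℝ × ℝ))

/-- The inner product with `ξ` of the tangential part. -/
def pI (ξ : Eu d) : Eu d × ℝ × ℝ →L[ℝ] ℂ :=
  Complex.ofRealCLM.comp ((innerSL ℝ ξ).comp (ContinuousLinearMap.fst ℝ (Eu d) (ℝ × ℝ)))

theorem norm_pY_le : ‖pY d‖ ≤ 1 := by
  refine ContinuousLinearMap.opNorm_le_bound _ zero_le_one fun v => ?_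
  simp only [pY, ContinuousLinearMap.comp_apply, Complex.ofRealCLM_apply, Complex.norm_real, one_mul]
  exact (norm_fst_le v.2).trans (norm_snd_le v)

theorem norm_pW_le : ‖pW d‖ ≤ 1 := by
  refine ContinuousLinearMap.opNorm_le_bound _ zero_le_one fun v => ?_
  simp only [pW, ContinuousLinearMap.comp_apply, Complex.ofRealCLM_apply, Complex.norm_real, one_mul]
  exact (norm_snd_le v.2).trans (norm_snd_le v)

theorem norm_pI_le (ξ : Eu d) : ‖pI ξ‖ ≤ ‖ξ‖ := by
  refine ContinuousLinearMap.opNorm_le_bound _ (norm_nonneg _) fun v => ?_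
  simp only [pI, ContinuousLinearMap.comp_apply, Complex.ofRealCLM_apply, Complex.norm_real,
    innerSL_apply_apply]
  refine (norm_inner_le_norm _ _).trans ?_
  gcongr
  exact norm_fst_le v

theorem pI_eq_sum (ξ : Eu d) (v : Eu d × ℝ × ℝ) : pI ξ v = ∑ j, pX j v * (ξ j : ℂ) := by
  simp only [pI, pX, ContinuousLinearMap.comp_apply, Complex.ofRealCLM_apply, innerSL_apply_apply,
    coordC_apply, PiLp.inner_apply]
  push_cast
  refine Finset.sum_congr rfl fun j _ => ?_
  simp

/-- The derivative of the integrand of the partial Fourier integral. -/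
def fourInt (s : ℝ) (G : Smooth d) (q : Eu d × ℝ × ℝ) (ξ : Eu d) : Eu d × ℝ × ℝ →L[ℝ] ℂ :=
  char (s • q.1) ξ • ((Complex.I * s * G.fn (ξ, q.2)) • pI ξ +
    (D (ey d) G).fn (ξ, q.2) • pY d + (D (ew d) G).fn (ξ, q.2) • pW d)

theorem hasFDerivWithinAt_fourInt (s : ℝ) (G : Smooth d) {q : Eu d × ℝ × ℝ} (hq : q ∈ quad d)
    (ξ : Eu d) : HasFDerivWithinAt (fun q => char (s • q.1) ξ * G.fn (ξ, q.2)) (fourInt s G q ξ)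
      (quad d) q := by
  have hq' : (ξ, q.2) ∈ quad d := mem_quad.2 (mem_quad.1 hq)
  have hchar : (fun q : Eu d × ℝ × ℝ => char (s • q.1) ξ)
      = fun q => Complex.exp ((Complex.I * s) * pI ξ q) := by
    funext q
    rw [char, pI]
    congr 1
    simp only [ContinuousLinearMap.comp_apply, Complex.ofRealCLM_apply, innerSL_apply_apply,
      ContinuousLinearMap.coe_fst', inner_smul_left, real_inner_comm q.1 ξ]
    simp
    ring
  have h1 : HasFDerivAt (fun q : Eu d × ℝ × ℝ => char (s • q.1) ξ)
      (char (s • q.1) ξ • ((Complex.I * s) • pI ξ)) q := by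
    rw [hchar, congrFun hchar q]
    exact ((pI ξ).hasFDerivAt.const_mul (Complex.I * s)).cexp
  have h2 : HasFDerivWithinAt (fun q : Eu d × ℝ × ℝ => G.fn (ξ, q.2))
      ((D (ey d) G).fn (ξ, q.2) • pY d + (D (ew d) G).fn (ξ, q.2) • pW d) (quad d) q := by
    have h3 := (G.hasFDerivWithinAt hq').comp (f := fun q : Eu d × ℝ × ℝ => (ξ, q.2)) q
      ((hasFDerivAt_const ξ q).prodMk
        (ContinuousLinearMap.snd ℝ (Eu d) (ℝ × ℝ)).hasFDerivAt).hasFDerivWithinAt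
      (s := quad d) (fun q hq => mem_quad.2 (mem_quad.1 hq))
    refine h3.congr_fderiv ?_
    ext v
    · have h0 := (fderivWithin ℝ G.fn (quad d) (ξ, q.2)).map_zero
      simp [pY, pW]
      exact h0
    · simp [pY, pW, D_apply _ _ hq', ey]
    · simp [pY, pW, D_apply _ _ hq', ew]
  refine (h1.hasFDerivWithinAt.mul h2).congr_fderiv ?_
  ext v <;> simp [fourInt] <;> ring

theorem exists_fourInt_bound (s : ℝ) {G : Smooth d} (hG : Rapid G) :
    ∃ C, ∀ ξ, ∀ q ∈ quad d, ‖fourInt s G q ξ‖ ≤ C * (wt ξ ^ (d + 1))⁻¹ := by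
  -- The additional power of the weight absorbs the factor |ξ| from the derivative of the character.
  obtain ⟨C0, h0, hC0⟩ := hG.bound (d + 1 + 1)
  obtain ⟨C1, h1, hC1⟩ := hG.D_ey.bound (d + 1)
  obtain ⟨C2, h2, hC2⟩ := hG.D_ew.bound (d + 1)
  refine ⟨|s| * C0 + C1 + C2, fun ξ q hq => ?_⟩
  have hq' : (ξ, q.2) ∈ quad d := mem_quad.2 (mem_quad.1 hq)
  have hw := wt_pos ξ
  rw [fourInt, norm_smul, norm_char, one_mul, add_mul, add_mul]
  refine norm_add_le_of_le (norm_add_le_of_le ?_ ?_) ?_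
  · rw [norm_smul, norm_mul, norm_mul, Complex.norm_I, one_mul, Complex.norm_real, Real.norm_eq_abs]
    calc |s| * ‖G.fn (ξ, q.2)‖ * ‖pI ξ‖ ≤ |s| * (C0 * (wt ξ ^ (d + 1 + 1))⁻¹) * wt ξ := by
          gcongr
          · exact hC0 _ hq'
          · exact (norm_pI_le ξ).trans (norm_le_wt ξ)
      _ = _ := by rw [pow_succ]; field_simp
  · rw [norm_smul]
    exact (mul_le_of_le_one_right (norm_nonneg _) norm_pY_le).trans (hC1 _ hq')
  · rw [norm_smul]
    exact (mul_le_of_le_one_right (norm_nonneg _) norm_pW_le).trans (hC2 _ hq')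

/-- The derivative of the partial Fourier integral. -/
def fourDeriv (s : ℝ) (G : Smooth d) (q : Eu d × ℝ × ℝ) : Eu d × ℝ × ℝ →L[ℝ] ℂ :=
  ∑ j, (Complex.I * s * fourFn s (mulX j G) q) • pX j +
    fourFn s (D (ey d) G) q • pY d + fourFn s (D (ew d) G) q • pW d

theorem hasFDerivWithinAt_fourFn (s : ℝ) {G : Smooth d} (hG : Rapid G) {q : Eu d × ℝ × ℝ}
    (hq : q ∈ quad d) : HasFDerivWithinAt (fourFn s G) (fourDeriv s G q) (quad d) q := by
  obtain ⟨C, hC⟩ := exists_fourInt_bound s hG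
  refine hasFDerivWithinAt_integral (convex_quad d) (interior_quad_nonempty d)
    (f := fun q ξ => char (s • q.1) ξ * G.fn (ξ, q.2)) (D := fourInt s G)
    ((integrable_inv_wt_pow d).const_mul C)
    (fun q hq => integrable_char_mul (integrable_slice hG (mem_quad.1 hq).1 (mem_quad.1 hq).2) _)
    (fun ξ q hq => hasFDerivWithinAt_fourInt s G hq ξ) hC hq fun v => ?_
  have hy := (mem_quad.1 hq).1
  have hw := (mem_quad.1 hq).2
  have i1 : ∀ j, Integrable fun ξ => char (s • q.1) ξ * (mulX j G).fn (ξ, q.2) := fun j =>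
    integrable_char_mul (integrable_slice (hG.mulX j) hy hw) _
  have i2 : Integrable fun ξ => char (s • q.1) ξ * (D (ey d) G).fn (ξ, q.2) :=
    integrable_char_mul (integrable_slice hG.D_ey hy hw) _
  have i3 : Integrable fun ξ => char (s • q.1) ξ * (D (ew d) G).fn (ξ, q.2) :=
    integrable_char_mul (integrable_slice hG.D_ew hy hw) _
  have e : ∀ ξ, fourInt s G q ξ v = (∑ j, (Complex.I * s * pX j v) *
      (char (s • q.1) ξ * (mulX j G).fn (ξ, q.2)) + pY d v * (char (s • q.1) ξ *
      (D (ey d) G).fn (ξ, q.2))) + pW d v * (char (s • q.1) ξ * (D (ew d) G).fn (ξ, q.2)) := by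
    intro ξ
    simp only [fourInt, smul_apply, add_apply, smul_eq_mul,
      pI_eq_sum, mulX, coordC_apply, Finset.mul_sum, mul_add]
    congr 1
    · congr 1
      · exact Finset.sum_congr rfl fun j _ => by ring
      · ring
    · ring
  have i1' : Integrable fun ξ => ∑ j, (Complex.I * s * pX j v) *
      (char (s • q.1) ξ * (mulX j G).fn (ξ, q.2)) :=
    integrable_finsetSum _ fun j _ => (i1 j).const_mul _
  have i12 : Integrable fun ξ => ∑ j, (Complex.I * s * pX j v) *
      (char (s • q.1) ξ * (mulX j G).fn (ξ, q.2)) + pY d v * (char (s • q.1) ξ *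
      (D (ey d) G).fn (ξ, q.2)) := i1'.add (i2.const_mul _)
  simp_rw [e]
  rw [integral_add i12 (i3.const_mul _), integral_add i1' (i2.const_mul _),
    integral_finsetSum _ fun j _ => (i1 j).const_mul _]
  simp only [integral_const_mul, fourDeriv, add_apply,
    sum_apply, smul_apply, smul_eq_mul, fourFn, four]
  congr 1
  · congr 1
    · exact Finset.sum_congr rfl fun j _ => by ring
    · ring
  · ring

/-- The Fourier integrals of rapid functions form a class closed under differentiation: tangential
derivatives multiply G by i s ξ_j, normal derivatives fall on G. No derivative of G in ξ occurs,
which is why `Rapid` asks only for normal ones. -/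
theorem contDiffOn_fourFn (s : ℝ) {G : Smooth d} (hG : Rapid G) :
    ContDiffOn ℝ ∞ (fourFn s G) (quad d) := by
  refine contDiffOn_of_closed_class (uniqueDiffOn_quad d)
    (𝓕 := {f | ∃ G : Smooth d, Rapid G ∧ f = fourFn s G}) ?_ ⟨G, hG, rfl⟩
  rintro f ⟨G, hG, rfl⟩
  refine ⟨fourDeriv s G, fun q hq => hasFDerivWithinAt_fourFn s hG hq, fun n hn => ?_⟩
  unfold fourDeriv
  refine ((ContDiffOn.sum fun j _ => ?_).add ?_).add ?_
  · exact (contDiffOn_const.mul (hn _ ⟨_, hG.mulX j, rfl⟩)).smul contDiffOn_const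
  · exact (hn _ ⟨_, hG.D_ey, rfl⟩).smul contDiffOn_const
  · exact (hn _ ⟨_, hG.D_ew, rfl⟩).smul contDiffOn_const

/-- The partial Fourier integral as a smooth function. -/
def fourS (s : ℝ) (G : Smooth d) (hG : Rapid G) : Smooth d :=
  ⟨(quad d).indicator (fourFn s G), (contDiffOn_fourFn s hG).congr fun q hq => by
    rw [indicator_of_mem hq]⟩

theorem fourS_apply (s : ℝ) {G : Smooth d} (hG : Rapid G) {q : Eu d × ℝ × ℝ} (hq : q ∈ quad d) :
    (fourS s G hG).fn q = fourFn s G q := by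
  simp only [fourS]
  rw [indicator_of_mem hq]

theorem fderivWithin_fourS (s : ℝ) {G : Smooth d} (hG : Rapid G) {q : Eu d × ℝ × ℝ}
    (hq : q ∈ quad d) : fderivWithin ℝ (fourS s G hG).fn (quad d) q = fourDeriv s G q := by
  rw [fderivWithin_congr (fun q hq => fourS_apply s hG hq) (fourS_apply s hG hq)]
  exact (hasFDerivWithinAt_fourFn s hG hq).fderivWithin (uniqueDiffOn_quad d q hq)

theorem D_ey_fourS (s : ℝ) {G : Smooth d} (hG : Rapid G) :
    D (ey d) (fourS s G hG) = fourS s (D (ey d) G) hG.D_ey := by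
  refine Smooth.ext (funext fun q => ?_)
  by_cases hq : q ∈ quad d
  · rw [D_apply _ _ hq, fderivWithin_fourS s hG hq, fourS_apply s _ hq]
    simp [fourDeriv, pX, pY, pW, ey]
  · rw [D_apply_of_notMem _ _ hq]
    simp [fourS, hq]

theorem D_ew_fourS (s : ℝ) {G : Smooth d} (hG : Rapid G) :
    D (ew d) (fourS s G hG) = fourS s (D (ew d) G) hG.D_ew := by
  refine Smooth.ext (funext fun q => ?_)
  by_cases hq : q ∈ quad d
  · rw [D_apply _ _ hq, fderivWithin_fourS s hG hq, fourS_apply s _ hq]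
    simp [fourDeriv, pX, pY, pW, ew]
  · rw [D_apply_of_notMem _ _ hq]
    simp [fourS, hq]

theorem Rapid.iterate {G : Smooth d} (hG : Rapid G) (k l : ℕ) :
    Rapid ((D (ey d))^[k] ((D (ew d))^[l] G)) := by
  have h1 : ∀ l, Rapid ((D (ew d))^[l] G) := fun l => by
    induction l with
    | zero => exact hG
    | succ l ih => rw [Function.iterate_succ_apply']; exact ih.D_ew
  induction k with
  | zero => exact h1 l
  | succ k ih => rw [Function.iterate_succ_apply']; exact ih.D_ey

theorem iterate_fourS (s : ℝ) {G : Smooth d} (hG : Rapid G) (k l : ℕ) :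
    (D (ey d))^[k] ((D (ew d))^[l] (fourS s G hG)) = fourS s _ (hG.iterate k l) := by
  have h1 : ∀ l, (D (ew d))^[l] (fourS s G hG) = fourS s _ (hG.iterate 0 l) := fun l => by
    induction l with
    | zero => rfl
    | succ l ih =>
      rw [Function.iterate_succ_apply', ih, D_ew_fourS]
      simp only [Function.iterate_succ_apply', Function.iterate_zero, id_eq]
  induction k with
  | zero => exact h1 l
  | succ k ih =>
    rw [Function.iterate_succ_apply', ih, D_ey_fourS]
    simp only [Function.iterate_succ_apply']

end Smooth

/-! ### Fourier integrals of rapidly decreasing families -/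

/-- Smooth functions all of whose products with powers of the weight are bounded. -/
def RapidFn {n : ℕ} (f : Eu n → ℂ) : Prop :=
  ContDiff ℝ ∞ f ∧ ∀ M : ℕ, ∃ C : ℝ, ∀ ξ, ‖f ξ‖ ≤ C * (wt ξ ^ M)⁻¹

namespace Smooth

/-- The extension of a smooth function of `ξ` that is constant in the normal variables. -/
def ext0 {n : ℕ} (f : Eu n → ℂ) (hf : ContDiff ℝ ∞ f) : Smooth n :=
  ⟨fun q => f q.1, (hf.comp contDiff_fst).contDiffOn⟩

/-- The zero function. -/
def zero (n : ℕ) : Smooth n := ⟨fun _ => 0, contDiffOn_const⟩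

theorem D_zero {n : ℕ} (v : Eu n × ℝ × ℝ) : D v (zero n) = zero n := by
  refine Smooth.ext (funext fun q => ?_)
  by_cases hq : q ∈ quad n
  · rw [D_apply _ _ hq]
    simp [zero]
  · rw [D_apply_of_notMem _ _ hq]
    rfl

theorem D_ey_ext0 {n : ℕ} {f : Eu n → ℂ} (hf : ContDiff ℝ ∞ f) :
    D (ey n) (ext0 f hf) = zero n := by
  refine Smooth.ext (funext fun q => ?_)
  by_cases hq : q ∈ quad n
  · obtain ⟨ξ, y, w⟩ := q
    have h := mem_quad.1 hq
    exact (uniqueDiffOn_Ici 0 y h.1).eq_deriv _ ((ext0 f hf).hasDerivWithinAt_y ξ h.1 h.2)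
      (hasDerivWithinAt_const y _ (f ξ))
  · rw [D_apply_of_notMem _ _ hq]
    rfl

theorem D_ew_ext0 {n : ℕ} {f : Eu n → ℂ} (hf : ContDiff ℝ ∞ f) :
    D (ew n) (ext0 f hf) = zero n := by
  refine Smooth.ext (funext fun q => ?_)
  by_cases hq : q ∈ quad n
  · obtain ⟨ξ, y, w⟩ := q
    have h := mem_quad.1 hq
    exact (uniqueDiffOn_Ici 0 w h.2).eq_deriv _ ((ext0 f hf).hasDerivWithinAt_w ξ h.1 h.2)
      (hasDerivWithinAt_const w _ (f ξ))
  · rw [D_apply_of_notMem _ _ hq]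
    rfl

/-- Functions of ξ alone become functions on the quarter space with vanishing normal derivatives.
The plain Fourier integral thus inherits smoothness and its derivatives from the partial one. -/
theorem rapid_ext0 {n : ℕ} {f : Eu n → ℂ} (hf : RapidFn f) : Rapid (ext0 f hf.1) := fun M k l => by
  have hz : ∀ (v : Eu n × ℝ × ℝ) (k : ℕ), (D v)^[k] (zero n) = zero n := fun v k =>
    Function.iterate_fixed (D_zero v) k
  obtain ⟨C, hC⟩ := hf.2 M
  rcases l with _ | l
  · rcases k with _ | k
    · exact ⟨C, fun q _ => hC q.1⟩
    · refine ⟨0, fun q _ => ?_⟩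
      rw [Function.iterate_succ_apply, Function.iterate_zero, id, D_ey_ext0, hz]
      simp [zero]
  · refine ⟨0, fun q _ => ?_⟩
    rw [Function.iterate_succ_apply, D_ew_ext0, hz, hz]
    simp [zero]

end Smooth

open Smooth

namespace RapidFn

variable {n : ℕ} {f : Eu n → ℂ}

theorem integrable (hf : RapidFn f) : Integrable f := by
  obtain ⟨C, hC⟩ := hf.2 (n + 1)
  exact ((integrable_inv_wt_pow n).const_mul C).mono' hf.1.continuous.aestronglyMeasurable
    (Eventually.of_forall hC)

theorem four_eq (hf : RapidFn f) (s : ℝ) (z : Eu n) :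
    four s f z = (fourS s (ext0 f hf.1) (rapid_ext0 hf)).fn (z, 0, 0) := by
  rw [fourS_apply _ _ (mem_quad.2 ⟨le_rfl, le_rfl⟩)]
  rfl

theorem contDiff_four (hf : RapidFn f) (s : ℝ) : ContDiff ℝ ∞ (four s f) := by
  rw [funext (hf.four_eq s)]
  exact contDiff_x _ le_rfl le_rfl

theorem fderiv_four (hf : RapidFn f) (s : ℝ) (z : Eu n) (j : Fin n) :
    fderiv ℝ (four s f) z (EuclideanSpace.single j 1)
      = Complex.I * s * four s (fun ξ => (ξ j : ℂ) * f ξ) z := by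
  have hq : (z, 0, 0) ∈ quad n := mem_quad.2 ⟨le_rfl, le_rfl⟩
  rw [funext (hf.four_eq s), (hasFDerivAt_x _ z le_rfl le_rfl).fderiv, fderivWithin_fourS s _ hq]
  simp only [fourDeriv, pX, pY, pW, ContinuousLinearMap.comp_apply, ContinuousLinearMap.inl_apply,
    add_apply, sum_apply, smul_apply, smul_eq_mul, ContinuousLinearMap.coe_fst',
    ContinuousLinearMap.coe_snd', Complex.ofRealCLM_apply, coordC_apply]
  rw [Finset.sum_eq_single j]
  · simp [fourFn, mulX, ext0, coordC_apply]
  · intro i _ hi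
    simp [hi]
  · simp

theorem hasFDerivAt_char (s : ℝ) (z ξ : Eu n) : HasFDerivAt (fun ξ => char (s • z) ξ)
    (char (s • z) ξ • (Complex.I • Complex.ofRealCLM.comp (innerSL ℝ (s • z)))) ξ := by
  have h : (fun ξ => char (s • z) ξ)
      = fun ξ => Complex.exp (Complex.I * Complex.ofRealCLM.comp (innerSL ℝ (s • z)) ξ) := rfl
  rw [h]
  exact ((Complex.ofRealCLM.comp (innerSL ℝ (s • z))).hasFDerivAt.const_mul Complex.I).cexp

theorem coord_mul_four (hf : RapidFn f) {s : ℝ} (hs : s ≠ 0) (j : Fin n)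
    (hf' : Integrable fun ξ => fderiv ℝ f ξ (EuclideanSpace.single j 1)) (z : Eu n) :
    (z j : ℂ) * four s f z = Complex.I / s *
      four s (fun ξ => fderiv ℝ f ξ (EuclideanSpace.single j 1)) z := by
  have hd : ∀ ξ, fderiv ℝ (fun ξ => char (s • z) ξ) ξ (EuclideanSpace.single j 1)
      = (Complex.I * s * z j) * char (s • z) ξ := fun ξ => by
    rw [(hasFDerivAt_char s z ξ).fderiv]
    simp [EuclideanSpace.inner_single_right]
    ring
  have hi := integrable_char_mul hf.integrable (s • z)
  have h := integral_mul_fderiv_eq_neg_fderiv_mul_of_integrable (μ := volume)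
    (f := fun ξ => char (s • z) ξ) (g := f) (v := EuclideanSpace.single j 1)
    (by simp_rw [hd, mul_assoc (Complex.I * s * z j)]; exact hi.const_mul _)
    (integrable_char_mul hf' _) hi (fun ξ _ => (hasFDerivAt_char s z ξ).differentiableAt)
    (fun ξ _ => hf.1.differentiable (by simp) ξ)
  simp_rw [hd, mul_assoc (Complex.I * s * z j)] at h
  rw [integral_const_mul] at h
  have hs' : (s : ℂ) ≠ 0 := by exact_mod_cast hs
  simp only [four]
  rw [h]
  field_simp
  rw [Complex.I_sq]
  ring

end RapidFn

section Family

variable {ι : Type*} {N n : ℕ} {τ : ℝ} {U : Set (Eu N)} {q : ι → Eu N → Eu n → ℂ}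

theorem RapidFam.rapidFn (hU : Body U) (h : RapidFam τ U q) (i : ι) {x : Eu N} (hx : x ∈ U) :
    RapidFn (q i x) := by
  refine ⟨h.1 i x hx, fun M => ?_⟩
  obtain ⟨C, -, hC⟩ := h.weight_bound hU M
  exact ⟨C, fun ξ => (hC i ξ).norm_le hx⟩

theorem HolderBoundOn.integral (hU : Body U) {Y : Type} [MeasurableSpace Y] {μ : Measure Y}
    {f : Eu N → Y → ℂ} {b : Y → ℝ} (hb : Integrable b μ)
    (hm : ∀ x ∈ U, AEStronglyMeasurable (f x) μ)
    (hf : ∀ y, HolderBoundOn τ U (fun x => f x y) (b y)) :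
    HolderBoundOn τ U (fun x => ∫ y, f x y ∂μ) (∫ y, ‖b y‖ ∂μ) :=
  HolderOn.integral (k := ⌊τ⌋₊) (θ := τ - ⌊τ⌋₊) hU.convex hU.int hb hm (Eventually.of_forall hf)

theorem RapidFam.exists_four_bound (hU : Body U) (h : RapidFam τ U q) (s : ℝ) :
    ∃ C : ℝ, ∀ i z, HolderBoundOn τ U (fun x => four s (q i x) z) C := by
  obtain ⟨C, -, hC⟩ := h.weight_bound hU (n + 1)
  refine ⟨_, fun i z => HolderBoundOn.integral hU ((integrable_inv_wt_pow n).const_mul C)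
    (fun x hx => (integrable_char_mul (h.rapidFn hU i hx).integrable _).1) fun ξ => ?_⟩
  have := (hC i ξ).const_mul hU (char (s • z) ξ)
  rwa [norm_char, one_mul] at this

/-- Each derivative in z becomes multiplication of q by i s ξ_j, and each factor z_j becomes a
derivative of q times i/s. Both operations lead to rapid families, so two inductions reduce
everything to a bound without weights and derivatives, obtained by integrating a multiple of the
integrable weight. -/
theorem RapidFam.four (hU : Body U) (h : RapidFam τ U q) {s : ℝ} (hs : s ≠ 0) :
    RapidFam τ U fun i x z => four s (q i x) z := by
  refine ⟨fun i x hx => (h.rapidFn hU i hx).contDiff_four s, fun r => ?_⟩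
  induction r generalizing q with
  | zero =>
    intro a β
    induction β using monom_induction generalizing q with
    | h0 =>
      obtain ⟨C, hC⟩ := h.exists_four_bound hU s
      refine ⟨C, fun i z => (hC i z).congr fun x hx => ?_⟩
      simp [monom_zero, partialD_zero]
    | hs β j ih =>
      obtain ⟨C, hC⟩ := ih ((h.deriv j).const_mul hU (Complex.I / s))
      refine ⟨C, fun i z => (hC i z).congr fun x hx => ?_⟩
      have h1 := (h.rapidFn hU i hx).coord_mul_four hs j
        ((h.deriv j).rapidFn hU i hx).integrable z
      have h2 : NonsmoothGreen.four s (fun ξ => Complex.I / s *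
          fderiv ℝ (q i x) ξ (EuclideanSpace.single j 1)) z = Complex.I / s *
          NonsmoothGreen.four s (fun ξ => fderiv ℝ (q i x) ξ (EuclideanSpace.single j 1)) z := by
        simp only [NonsmoothGreen.four, ← integral_const_mul]
        refine integral_congr_ae (Eventually.of_forall fun ξ => ?_)
        simp only
        ring
      rw [partialD_zero, partialD_zero, monom_add, monom_single]
      beta_reduce
      rw [h2, ← h1]
      push_cast
      ring
  | succ r ih =>
    intro a β
    obtain ⟨C, hC⟩ := ih ((h.coord_mul hU (a (Fin.last r))).const_mul hU (Complex.I * s))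
      (Fin.init a) β
    refine ⟨C, fun i z => (hC i z).congr fun x hx => ?_⟩
    rw [partialD_succ _ ((h.rapidFn hU i hx).contDiff_four s)]
    congr 1
    refine partialD_congr _ (fun ζ => ?_) z
    rw [(h.rapidFn hU i hx).fderiv_four]
    simp only [NonsmoothGreen.four, ← integral_const_mul]
    refine integral_congr_ae (Eventually.of_forall fun ξ => ?_)
    simp only
    ring

end Family

/-! ### Kernel bounds are preserved by Fourier integrals -/

section Kernel

variable {N d : ℕ} {τ : ℝ} {U : Set (Eu N)}

theorem kernelBound_iff_rapidFam {K : Eu d → Eu d → ℂ} :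
    KernelBound τ K ↔ RapidFam τ univ (fun _ : Unit => K) := by
  constructor
  · rintro ⟨h1, h2⟩
    refine ⟨fun _ x _ => h1 x, fun r a β => ?_⟩
    obtain ⟨C, hC⟩ := h2 r a β
    exact ⟨C, fun _ ξ => hC ξ⟩
  · rintro ⟨h1, h2⟩
    refine ⟨fun x => h1 () x trivial, fun r a β => ?_⟩
    obtain ⟨C, hC⟩ := h2 r a β
    exact ⟨C, fun ξ => hC () ξ⟩

theorem KernelBound.four {K : Eu d → Eu d → ℂ} (h : KernelBound τ K) {s : ℝ} (hs : s ≠ 0) :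
    KernelBound τ fun x z => four s (K x) z :=
  kernelBound_iff_rapidFam.2 ((kernelBound_iff_rapidFam.1 h).four (body_univ d) hs)

/-- The pairs of nonnegative numbers. -/
abbrev Quadrant : Type := {p : ℝ × ℝ // 0 ≤ p.1 ∧ 0 ≤ p.2}

/-- The weighted normal derivatives of a kernel, as a family of functions of `ξ`. -/
def normalFam (K : Eu N → Eu d → ℝ → ℝ → ℂ) (k k' l l' : ℕ) (i : Quadrant) (x : Eu N) (ξ : Eu d) : ℂ :=
  (i.1.1 : ℂ) ^ k * (i.1.2 : ℂ) ^ l *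
    iteratedDerivWithin k' (fun y₁ => iteratedDerivWithin l' (K x ξ y₁) (Ici 0) i.1.2) (Ici 0) i.1.1

theorem normalFam_eq {K : Eu N → Eu d → ℝ → ℝ → ℂ} {x : Eu N} (G : Smooth d)
    (hG : ∀ ξ, ∀ y ≥ 0, ∀ w ≥ 0, K x ξ y w = G.fn (ξ, y, w)) (k k' l l' : ℕ) (i : Quadrant)
    (ξ : Eu d) : normalFam K k k' l l' i x ξ = (i.1.1 : ℂ) ^ k * (i.1.2 : ℂ) ^ l *
      ((D (ey d))^[k'] ((D (ew d))^[l'] G)).fn (ξ, i.1.1, i.1.2) := by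
  rw [normalFam, G.mixedD2_inner_eq hG k' l' ξ i.2.1 i.2.2]

theorem contDiff_normalFam {K : Eu N → Eu d → ℝ → ℝ → ℂ} {x : Eu N} (G : Smooth d)
    (hG : ∀ ξ, ∀ y ≥ 0, ∀ w ≥ 0, K x ξ y w = G.fn (ξ, y, w)) (k k' l l' : ℕ) (i : Quadrant) :
    ContDiff ℝ ∞ (normalFam K k k' l l' i x) := by
  rw [funext (normalFam_eq G hG k k' l l' i)]
  exact contDiff_const.mul (contDiff_x _ i.2.1 i.2.2)

theorem partialD_normalFam {K : Eu N → Eu d → ℝ → ℝ → ℂ} {x : Eu N} (G : Smooth d)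
    (hG : ∀ ξ, ∀ y ≥ 0, ∀ w ≥ 0, K x ξ y w = G.fn (ξ, y, w)) (k k' l l' : ℕ) (i : Quadrant)
    {r : ℕ} (a : Fin r → Fin d) (ξ : Eu d) :
    partialD a (normalFam K k k' l l' i x) ξ = (i.1.1 : ℂ) ^ k * (i.1.2 : ℂ) ^ l *
      mixedD2 a k' l' (K x) ξ i.1.1 i.1.2 := by
  rw [partialD_congr a (normalFam_eq G hG k k' l l' i),
    partialD_const_mul _ _ (contDiff_x _ i.2.1 i.2.2), partialD_eq _ _ _ i.2.1 i.2.2,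
    G.mixedD2_eq hG _ _ _ _ i.2.1 i.2.2, mix]

/-- The normal variables become the index of the family. The supremum over y and w in the kernel
estimate is the uniformity over the index. -/
theorem KernelBound2.normalFam {K : Eu N → Eu d → ℝ → ℝ → ℂ} (h : KernelBound2 τ U K)
    (k k' l l' : ℕ) : RapidFam τ U (normalFam K k k' l l') := by
  refine ⟨fun i x hx => contDiff_normalFam (Smooth.of (h.1 x hx)) (fun _ _ _ _ _ => rfl) _ _ _ _ _,
    fun r a β => ?_⟩
  obtain ⟨C, hC⟩ := h.2 r a β k k' l l'
  refine ⟨C, fun i ξ => (hC ξ i.1.1 i.2.1 i.1.2 i.2.2).congr fun x hx => ?_⟩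
  rw [partialD_normalFam (Smooth.of (h.1 x hx)) (fun _ _ _ _ _ => rfl)]
  ring

theorem KernelBound2.rapid (hU : Body U) {K : Eu N → Eu d → ℝ → ℝ → ℂ} (h : KernelBound2 τ U K)
    {x : Eu N} (hx : x ∈ U) : Rapid (Smooth.of (h.1 x hx)) := fun M k l => by
  obtain ⟨C, hC⟩ := (h.normalFam 0 k 0 l).weight_bound hU M
  refine ⟨C, fun q hq => ?_⟩
  have hq' := mem_quad.1 hq
  have h1 := (hC.2 ⟨q.2, hq'⟩ q.1).norm_le hx
  rw [normalFam_eq (Smooth.of (h.1 x hx)) (fun _ _ _ _ _ => rfl)] at h1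
  simpa using h1

theorem KernelBound2.four (hU : Body U) {K : Eu N → Eu d → ℝ → ℝ → ℂ} (h : KernelBound2 τ U K)
    {s : ℝ} (hs : s ≠ 0) :
    KernelBound2 τ U fun x z y w => four s (fun ξ => K x ξ y w) z := by
  have hfn : ∀ x (hx : x ∈ U), ∀ z, ∀ y ≥ 0, ∀ w ≥ 0, NonsmoothGreen.four s (fun ξ => K x ξ y w) z
      = (fourS s _ (h.rapid hU hx)).fn (z, y, w) := fun x hx z y hy w hw => by
    rw [fourS_apply _ _ (mem_quad.2 ⟨hy, hw⟩)]
    rfl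
  refine ⟨fun x hx => ?_, fun r a β k k' l l' => ?_⟩
  · refine (fourS s _ (h.rapid hU hx)).smooth.congr fun q hq => ?_
    have hq' := mem_quad.1 hq
    exact hfn x hx q.1 q.2.1 hq'.1 q.2.2 hq'.2
  · obtain ⟨C, hC⟩ := ((h.normalFam k k' l l').four hU hs).2 r a β
    refine ⟨C, fun z y hy w hw => (hC ⟨(y, w), hy, hw⟩ z).congr fun x hx => ?_⟩
    -- Normal derivatives and normal weights pass under the tangential Fourier integral, so the
    -- weighted derivatives of the transform form the transform of the rapid family `normalFam`.
    have hS : ∀ ζ, NonsmoothGreen.four s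
        (NonsmoothGreen.normalFam K k k' l l' ⟨(y, w), hy, hw⟩ x) ζ
        = (y : ℂ) ^ k * (w : ℂ) ^ l *
        ((D (ey d))^[k'] ((D (ew d))^[l'] (fourS s _ (h.rapid hU hx)))).fn (ζ, y, w) := fun ζ => by
      rw [iterate_fourS, fourS_apply _ _ (mem_quad.2 ⟨hy, hw⟩), fourFn, NonsmoothGreen.four,
        NonsmoothGreen.four, ← integral_const_mul]
      refine integral_congr_ae (Eventually.of_forall fun ξ => ?_)
      simp only
      rw [normalFam_eq (Smooth.of (h.1 x hx)) (fun _ _ _ _ _ => rfl)]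
      ring
    rw [partialD_congr a hS, partialD_const_mul _ _ (contDiff_x _ hy hw), partialD_eq _ _ _ hy hw,
      (fourS s _ (h.rapid hU hx)).mixedD2_eq (hfn x hx) a k' l' z hy hw, mix]
    ring

end Kernel

open Smooth

/-! ### Kernels with one normal variable -/

section OneVariable

variable {N d : ℕ} {τ : ℝ} {U : Set (Eu N)}

/-- The product with `e^{-w}`, which turns kernels with one normal variable into kernels with two. -/
def tens (h : Eu N → Eu d → ℝ → ℂ) (x : Eu N) (ξ : Eu d) (y w : ℝ) : ℂ :=
  (Real.exp (-w) : ℂ) * h x ξ y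

theorem iteratedDerivWithin_exp_neg_mul (l : ℕ) (c : ℂ) {w : ℝ} (hw : 0 ≤ w) :
    iteratedDerivWithin l (fun w : ℝ => (Real.exp (-w) : ℂ) * c) (Ici 0) w
      = ((-1) ^ l * Real.exp (-w) : ℂ) * c := by
  induction l generalizing w with
  | zero => simp
  | succ l ih =>
    rw [iteratedDerivWithin_succ, derivWithin_congr (𝕜 := ℝ) (s := Ici 0)
      (f := fun w : ℝ => ((-1) ^ l * Real.exp (-w) : ℂ) * c) (fun s hs => ih hs) (ih hw)]
    refine HasDerivWithinAt.derivWithin ?_ (uniqueDiffOn_Ici 0 w hw)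
    have h1 : HasDerivAt (fun w : ℝ => (Real.exp (-w) : ℂ)) (-(Real.exp (-w) : ℂ)) w := by
      have := ((hasDerivAt_neg w).exp).ofReal_comp
      simpa using this
    have h2 := ((h1.const_mul ((-1 : ℂ) ^ l)).mul_const c).hasDerivWithinAt (s := Ici (0 : ℝ))
    convert h2 using 1
    rw [pow_succ]; ring

theorem contDiff_normal_slice {h : Eu d → ℝ → ℂ}
    (hh : ContDiffOn ℝ ∞ (fun q : Eu d × ℝ => h q.1 q.2) (univ ×ˢ Ici 0)) (l : ℕ) {y : ℝ}
    (hy : 0 ≤ y) : ContDiff ℝ ∞ fun η => iteratedDerivWithin l (h η) (Ici 0) y := by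
  have := fun η => (Smooth.of (g := fun ξ y _ => h ξ y) (contDiffOn_const_extension hh)).mixedD2_inner_eq
    (g := fun ξ y _ => h ξ y) (fun _ _ _ _ _ => rfl) l 0 η hy le_rfl
  simp only [iteratedDerivWithin_zero] at this
  rw [funext this]
  exact contDiff_x _ hy le_rfl

theorem contDiffOn_y_slice {h : Eu d → ℝ → ℂ}
    (hh : ContDiffOn ℝ ∞ (fun q : Eu d × ℝ => h q.1 q.2) (univ ×ˢ Ici 0)) (η : Eu d) :
    ContDiffOn ℝ ∞ (h η) (Ici 0) :=
  hh.comp (f := fun y => (η, y)) (by fun_prop) fun y hy => ⟨trivial, hy⟩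

theorem mixedD2_tens {h : Eu N → Eu d → ℝ → ℂ} {x : Eu N}
    (hh : ContDiffOn ℝ ∞ (fun q : Eu d × ℝ => h x q.1 q.2) (univ ×ˢ Ici 0)) {r : ℕ}
    (a : Fin r → Fin d) (k l : ℕ) (ξ : Eu d) {y w : ℝ} (hy : 0 ≤ y) (hw : 0 ≤ w) :
    mixedD2 a k l (tens h x) ξ y w = ((-1) ^ l * Real.exp (-w) : ℂ) * mixedD a k (h x) ξ y := by
  rw [mixedD, ← partialD_const_mul _ _ (contDiff_normal_slice hh k hy), mixedD2]
  refine partialD_congr a (fun η => ?_) ξ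
  refine (iteratedDerivWithin_congr (s := Ici 0)
    (g := fun y => ((-1) ^ l * Real.exp (-w) : ℂ) * h x η y)
    (fun s _ => iteratedDerivWithin_exp_neg_mul l (h x η s) hw) hy).trans ?_
  exact iteratedDerivWithin_const_mul hy (uniqueDiffOn_Ici 0) _
    (((contDiffOn_y_slice hh η) y hy).of_le (by exact_mod_cast le_top))

theorem exists_pow_mul_exp_neg_bound (l : ℕ) : ∃ C : ℝ, 0 ≤ C ∧ ∀ w : ℝ, 0 ≤ w →
    w ^ l * Real.exp (-w) ≤ C := by
  refine ⟨l.factorial, by positivity, fun w hw => ?_⟩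
  have h1 := Real.pow_div_factorial_le_exp w hw l
  rw [div_le_iff₀ (by positivity)] at h1
  rw [Real.exp_neg, ← div_eq_mul_inv, div_le_iff₀ (Real.exp_pos w)]
  linarith

/-- All products of powers of w with derivatives of e^{-w} are bounded for w ≥ 0, which a constant
extension would not give. At w = 0 the factor is 1, so the kernel and its estimates are recovered
there. -/
theorem kernelBound1_iff_tens (hU : Body U) {h : Eu N → Eu d → ℝ → ℂ} :
    KernelBound1 τ U h ↔ KernelBound2 τ U (tens h) := by
  constructor
  · rintro ⟨h1, h2⟩
    refine ⟨fun x hx => ?_, fun r a β k k' l l' => ?_⟩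
    · exact ((Complex.ofRealCLM.contDiff.comp
        (Real.contDiff_exp.comp (contDiff_snd.comp contDiff_snd).neg)).contDiffOn).mul (contDiffOn_const_extension (h1 x hx))
    · obtain ⟨C, hC⟩ := h2 r a β k k'
      obtain ⟨C', hC', hl⟩ := exists_pow_mul_exp_neg_bound l
      refine ⟨C' * C, fun z y hy w hw => ?_⟩
      refine (((hC z y hy).const_mul hU ((-1) ^ l' * ((w ^ l * Real.exp (-w) : ℝ) : ℂ))).congr
        fun x hx => ?_).mono ?_
      · rw [mixedD2_tens (h1 x hx) _ _ _ _ hy hw]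
        push_cast
        ring
      · have h0 := (hC z y hy).nonneg hU
        rw [norm_mul, norm_pow, norm_neg, norm_one, one_pow, one_mul, Complex.norm_real,
          Real.norm_of_nonneg (by positivity)]
        gcongr
        exact hl w hw
  · rintro ⟨h1, h2⟩
    have h1' : ∀ x ∈ U, ContDiffOn ℝ ∞ (fun q : Eu d × ℝ => h x q.1 q.2) (univ ×ˢ Ici 0) := by
      intro x hx
      refine ((h1 x hx).comp (f := fun q : Eu d × ℝ => (q.1, q.2, (0 : ℝ))) (by fun_prop) ?_).congr
        fun q hq => ?_
      · rintro ⟨ξ, y⟩ ⟨-, hy⟩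
        exact ⟨trivial, hy, self_mem_Ici⟩
      · simp [tens]
    refine ⟨h1', fun r a β l l' => ?_⟩
    obtain ⟨C, hC⟩ := h2 r a β l l' 0 0
    refine ⟨C, fun z y hy => (hC z y hy 0 le_rfl).congr fun x hx => ?_⟩
    rw [mixedD2_tens (h1' x hx) _ _ _ _ hy le_rfl]
    simp

theorem KernelBound1.four (hU : Body U) {K : Eu N → Eu d → ℝ → ℂ} (h : KernelBound1 τ U K)
    {s : ℝ} (hs : s ≠ 0) : KernelBound1 τ U fun x z y => four s (fun ξ => K x ξ y) z := by
  rw [kernelBound1_iff_tens hU] at h ⊢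
  convert h.four hU hs using 5 with x z y w
  simp only [tens, NonsmoothGreen.four, ← integral_const_mul]
  congr 1
  funext ξ
  ring

end OneVariable

/-! ### From supremum bounds to `L²` bounds -/

section SupToL2

variable {N d : ℕ} {τ : ℝ} {U : Set (Eu N)}

theorem bracket_rpow {n : ℕ} (ξ : Eu n) (e : ℝ) : bracket ξ ^ e = wt ξ ^ (e / 2) := by
  rw [bracket, ← wt, Real.sqrt_eq_rpow, ← Real.rpow_mul (wt_pos ξ).le]
  ring_nf

theorem inv_wt_pow_le_bracket_rpow (e : ℝ) : ∃ M : ℕ, ∀ {n : ℕ} (ξ : Eu n),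
    (wt ξ ^ M)⁻¹ ≤ bracket ξ ^ e := by
  obtain ⟨M, hM⟩ := exists_nat_ge (-(e / 2))
  refine ⟨M, fun ξ => ?_⟩
  rw [bracket_rpow, ← Real.rpow_natCast, ← Real.rpow_neg (wt_pos ξ).le]
  exact Real.rpow_le_rpow_of_exponent_le (one_le_wt ξ) (by linarith)

theorem bracket_rpow_neg_two_mul {n : ℕ} (ξ : Eu n) (M : ℕ) :
    bracket ξ ^ (-(2 * M : ℝ)) = (wt ξ ^ M)⁻¹ := by
  rw [bracket_rpow, ← Real.rpow_natCast, ← Real.rpow_neg (wt_pos ξ).le]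
  ring_nf

theorem holderL2BoundOn_of_bound (hU : Body U) {Y : Type} [MeasurableSpace Y] {μ : Measure Y}
    {φ : Eu N → Y → ℂ} {b : Y → ℝ} (hb : MemLp b 2 μ) {c : ℝ} (hc : 0 ≤ c)
    (hm : ∀ x ∈ U, AEStronglyMeasurable (φ x) μ)
    (hφ : ∀ᵐ y ∂μ, HolderBoundOn τ U (fun x => φ x y) (c * b y)) :
    HolderL2BoundOn τ U μ φ (c * (eLpNorm b 2 μ).toReal) := by
  have hcb : MemLp (fun y => c * b y) 2 μ := hb.const_mul c
  obtain ⟨Φ, hΦ⟩ := exists_lp_lift (U := U) (p := 2) (μ := μ) (f := φ) fun x hx =>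
    hcb.mono (hm x hx) (hφ.mono fun y hy => (hy.norm_le hx).trans (le_abs_self _))
  refine ⟨Φ, hΦ, ?_⟩
  have h := holderOn_lp (k := ⌊τ⌋₊) (θ := τ - ⌊τ⌋₊) (by simp) hU.convex hU.int hcb hm hφ hΦ
  have he : (eLpNorm (fun y => c * b y) 2 μ).toReal = c * (eLpNorm b 2 μ).toReal := by
    have := eLpNorm_const_smul (μ := μ) (p := 2) c b
    rw [show (fun y => c * b y) = c • b from rfl, this, ENNReal.toReal_mul, toReal_enorm,
      Real.norm_of_nonneg hc]
  rwa [he] at h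

theorem memLp_inv_one_add_sq : MemLp (fun y : ℝ => (1 + y ^ 2)⁻¹) 2 volume := by
  have hc : Continuous fun y : ℝ => (1 + y ^ 2)⁻¹ :=
    (by fun_prop : Continuous fun y : ℝ => 1 + y ^ 2).inv₀ fun y => by positivity
  rw [memLp_two_iff_integrable_sq hc.aestronglyMeasurable]
  refine integrable_inv_one_add_sq.mono' (hc.pow 2).aestronglyMeasurable
    (Eventually.of_forall fun y => ?_)
  rw [Real.norm_of_nonneg (by positivity), sq]
  exact mul_le_of_le_one_left (by positivity) (inv_le_one_of_one_le₀ (by linarith [sq_nonneg y]))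

theorem memLp_inv_one_add_sq_prod :
    MemLp (fun q : ℝ × ℝ => (1 + q.1 ^ 2)⁻¹ * (1 + q.2 ^ 2)⁻¹) 2 volume := by
  have hm := memLp_inv_one_add_sq
  have h1 := (memLp_two_iff_integrable_sq hm.1).1 hm
  have hc : Continuous fun y : ℝ => (1 + y ^ 2)⁻¹ :=
    (by fun_prop : Continuous fun y : ℝ => 1 + y ^ 2).inv₀ fun y => by positivity
  have hc2 : Continuous fun q : ℝ × ℝ => (1 + q.1 ^ 2)⁻¹ * (1 + q.2 ^ 2)⁻¹ :=
    (hc.comp continuous_fst).mul (hc.comp continuous_snd)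
  rw [memLp_two_iff_integrable_sq hc2.aestronglyMeasurable]
  refine (h1.mul_prod h1).congr (Eventually.of_forall fun q => ?_)
  simp only
  ring

theorem KernelBound2.holderBound {K : Eu N → Eu d → ℝ → ℝ → ℂ} (h : KernelBound2 τ U K) (ξ : Eu d)
    {y w : ℝ} (hy : 0 ≤ y) (hw : 0 ≤ w) : ∃ B, HolderBoundOn τ U (fun x => K x ξ y w) B := by
  obtain ⟨C, hC⟩ := h.2 0 Fin.elim0 0 0 0 0 0
  refine ⟨C, (hC ξ y hy w hw).congr fun x hx => ?_⟩
  simp [mixedD2, partialD_zero, monom_zero]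

theorem KernelBound1.holderBound {K : Eu N → Eu d → ℝ → ℂ} (h : KernelBound1 τ U K) (ξ : Eu d)
    {y : ℝ} (hy : 0 ≤ y) : ∃ B, HolderBoundOn τ U (fun x => K x ξ y) B := by
  obtain ⟨C, hC⟩ := h.2 0 Fin.elim0 0 0 0
  refine ⟨C, (hC ξ y hy).congr fun x hx => ?_⟩
  simp [mixedD, partialD_zero, monom_zero]

theorem KernelBound2.weight_bound (hU : Body U) {K : Eu N → Eu d → ℝ → ℝ → ℂ}
    (h : KernelBound2 τ U K) {r : ℕ} (a : Fin r → Fin d) (k k' l l' M : ℕ) :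
    ∃ C, 0 ≤ C ∧ ∀ ξ, ∀ y ≥ (0 : ℝ), ∀ w ≥ (0 : ℝ), HolderBoundOn τ U
      (fun x => (y : ℂ) ^ k * (w : ℂ) ^ l * mixedD2 a k' l' (K x) ξ y w) (C * (wt ξ ^ M)⁻¹) := by
  obtain ⟨C, h0, hC⟩ := exists_weight_bound (ι := Quadrant) (τ := τ) (φ := fun i x ξ =>
    (i.1.1 : ℂ) ^ k * (i.1.2 : ℂ) ^ l * mixedD2 a k' l' (K x) ξ i.1.1 i.1.2) hU (fun β => by
      obtain ⟨C, hC⟩ := h.2 r a β k k' l l'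
      exact ⟨C, fun i ξ => (hC ξ i.1.1 i.2.1 i.1.2 i.2.2).congr fun x hx => by ring⟩) M
  exact ⟨C, h0, fun ξ y hy w hw => hC ⟨(y, w), hy, hw⟩ ξ⟩

theorem KernelBound1.weight_bound (hU : Body U) {K : Eu N → Eu d → ℝ → ℂ}
    (h : KernelBound1 τ U K) {r : ℕ} (a : Fin r → Fin d) (l l' M : ℕ) :
    ∃ C, 0 ≤ C ∧ ∀ ξ, ∀ y ≥ (0 : ℝ), HolderBoundOn τ U
      (fun x => (y : ℂ) ^ l * mixedD a l' (K x) ξ y) (C * (wt ξ ^ M)⁻¹) := by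
  obtain ⟨C, h0, hC⟩ := exists_weight_bound (ι := Ici (0 : ℝ)) (τ := τ) (φ := fun i x ξ =>
    (i.1 : ℂ) ^ l * mixedD a l' (K x) ξ i.1) hU (fun β => by
      obtain ⟨C, hC⟩ := h.2 r a β l l'
      exact ⟨C, fun i ξ => (hC ξ i.1 i.2).congr fun x hx => by ring⟩) M
  exact ⟨C, h0, fun ξ y hy => hC ⟨y, hy⟩ ξ⟩

theorem continuousOn_mixedD2 {g : Eu d → ℝ → ℝ → ℂ}
    (hg : ContDiffOn ℝ ∞ (fun q : Eu d × ℝ × ℝ => g q.1 q.2.1 q.2.2) (univ ×ˢ (Ici 0 ×ˢ Ici 0)))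
    {r : ℕ} (a : Fin r → Fin d) (k l : ℕ) (ξ : Eu d) :
    ContinuousOn (fun q : ℝ × ℝ => mixedD2 a k l g ξ q.1 q.2) (Ici 0 ×ˢ Ici 0) := by
  refine ((mix a k l (Smooth.of hg)).smooth.continuousOn.comp (f := fun q : ℝ × ℝ => (ξ, q))
    (by fun_prop) fun q hq => mem_quad.2 hq).congr fun q hq => ?_
  exact (Smooth.of hg).mixedD2_eq (fun _ _ _ _ _ => rfl) a k l ξ hq.1 hq.2

theorem continuousOn_mixedD {h : Eu d → ℝ → ℂ}
    (hh : ContDiffOn ℝ ∞ (fun q : Eu d × ℝ => h q.1 q.2) (univ ×ˢ Ici 0))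
    {r : ℕ} (a : Fin r → Fin d) (l : ℕ) (ξ : Eu d) :
    ContinuousOn (fun y : ℝ => mixedD a l h ξ y) (Ici 0) := by
  refine ((continuousOn_mixedD2 (g := fun ξ y _ => h ξ y) (contDiffOn_const_extension hh)
    a l 0 ξ).comp (f := fun y : ℝ => (y, (0 : ℝ))) (by fun_prop)
    fun y hy => ⟨hy, self_mem_Ici⟩).congr fun y hy => ?_
  exact mixedD_eq_mixedD2 a l h ξ y 0

/-- Multiplication by (1 + y²)(1 + w²) yields four terms, each with a kernel bound. Dividing by this
factor leaves a square integrable majorant, and a high power of the weight in ξ lies below any given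
power of ⟨ξ⟩. -/
theorem KernelBound2.isSymbolKernel2 (hU : Body U) {K : Eu N → Eu d → ℝ → ℝ → ℂ}
    (h : KernelBound2 τ U K) (m : ℝ) : IsSymbolKernel2 τ m U K := by
  refine ⟨h.1, fun ξ y hy w hw => h.holderBound ξ hy hw, fun r a k k' l l' => ?_⟩
  obtain ⟨M, hM⟩ := inv_wt_pow_le_bracket_rpow (m + 1 - k + k' - l + l' - r)
  obtain ⟨C0, h0, hC0⟩ := h.weight_bound hU a k k' l l' M
  obtain ⟨C1, h1, hC1⟩ := h.weight_bound hU a (k + 2) k' l l' M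
  obtain ⟨C2, h2, hC2⟩ := h.weight_bound hU a k k' (l + 2) l' M
  obtain ⟨C3, h3, hC3⟩ := h.weight_bound hU a (k + 2) k' (l + 2) l' M
  let b : ℝ × ℝ → ℝ := fun q => (1 + q.1 ^ 2)⁻¹ * (1 + q.2 ^ 2)⁻¹
  let μ : Measure (ℝ × ℝ) := volume.restrict (Ioi (0 : ℝ) ×ˢ Ioi (0 : ℝ))
  have hb : MemLp b 2 μ := memLp_inv_one_add_sq_prod.restrict _
  let B := (eLpNorm b 2 μ).toReal
  have hB : 0 ≤ B := ENNReal.toReal_nonneg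
  refine ⟨(C0 + C1 + C2 + C3) * B, fun ξ => ?_⟩
  have hw := wt_pos ξ
  obtain ⟨Φ, hΦ, hΦ'⟩ := holderL2BoundOn_of_bound (τ := τ) hU (μ := μ) (b := b)
    (φ := fun x q => (q.1 : ℂ) ^ k * (q.2 : ℂ) ^ l * mixedD2 a k' l' (K x) ξ q.1 q.2) hb
    (c := (C0 + C1 + C2 + C3) * (wt ξ ^ M)⁻¹) (by positivity) (fun x hx => by
      refine ContinuousOn.aestronglyMeasurable ?_ (measurableSet_Ioi.prod measurableSet_Ioi)
      exact (ContinuousOn.mul (Continuous.continuousOn (by fun_prop))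
        ((continuousOn_mixedD2 (h.1 x hx) a k' l' ξ).mono
        (prod_mono Ioi_subset_Ici_self Ioi_subset_Ici_self)))) (by
      refine (ae_restrict_iff' (measurableSet_Ioi.prod measurableSet_Ioi)).2
        (Eventually.of_forall fun q hq => ?_)
      have hy : 0 ≤ q.1 := le_of_lt hq.1
      have hw : 0 ≤ q.2 := le_of_lt hq.2
      have hs := (((hC0 ξ q.1 hy q.2 hw).add hU (hC1 ξ q.1 hy q.2 hw)).add hU
        (hC2 ξ q.1 hy q.2 hw)).add hU (hC3 ξ q.1 hy q.2 hw)
      have hp : 0 < (1 + q.1 ^ 2) * (1 + q.2 ^ 2) := by positivity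
      have hpc : ((((1 + q.1 ^ 2) * (1 + q.2 ^ 2) : ℝ)) : ℂ) ≠ 0 := by exact_mod_cast hp.ne'
      refine ((hs.const_mul hU ((((1 + q.1 ^ 2) * (1 + q.2 ^ 2) : ℝ)) : ℂ)⁻¹).congr
        fun x hx => ?_).mono (le_of_eq ?_)
      · rw [eq_inv_mul_iff_mul_eq₀ hpc]
        push_cast
        ring
      · rw [norm_inv, Complex.norm_real, Real.norm_of_nonneg hp.le, mul_inv]
        simp only [b]
        ring)
  refine ⟨Φ, hΦ, HolderOn.mono (k := ⌊τ⌋₊) (θ := τ - ⌊τ⌋₊) hΦ' ?_⟩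
  calc (C0 + C1 + C2 + C3) * (wt ξ ^ M)⁻¹ * B = (C0 + C1 + C2 + C3) * B * (wt ξ ^ M)⁻¹ := by ring
    _ ≤ _ := by gcongr; exact hM ξ

theorem KernelBound1.isSymbolKernel (hU : Body U) {K : Eu N → Eu d → ℝ → ℂ}
    (h : KernelBound1 τ U K) (m : ℝ) : IsSymbolKernel τ m U K := by
  refine ⟨h.1, fun ξ y hy => h.holderBound ξ hy, fun r a l l' => ?_⟩
  obtain ⟨M, hM⟩ := inv_wt_pow_le_bracket_rpow (m + 1 / 2 - l + l' - r)
  obtain ⟨C0, h0, hC0⟩ := h.weight_bound hU a l l' M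
  obtain ⟨C1, h1, hC1⟩ := h.weight_bound hU a (l + 2) l' M
  let b : ℝ → ℝ := fun y => (1 + y ^ 2)⁻¹
  let μ : Measure ℝ := volume.restrict (Ioi (0 : ℝ))
  have hb : MemLp b 2 μ := memLp_inv_one_add_sq.restrict _
  let B := (eLpNorm b 2 μ).toReal
  have hB : 0 ≤ B := ENNReal.toReal_nonneg
  refine ⟨(C0 + C1) * B, fun ξ => ?_⟩
  have hw := wt_pos ξ
  obtain ⟨Φ, hΦ, hΦ'⟩ := holderL2BoundOn_of_bound (τ := τ) hU (μ := μ) (b := b)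
    (φ := fun x y => (y : ℂ) ^ l * mixedD a l' (K x) ξ y) hb
    (c := (C0 + C1) * (wt ξ ^ M)⁻¹) (by positivity) (fun x hx => by
      refine ContinuousOn.aestronglyMeasurable ?_ measurableSet_Ioi
      exact (ContinuousOn.mul (Continuous.continuousOn (by fun_prop))
        ((continuousOn_mixedD (h.1 x hx) a l' ξ).mono Ioi_subset_Ici_self))) (by
      refine (ae_restrict_iff' measurableSet_Ioi).2 (Eventually.of_forall fun y hy => ?_)
      have hy : 0 ≤ y := le_of_lt hy
      have hs := (hC0 ξ y hy).add hU (hC1 ξ y hy)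
      have hp : 0 < 1 + y ^ 2 := by positivity
      have hpc : ((1 + y ^ 2 : ℝ) : ℂ) ≠ 0 := by exact_mod_cast hp.ne'
      refine ((hs.const_mul hU ((1 + y ^ 2 : ℝ) : ℂ)⁻¹).congr fun x hx => ?_).mono (le_of_eq ?_)
      · rw [eq_inv_mul_iff_mul_eq₀ hpc]
        push_cast
        ring
      · rw [norm_inv, Complex.norm_real, Real.norm_of_nonneg hp.le]
        simp only [b]
        ring)
  refine ⟨Φ, hΦ, HolderOn.mono (k := ⌊τ⌋₊) (θ := τ - ⌊τ⌋₊) hΦ' ?_⟩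
  calc (C0 + C1) * (wt ξ ^ M)⁻¹ * B = (C0 + C1) * B * (wt ξ ^ M)⁻¹ := by ring
    _ ≤ _ := by gcongr; exact hM ξ

end SupToL2

open Smooth

/-! ### From `L²` bounds to supremum bounds -/

/-- The kernel of the functional that recovers `y^k u(y)` from `s^k u(s)` and `s^k u'(s)`. -/
def evalKer (y : ℝ) (k i : ℕ) (s : ℝ) : ℝ :=
  (Ioc y (y + 1)).indicator (fun s => (y / s) ^ k * (y + 1 - s) ^ i) s

theorem measurable_evalKer (y : ℝ) (k i : ℕ) : Measurable (evalKer y k i) := by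
  unfold evalKer
  exact Measurable.indicator (by fun_prop) measurableSet_Ioc

/-- On the support y < s ≤ y + 1 both y/s and y + 1 - s lie in [0, 1]. As the support has length
one, the L² norm is at most one, uniformly in y. -/
theorem abs_evalKer_le {y : ℝ} (hy : 0 ≤ y) (k i : ℕ) (s : ℝ) :
    |evalKer y k i s| ≤ (Ioc y (y + 1)).indicator (fun _ => 1) s := by
  unfold evalKer
  by_cases hs : s ∈ Ioc y (y + 1)
  · have hs0 : 0 < s := hy.trans_lt hs.1
    rw [indicator_of_mem hs, indicator_of_mem hs, abs_of_nonneg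
      (mul_nonneg (by positivity) (pow_nonneg (by linarith [hs.2]) _))]
    refine mul_le_one₀ (pow_le_one₀ (by positivity) ((div_le_one hs0).2 hs.1.le))
      (pow_nonneg (by linarith [hs.2]) _) (pow_le_one₀ (by linarith [hs.2]) (by linarith [hs.1]))
  · simp [hs]

/-- Integration by parts of (y + 1 - s) u'(s) over [y, y + 1], where the boundary term at y + 1
vanishes: u(y) is the integral of u minus that of (y + 1 - s) u'. The factor y^k is written as
(y/s)^k s^k, so that only s^k u and s^k u' enter, with bounded coefficients. -/
theorem eval_identity {u u' : ℝ → ℂ} (hu : ∀ s, 0 ≤ s → HasDerivWithinAt u (u' s) (Ici 0) s)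
    (hc : ContinuousOn u' (Ici 0)) (k : ℕ) {y : ℝ} (hy : 0 ≤ y) :
    (y : ℂ) ^ k * u y = (∫ s in Ioi (0 : ℝ), (evalKer y k 0 s : ℂ) * ((s : ℂ) ^ k * u s)) -
      ∫ s in Ioi (0 : ℝ), (evalKer y k 1 s : ℂ) * ((s : ℂ) ^ k * u' s) := by
  have hsub : Ioc y (y + 1) ⊆ Ioi 0 := fun s hs => hy.trans_lt hs.1
  have hker : ∀ (i : ℕ) (v : ℝ → ℂ), ∫ s in Ioi (0 : ℝ), (evalKer y k i s : ℂ) * ((s : ℂ) ^ k * v s)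
      = (y : ℂ) ^ k * ∫ s in y..(y + 1), ((y + 1 - s : ℝ) : ℂ) ^ i * v s := by
    intro i v
    rw [intervalIntegral.integral_of_le (by linarith), ← integral_const_mul]
    have h1 : ∀ s, (evalKer y k i s : ℂ) * ((s : ℂ) ^ k * v s) = (Ioc y (y + 1)).indicator
        (fun s => (y : ℂ) ^ k * (((y + 1 - s : ℝ) : ℂ) ^ i * v s)) s := by
      intro s
      by_cases hs : s ∈ Ioc y (y + 1)
      · have hs0 : (s : ℂ) ≠ 0 := by exact_mod_cast (hsub hs).ne'
        rw [evalKer, indicator_of_mem hs, indicator_of_mem hs]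
        push_cast
        rw [div_pow]
        field_simp
      · rw [evalKer, indicator_of_notMem hs, indicator_of_notMem hs]
        simp
    simp_rw [h1]
    rw [setIntegral_indicator measurableSet_Ioc, inter_eq_self_of_subset_right hsub]
  rw [hker, hker, ← mul_sub]
  congr 1
  have hIcc : uIcc y (y + 1) ⊆ Ici 0 := by
    rw [uIcc_of_le (by linarith)]
    exact fun s hs => hy.trans hs.1
  have h2 := intervalIntegral.integral_mul_deriv_eq_deriv_mul_of_hasDerivWithinAt
    (a := y) (b := y + 1) (u := fun s => ((y + 1 - s : ℝ) : ℂ)) (u' := fun _ => -1) (v := u)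
    (v' := u') (fun s _ => by
      have := ((hasDerivAt_id s).const_sub (y + 1)).ofReal_comp.hasDerivWithinAt
        (s := uIcc y (y + 1))
      simpa using this) (fun s hs => (hu s (hIcc hs)).mono hIcc) intervalIntegrable_const
    (hc.mono hIcc).intervalIntegrable
  simp only [pow_zero, one_mul, pow_one]
  rw [h2]
  simp

section Functional

variable {Y : Type} [MeasurableSpace Y] {μ : Measure Y} {N : ℕ} {τ : ℝ} {U : Set (Eu N)}

theorem memLp_of_le_indicator {κ : Y → ℝ} (hm : Measurable κ) {S : Set Y} (hS : MeasurableSet S)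
    (hμ : μ S ≤ 1) (hκ : ∀ y, |κ y| ≤ S.indicator (fun _ => 1) y) :
    MemLp κ 2 μ ∧ eLpNorm κ 2 μ ≤ 1 := by
  have h1 : MemLp (S.indicator fun _ => (1 : ℝ)) 2 μ :=
    memLp_indicator_const 2 hS 1 (Or.inr (hμ.trans_lt (by simp)).ne)
  have h2 : ∀ᵐ y ∂μ, ‖κ y‖ ≤ S.indicator (fun _ => (1 : ℝ)) y := Eventually.of_forall hκ
  refine ⟨h1.mono hm.aestronglyMeasurable (h2.mono fun s hs => hs.trans (le_abs_self _)), ?_⟩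
  refine (eLpNorm_mono_ae_real h2).trans ?_
  rw [eLpNorm_indicator_const hS (by simp) (by simp), enorm_one, one_mul]
  exact ENNReal.rpow_le_one hμ (by simp)

/-- The L² inner product with κ. Since κ is real, the conjugation in its first slot has no effect;
scalars are restricted to ℝ because the Hölder classes are real. -/
theorem exists_functional {κ : Y → ℝ} (hκ : MemLp κ 2 μ) (h1 : eLpNorm κ 2 μ ≤ 1) :
    ∃ L : Lp ℂ 2 μ →L[ℝ] ℂ, ‖L‖ ≤ 1 ∧ ∀ (Φ : Lp ℂ 2 μ) (φ : Y → ℂ), Φ =ᵐ[μ] φ →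
      L Φ = ∫ y, (κ y : ℂ) * φ y ∂μ := by
  have hc : MemLp (fun y => (κ y : ℂ)) 2 μ := hκ.ofReal
  refine ⟨(innerSL ℂ hc.toLp).restrictScalars ℝ, ?_, fun Φ φ hΦ => ?_⟩
  · rw [ContinuousLinearMap.norm_restrictScalars, innerSL_apply_norm, Lp.norm_toLp]
    refine ENNReal.toReal_le_of_le_ofReal zero_le_one ?_
    rw [ENNReal.ofReal_one]
    refine le_trans (le_of_eq (eLpNorm_congr_norm_ae (Eventually.of_forall fun y => ?_))) h1
    simp
  · rw [ContinuousLinearMap.coe_restrictScalars', innerSL_apply_apply, L2.inner_def]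
    refine integral_congr_ae ?_
    filter_upwards [hΦ, hc.coeFn_toLp] with y h2 h3
    rw [h2, h3]
    simp [mul_comm]

theorem HolderL2BoundOn.functional (hU : Body U) {φ : Eu N → Y → ℂ} {B : ℝ}
    (h : HolderL2BoundOn τ U μ φ B) {κ : Y → ℝ} (hκ : MemLp κ 2 μ) (h1 : eLpNorm κ 2 μ ≤ 1) :
    HolderBoundOn τ U (fun x => ∫ y, (κ y : ℂ) * φ x y ∂μ) B := by
  obtain ⟨Φ, hΦ, hB⟩ := h
  obtain ⟨L, hL, hL'⟩ := exists_functional hκ h1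
  obtain ⟨x₀, hx₀⟩ := hU.int
  have hB' : HolderOn ⌊τ⌋₊ (τ - ⌊τ⌋₊) U Φ B := hB
  have h0 : 0 ≤ B := (norm_nonneg _).trans (hB'.norm_le (interior_subset hx₀))
  exact ((hB'.clm_comp hU.unique L).mono (mul_le_of_le_one_left h0 hL)).congr
    fun x hx => (hL' _ _ (hΦ x hx)).symm

theorem HolderL2BoundOn.integrable {φ : Eu N → Y → ℂ} {B : ℝ}
    (h : HolderL2BoundOn τ U μ φ B) {κ : Y → ℝ} (hκ : MemLp κ 2 μ) {x : Eu N} (hx : x ∈ U) :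
    Integrable (fun y => (κ y : ℂ) * φ x y) μ := by
  obtain ⟨Φ, hΦ, -⟩ := h
  have h2 : MemLp (φ x) 2 μ := (memLp_congr_ae (hΦ x hx)).1 (Lp.memLp (Φ x))
  exact MemLp.integrable_mul (p := 2) (q := 2) hκ.ofReal h2

end Functional

section L2ToSup

variable {N d : ℕ} {τ : ℝ} {U : Set (Eu N)}

theorem memLp_evalKer {y : ℝ} (hy : 0 ≤ y) (k i : ℕ) :
    MemLp (evalKer y k i) 2 (volume.restrict (Ioi (0 : ℝ))) ∧
      eLpNorm (evalKer y k i) 2 (volume.restrict (Ioi (0 : ℝ))) ≤ 1 :=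
  memLp_of_le_indicator (measurable_evalKer y k i) measurableSet_Ioc
    ((Measure.restrict_apply_le _ _).trans (by simp)) (abs_evalKer_le hy k i)

theorem memLp_evalKer_mul {y w : ℝ} (hy : 0 ≤ y) (hw : 0 ≤ w) (k i l j : ℕ) :
    MemLp (fun q : ℝ × ℝ => evalKer y k i q.1 * evalKer w l j q.2) 2
      (volume.restrict (Ioi (0 : ℝ) ×ˢ Ioi (0 : ℝ))) ∧
    eLpNorm (fun q : ℝ × ℝ => evalKer y k i q.1 * evalKer w l j q.2) 2
      (volume.restrict (Ioi (0 : ℝ) ×ˢ Ioi (0 : ℝ))) ≤ 1 := by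
  refine memLp_of_le_indicator
    (((measurable_evalKer y k i).comp measurable_fst).mul
      ((measurable_evalKer w l j).comp measurable_snd))
    (measurableSet_Ioc.prod measurableSet_Ioc) (S := Ioc y (y + 1) ×ˢ Ioc w (w + 1)) ?_ fun q => ?_
  · refine (Measure.restrict_apply_le _ _).trans ?_
    rw [Measure.volume_eq_prod, Measure.prod_prod]
    simp
  · rw [abs_mul]
    refine (mul_le_mul (abs_evalKer_le hy k i q.1) (abs_evalKer_le hw l j q.2) (abs_nonneg _)
      (indicator_nonneg (fun _ _ => zero_le_one) _)).trans_eq ?_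
    by_cases h1 : q.1 ∈ Ioc y (y + 1)
    · by_cases h2 : q.2 ∈ Ioc w (w + 1)
      · rw [indicator_of_mem h1, indicator_of_mem h2, indicator_of_mem (show q ∈ Ioc y (y + 1) ×ˢ Ioc w (w + 1) from ⟨h1, h2⟩), one_mul]
      · rw [indicator_of_notMem h2, indicator_of_notMem
          (show q ∉ Ioc y (y + 1) ×ˢ Ioc w (w + 1) from fun h => h2 h.2), mul_zero]
    · rw [indicator_of_notMem h1, indicator_of_notMem
        (show q ∉ Ioc y (y + 1) ×ˢ Ioc w (w + 1) from fun h => h1 h.1), zero_mul]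

theorem hasDerivWithinAt_mixedD2_y {g : Eu d → ℝ → ℝ → ℂ}
    (hg : ContDiffOn ℝ ∞ (fun q : Eu d × ℝ × ℝ => g q.1 q.2.1 q.2.2) (univ ×ˢ (Ici 0 ×ˢ Ici 0)))
    {r : ℕ} (a : Fin r → Fin d) (k l : ℕ) (ξ : Eu d) {y w : ℝ} (hy : 0 ≤ y) (hw : 0 ≤ w) :
    HasDerivWithinAt (fun s => mixedD2 a k l g ξ s w) (mixedD2 a (k + 1) l g ξ y w) (Ici 0) y := by
  have he := (Smooth.of hg).mixedD2_eq (fun _ _ _ _ _ => rfl) (d := d) (r := r) (g := g)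
  have h := (mix a k l (Smooth.of hg)).hasDerivWithinAt_y ξ hy hw
  rw [D_ey_mix, ← he _ _ _ _ hy hw] at h
  exact h.congr (fun s hs => he _ _ _ _ hs hw) (he _ _ _ _ hy hw)

theorem hasDerivWithinAt_mixedD2_w {g : Eu d → ℝ → ℝ → ℂ}
    (hg : ContDiffOn ℝ ∞ (fun q : Eu d × ℝ × ℝ => g q.1 q.2.1 q.2.2) (univ ×ˢ (Ici 0 ×ˢ Ici 0)))
    {r : ℕ} (a : Fin r → Fin d) (k l : ℕ) (ξ : Eu d) {y w : ℝ} (hy : 0 ≤ y) (hw : 0 ≤ w) :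
    HasDerivWithinAt (fun s => mixedD2 a k l g ξ y s) (mixedD2 a k (l + 1) g ξ y w) (Ici 0) w := by
  have he := (Smooth.of hg).mixedD2_eq (fun _ _ _ _ _ => rfl) (d := d) (r := r) (g := g)
  have h := (mix a k l (Smooth.of hg)).hasDerivWithinAt_w ξ hy hw
  rw [D_ew_mix, ← he _ _ _ _ hy hw] at h
  exact h.congr (fun s hs => he _ _ _ _ hy hs) (he _ _ _ _ hy hw)

theorem hasDerivWithinAt_mixedD {h : Eu d → ℝ → ℂ}
    (hh : ContDiffOn ℝ ∞ (fun q : Eu d × ℝ => h q.1 q.2) (univ ×ˢ Ici 0))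
    {r : ℕ} (a : Fin r → Fin d) (l : ℕ) (ξ : Eu d) {y : ℝ} (hy : 0 ≤ y) :
    HasDerivWithinAt (fun s => mixedD a l h ξ s) (mixedD a (l + 1) h ξ y) (Ici 0) y := by
  have := hasDerivWithinAt_mixedD2_y (g := fun ξ y _ => h ξ y) (contDiffOn_const_extension hh)
    a l 0 ξ hy (le_refl (0 : ℝ))
  simpa only [← mixedD_eq_mixedD2] using this

/-- `eval_identity` expresses the pointwise value by two functionals of norm at most one on L², so
the L² bounds for l' and l' + 1 normal derivatives give a bound uniform in y. -/
theorem kernelBound1_of_isSymbolKernel (hU : Body U) {h : Eu N → Eu d → ℝ → ℂ}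
    (H : ∀ m : ℝ, IsSymbolKernel τ m U h) : KernelBound1 τ U h := by
  have hsm := (H 0).1
  refine ⟨hsm, fun r a β l l' => ?_⟩
  have key : ∀ M : ℕ, ∃ C : ℝ, ∀ (i : Ici (0 : ℝ)) (ξ : Eu d), HolderBoundOn τ U
      (fun x => (i.1 : ℂ) ^ l * mixedD a l' (h x) ξ i.1) (C * (wt ξ ^ M)⁻¹) := by
    intro M
    -- The order is chosen such that the exponent of ⟨ξ⟩ becomes -2M; in the next line it is
    -- adjusted to one more normal derivative.
    obtain ⟨C0, hC0⟩ := (H (-(2 * M) - 1 / 2 + l - l' + r)).2.2 r a l l'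
    obtain ⟨C1, hC1⟩ := (H (-(2 * M) - 1 / 2 + l - (l' + 1 : ℕ) + r)).2.2 r a l (l' + 1)
    refine ⟨C0 + C1, fun i ξ => ?_⟩
    have e0 := hC0 ξ
    have e1 := hC1 ξ
    rw [show (-(2 * M) - 1 / 2 + l - l' + r + 1 / 2 - l + l' - r : ℝ) = -(2 * M) by ring,
      bracket_rpow_neg_two_mul] at e0
    rw [show (-(2 * M) - 1 / 2 + l - (l' + 1 : ℕ) + r + 1 / 2 - l + (l' + 1 : ℕ) - r : ℝ)
      = -(2 * M) by ring, bracket_rpow_neg_two_mul] at e1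
    have f0 := e0.functional hU (memLp_evalKer i.2 l 0).1 (memLp_evalKer i.2 l 0).2
    have f1 := (e1.functional hU (memLp_evalKer i.2 l 1).1 (memLp_evalKer i.2 l 1).2).const_mul hU
      (-1)
    rw [norm_neg, norm_one, one_mul] at f1
    rw [add_mul]
    refine (f0.add hU f1).congr fun x hx => ?_
    rw [eval_identity (fun s hs => hasDerivWithinAt_mixedD (hsm x hx) a l' ξ hs)
      (continuousOn_mixedD (hsm x hx) a (l' + 1) ξ) l i.2]
    ring
  obtain ⟨C, hC⟩ := exists_monom_bound hU key β
  exact ⟨C, fun z y hy => (hC ⟨y, hy⟩ z).congr fun x hx => by ring⟩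

theorem integral_quadrant_eq {F : ℝ × ℝ → ℂ} {κ κ' : ℝ → ℝ} {k l : ℕ}
    (hF : Integrable (fun q : ℝ × ℝ => ((κ q.1 * κ' q.2 : ℝ) : ℂ) *
      ((q.1 : ℂ) ^ k * (q.2 : ℂ) ^ l * F q)) (volume.restrict (Ioi (0 : ℝ) ×ˢ Ioi (0 : ℝ)))) :
    Integrable (fun r => (κ' r : ℂ) * ((r : ℂ) ^ l *
      ∫ s in Ioi (0 : ℝ), (κ s : ℂ) * ((s : ℂ) ^ k * F (s, r)))) (volume.restrict (Ioi (0 : ℝ))) ∧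
    ∫ q in Ioi (0 : ℝ) ×ˢ Ioi (0 : ℝ), ((κ q.1 * κ' q.2 : ℝ) : ℂ) *
      ((q.1 : ℂ) ^ k * (q.2 : ℂ) ^ l * F q) = ∫ r in Ioi (0 : ℝ), (κ' r : ℂ) * ((r : ℂ) ^ l *
      ∫ s in Ioi (0 : ℝ), (κ s : ℂ) * ((s : ℂ) ^ k * F (s, r))) := by
  have e : ∀ r, ∫ s in Ioi (0 : ℝ), ((κ s * κ' r : ℝ) : ℂ) * ((s : ℂ) ^ k * (r : ℂ) ^ l * F (s, r))
      = (κ' r : ℂ) * ((r : ℂ) ^ l * ∫ s in Ioi (0 : ℝ), (κ s : ℂ) * ((s : ℂ) ^ k * F (s, r))) := by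
    intro r
    rw [← integral_const_mul, ← integral_const_mul]
    refine integral_congr_ae (Eventually.of_forall fun s => ?_)
    simp only
    push_cast
    ring
  rw [Measure.volume_eq_prod, ← Measure.prod_restrict] at hF ⊢
  have h1 := hF.integral_prod_right
  simp only [e] at h1
  refine ⟨h1, ?_⟩
  rw [integral_prod_symm _ hF]
  simp only [e]

/-- `eval_identity` in w and then in y gives four pairings with products of evaluation kernels, for
up to one additional derivative in each normal variable. `integral_quadrant_eq` turns the iterated
integrals into integrals over the quadrant. -/
theorem kernelBound2_of_isSymbolKernel2 (hU : Body U) {g : Eu N → Eu d → ℝ → ℝ → ℂ}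
    (H : ∀ m : ℝ, IsSymbolKernel2 τ m U g) : KernelBound2 τ U g := by
  have hsm := (H 0).1
  refine ⟨hsm, fun r a β k k' l l' => ?_⟩
  have key : ∀ M : ℕ, ∃ C : ℝ, ∀ (i : Quadrant) (ξ : Eu d), HolderBoundOn τ U
      (fun x => (i.1.1 : ℂ) ^ k * (i.1.2 : ℂ) ^ l * mixedD2 a k' l' (g x) ξ i.1.1 i.1.2)
      (C * (wt ξ ^ M)⁻¹) := by
    intro M
    have bd : ∀ k' l' : ℕ, ∃ C : ℝ, ∀ ξ, HolderL2BoundOn τ U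
        (volume.restrict (Ioi (0 : ℝ) ×ˢ Ioi (0 : ℝ)))
        (fun x q => (q.1 : ℂ) ^ k * (q.2 : ℂ) ^ l * mixedD2 a k' l' (g x) ξ q.1 q.2)
        (C * (wt ξ ^ M)⁻¹) := by
      intro k' l'
      obtain ⟨C, hC⟩ := (H (-(2 * M) - 1 + k - k' + l - l' + r)).2.2 r a k k' l l'
      refine ⟨C, fun ξ => ?_⟩
      have := hC ξ
      rwa [show (-(2 * M) - 1 + k - k' + l - l' + r + 1 - k + k' - l + l' - r : ℝ) = -(2 * M) by
        ring, bracket_rpow_neg_two_mul] at this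
    obtain ⟨C00, h00⟩ := bd k' l'
    obtain ⟨C10, h10⟩ := bd (k' + 1) l'
    obtain ⟨C01, h01⟩ := bd k' (l' + 1)
    obtain ⟨C11, h11⟩ := bd (k' + 1) (l' + 1)
    refine ⟨C00 + C10 + C01 + C11, fun i ξ => ?_⟩
    obtain ⟨⟨y, w⟩, hy, hw⟩ := i
    simp only at hy hw
    have m := fun i j => memLp_evalKer_mul hy hw k i l j
    have f00 := (h00 ξ).functional hU (m 0 0).1 (m 0 0).2
    have f10 := ((h10 ξ).functional hU (m 1 0).1 (m 1 0).2).const_mul hU (-1)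
    have f01 := ((h01 ξ).functional hU (m 0 1).1 (m 0 1).2).const_mul hU (-1)
    have f11 := (h11 ξ).functional hU (m 1 1).1 (m 1 1).2
    rw [norm_neg, norm_one, one_mul] at f10 f01
    simp only [add_mul]
    refine (((f00.add hU f10).add hU f01).add hU f11).congr fun x hx => ?_
    have hs := hsm x hx
    obtain ⟨i00, q00⟩ := integral_quadrant_eq ((h00 ξ).integrable (m 0 0).1 hx)
    obtain ⟨i10, q10⟩ := integral_quadrant_eq ((h10 ξ).integrable (m 1 0).1 hx)
    obtain ⟨i01, q01⟩ := integral_quadrant_eq ((h01 ξ).integrable (m 0 1).1 hx)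
    obtain ⟨i11, q11⟩ := integral_quadrant_eq ((h11 ξ).integrable (m 1 1).1 hx)
    rw [q00, q10, q01, q11]
    have cont : ∀ k' l' : ℕ, ∀ s : ℝ, 0 ≤ s →
        ContinuousOn (fun t => mixedD2 a k' l' (g x) ξ t s) (Ici 0) ∧
        ContinuousOn (fun t => mixedD2 a k' l' (g x) ξ s t) (Ici 0) := fun k' l' s h0 =>
      ⟨(continuousOn_mixedD2 hs a k' l' ξ).comp (f := fun t : ℝ => (t, s)) (by fun_prop)
        fun t ht => ⟨ht, h0⟩,
       (continuousOn_mixedD2 hs a k' l' ξ).comp (f := fun t : ℝ => (s, t)) (by fun_prop)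
        fun t ht => ⟨h0, ht⟩⟩
    have ew := eval_identity (u := fun t => mixedD2 a k' l' (g x) ξ y t)
      (u' := fun t => mixedD2 a k' (l' + 1) (g x) ξ y t)
      (fun s h0 => hasDerivWithinAt_mixedD2_w hs a k' l' ξ hy h0) (cont _ _ y hy).2 l hw
    -- The identity in y, applied under the integral over the second normal variable. Integrability
    -- of the two resulting terms is needed to split the integral.
    have step : ∀ j l', (Integrable (fun r => (evalKer w l j r : ℂ) * ((r : ℂ) ^ l *
          ∫ s in Ioi (0 : ℝ), (evalKer y k 0 s : ℂ) * ((s : ℂ) ^ k *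
          mixedD2 a k' l' (g x) ξ s r))) (volume.restrict (Ioi (0 : ℝ)))) →
        (Integrable (fun r => (evalKer w l j r : ℂ) * ((r : ℂ) ^ l *
          ∫ s in Ioi (0 : ℝ), (evalKer y k 1 s : ℂ) * ((s : ℂ) ^ k *
          mixedD2 a (k' + 1) l' (g x) ξ s r))) (volume.restrict (Ioi (0 : ℝ)))) →
        (y : ℂ) ^ k * (∫ r in Ioi (0 : ℝ), (evalKer w l j r : ℂ) * ((r : ℂ) ^ l *
          mixedD2 a k' l' (g x) ξ y r)) =
        (∫ r in Ioi (0 : ℝ), (evalKer w l j r : ℂ) * ((r : ℂ) ^ l *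
          ∫ s in Ioi (0 : ℝ), (evalKer y k 0 s : ℂ) * ((s : ℂ) ^ k *
          mixedD2 a k' l' (g x) ξ s r))) -
        ∫ r in Ioi (0 : ℝ), (evalKer w l j r : ℂ) * ((r : ℂ) ^ l *
          ∫ s in Ioi (0 : ℝ), (evalKer y k 1 s : ℂ) * ((s : ℂ) ^ k *
          mixedD2 a (k' + 1) l' (g x) ξ s r)) := by
      intro j l' j0 j1
      rw [← integral_sub j0 j1, ← integral_const_mul]
      refine setIntegral_congr_fun measurableSet_Ioi fun r hr => ?_
      have h0 : (0 : ℝ) ≤ r := le_of_lt hr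
      have := eval_identity (u := fun t => mixedD2 a k' l' (g x) ξ t r)
        (u' := fun t => mixedD2 a (k' + 1) l' (g x) ξ t r)
        (fun t h1 => hasDerivWithinAt_mixedD2_y hs a k' l' ξ h1 h0) (cont _ _ r h0).1 k hy
      beta_reduce at this ⊢
      rw [← mul_sub, ← mul_sub, ← this]
      ring
    rw [mul_assoc, ew, mul_sub, step 0 l' i00 i10, step 1 (l' + 1) i01 i11]
    ring
  obtain ⟨C, hC⟩ := exists_monom_bound hU key β
  exact ⟨C, fun z y hy w hw => (hC ⟨(y, w), hy, hw⟩ z).congr fun x hx => by ring⟩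

/-- No Fourier transform is involved: p itself satisfies both sets of estimates, since arbitrary
weights in ξ and arbitrary monomials in ξ control each other. -/
theorem isSymbol_iff_kernelBound {p : Eu d → Eu d → ℂ} :
    (∀ m : ℝ, IsSymbol τ m p) ↔ KernelBound τ p := by
  have hU := body_univ d
  constructor
  · intro H
    refine ⟨(H 0).1, fun r a β => ?_⟩
    obtain ⟨C, hC⟩ := exists_monom_bound (ι := Unit) (τ := τ) (φ := fun _ x ξ => partialD a (p x) ξ)
      hU (fun M => by
        obtain ⟨C, hC⟩ := (H (-(2 * M) + r)).2 r a
        refine ⟨C, fun _ ξ => ?_⟩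
        have := hC ξ
        rwa [show (-(2 * M) + r - r : ℝ) = -(2 * M) by ring, bracket_rpow_neg_two_mul] at this) β
    exact ⟨C, fun z => hC () z⟩
  · rintro ⟨h1, h2⟩ m
    refine ⟨h1, fun r a => ?_⟩
    obtain ⟨M, hM⟩ := inv_wt_pow_le_bracket_rpow (m - r)
    obtain ⟨C, h0, hC⟩ := exists_weight_bound (ι := Unit) (τ := τ)
      (φ := fun _ x ξ => partialD a (p x) ξ) hU (fun β => by
        obtain ⟨C, hC⟩ := h2 r a β
        exact ⟨C, fun _ ξ => hC ξ⟩) M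
    exact ⟨C, fun ξ => (hC () ξ).mono (mul_le_mul_of_nonneg_left (hM ξ) h0)⟩

end L2ToSup

open Smooth

/-! ### Constant multiples of kernels -/

section ConstMul

variable {N d : ℕ} {τ : ℝ} {U : Set (Eu N)}

theorem KernelBound.const_mul {K : Eu d → Eu d → ℂ} (h : KernelBound τ K) (c : ℂ) :
    KernelBound τ fun x z => c * K x z :=
  kernelBound_iff_rapidFam.2 ((kernelBound_iff_rapidFam.1 h).const_mul (body_univ d) c)

theorem mixedD2_const_mul {r : ℕ} (a : Fin r → Fin d) (k l : ℕ) (c : ℂ) {g : Eu d → ℝ → ℝ → ℂ}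
    (hg : ContDiffOn ℝ ∞ (fun q : Eu d × ℝ × ℝ => g q.1 q.2.1 q.2.2) (univ ×ˢ (Ici 0 ×ˢ Ici 0)))
    (ξ : Eu d) {y w : ℝ} (hy : 0 ≤ y) (hw : 0 ≤ w) :
    mixedD2 a k l (fun ξ y w => c * g ξ y w) ξ y w = c * mixedD2 a k l g ξ y w := by
  have h1 := fun η => (Smooth.of hg).mixedD2_inner_eq (g := g) (fun _ _ _ _ _ => rfl) k l η hy hw
  rw [mixedD2, mixedD2, ← partialD_const_mul a c (by rw [funext h1]; exact contDiff_x _ hy hw)]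
  refine partialD_congr a (fun η => ?_) ξ
  simp_rw [iteratedDerivWithin_const_mul_field]

theorem KernelBound2.const_mul (hU : Body U) {K : Eu N → Eu d → ℝ → ℝ → ℂ} (h : KernelBound2 τ U K)
    (c : ℂ) : KernelBound2 τ U fun x z y w => c * K x z y w := by
  refine ⟨fun x hx => contDiffOn_const.mul (h.1 x hx), fun r a β k k' l l' => ?_⟩
  obtain ⟨C, hC⟩ := h.2 r a β k k' l l'
  refine ⟨‖c‖ * C, fun z y hy w hw => ((hC z y hy w hw).const_mul hU c).congr fun x hx => ?_⟩
  rw [mixedD2_const_mul a k' l' c (h.1 x hx) z hy hw]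
  ring

theorem KernelBound1.const_mul (hU : Body U) {K : Eu N → Eu d → ℝ → ℂ} (h : KernelBound1 τ U K)
    (c : ℂ) : KernelBound1 τ U fun x z y => c * K x z y := by
  rw [kernelBound1_iff_tens hU] at h ⊢
  convert h.const_mul hU c using 5 with x z y w
  simp only [tens]
  ring

end ConstMul

/-! ### The Fourier inversion formula -/

theorem fourier_eq_four {n : ℕ} (u : Eu n → ℂ) : fourier u = four (-1) u := by
  funext ξ
  refine integral_congr_ae (Eventually.of_forall fun y => ?_)
  simp only [char, neg_one_smul, inner_neg_left, real_inner_comm]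

theorem fourierIntegral_eq_four {n : ℕ} (u : Eu n → ℂ) (w : Eu n) :
    FourierTransform.fourier u w = four (-1) u ((2 * Real.pi) • w) := by
  rw [Real.fourier_eq']
  refine integral_congr_ae (Eventually.of_forall fun y => ?_)
  simp only [char, smul_eq_mul, inner_smul_left, real_inner_comm]
  congr 2
  simp
  ring

theorem fourierIntegralInv_eq_four {n : ℕ} (u : Eu n → ℂ) (w : Eu n) :
    FourierTransformInv.fourierInv u w = four 1 u ((2 * Real.pi) • w) := by
  rw [Real.fourierInv_eq']
  refine integral_congr_ae (Eventually.of_forall fun y => ?_)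
  simp only [char, smul_eq_mul, inner_smul_left, real_inner_comm]
  congr 2
  simp
  ring

theorem four_comp_smul {n : ℕ} (s : ℝ) (u : Eu n → ℂ) (z : Eu n) {R : ℝ} (hR : 0 < R) :
    four s (fun ξ => u (R • ξ)) (R • z) = ((R : ℂ)⁻¹) ^ n * four s u z := by
  have h := Measure.integral_comp_smul (volume : Measure (Eu n))
    (fun ξ => char (s • z) ξ * u ξ) R
  rw [finrank_euclideanSpace_fin, abs_of_pos (by positivity)] at h
  rw [four, four]
  have h2 : ((R : ℂ)⁻¹) ^ n * ∫ ξ, char (s • z) ξ * u ξ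
      = ((R ^ n)⁻¹ : ℝ) • ∫ ξ, char (s • z) ξ * u ξ := by
    rw [Complex.real_smul]
    push_cast
    rw [inv_pow]
  rw [h2, ← h]
  refine integral_congr_ae (Eventually.of_forall fun y => ?_)
  simp only [char, inner_smul_left, inner_smul_right]
  congr 3
  simp
  ring

/-- The inversion formula with 2π in the exponent, rescaled by the dilation with factor 2π; its
Jacobian is the factor (2π)^{-n}. -/
theorem nfac_mul_four_four {n : ℕ} {u : Eu n → ℂ} (hu : Integrable u) (hc : Continuous u)
    (hf : Integrable (four (-1) u)) (z : Eu n) : nfac n * four 1 (four (-1) u) z = u z := by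
  have h2 : (0 : ℝ) < 2 * Real.pi := by positivity
  have hF : FourierTransform.fourier u = fun w => four (-1) u ((2 * Real.pi) • w) :=
    funext (fourierIntegral_eq_four u)
  have h := congrFun (hc.fourierInv_fourier_eq hu (by rw [hF]; exact hf.comp_smul h2.ne')) z
  rw [fourierIntegralInv_eq_four, hF, four_comp_smul 1 _ _ h2] at h
  exact h

/-! ### Fubini's theorem for Fourier integrals -/

section Fubini

variable {n : ℕ} {Y : Type} [MeasurableSpace Y] {μ : Measure Y}

theorem char_mul_char_neg (x b ξ : Eu n) : char x ξ * char (-b) ξ = char (x - b) ξ := by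
  rw [char, char, char, ← Complex.exp_add, ← mul_add, sub_eq_add_neg, inner_add_left]
  push_cast
  rfl

theorem integrable_char_mul_prod {h : Eu n → Y → ℂ} {b : Y → Eu n} (hb : Measurable b) {f : Y → ℂ}
    (hint : Integrable (fun q : Eu n × Y => h q.1 q.2 * f q.2) (volume.prod μ)) (x : Eu n) :
    Integrable (fun q : Eu n × Y => char x q.1 * (h q.1 q.2 * char (-(b q.2)) q.1 * f q.2))
      (volume.prod μ) := by
  have hm : Measurable fun q : Eu n × Y => char (x - b q.2) q.1 := by
    have := (continuous_char (n := n)).measurable.comp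
      ((measurable_const.sub (hb.comp measurable_snd)).prodMk measurable_fst :
        Measurable fun q : Eu n × Y => (x - b q.2, q.1))
    exact this
  refine (hint.bdd_mul (c := 1) hm.aestronglyMeasurable
    (Eventually.of_forall fun q => (norm_char _ _).le)).congr (Eventually.of_forall fun q => ?_)
  simp only [← char_mul_char_neg]
  ring

/-- Fubini's theorem. The map b extracts from y the variable dual to ξ: it is the identity for
pseudodifferential operators and the tangential projection when y also contains a normal variable.
-/
theorem integral_char_mul_integral [SFinite μ] {h : Eu n → Y → ℂ} {b : Y → Eu n} (hb : Measurable b) {f : Y → ℂ}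
    (hint : Integrable (fun q : Eu n × Y => h q.1 q.2 * f q.2) (volume.prod μ)) (x : Eu n) :
    ∫ ξ, char x ξ * ∫ y, h ξ y * char (-(b y)) ξ * f y ∂μ
      = ∫ y, four 1 (fun ξ => h ξ y) (x - b y) * f y ∂μ := by
  simp_rw [← integral_const_mul]
  rw [integral_integral_swap (integrable_char_mul_prod hb hint x)]
  refine integral_congr_ae (Eventually.of_forall fun y => ?_)
  simp only [four, ← integral_mul_const, one_smul, ← char_mul_char_neg]
  refine integral_congr_ae (Eventually.of_forall fun ξ => ?_)
  ring

theorem integrable_mul_prod {h : Eu n → Y → ℂ} {f : Y → ℂ} {C : ℝ}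
    (hm : AEStronglyMeasurable (fun q : Eu n × Y => h q.1 q.2) (volume.prod μ))
    (hC : ∀ᵐ q ∂(volume.prod μ), ‖h q.1 q.2‖ ≤ C * (wt q.1 ^ (n + 1))⁻¹) (hf : Integrable f μ) :
    Integrable (fun q : Eu n × Y => h q.1 q.2 * f q.2) (volume.prod μ) := by
  have h1 := ((integrable_inv_wt_pow n).const_mul C).mul_prod hf.norm
  refine h1.mono' (hm.mul hf.aestronglyMeasurable.comp_snd) (hC.mono fun q hq => ?_)
  rw [norm_mul]
  exact mul_le_mul_of_nonneg_right hq (norm_nonneg _)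

end Fubini

/-! ### Kernels of pseudodifferential and Poisson operators and of the truncation -/

section Psi

variable {n d : ℕ}

theorem RapidFn.integrable_mul_prod {p : Eu n → ℂ} (hp : RapidFn p) {f : Eu n → ℂ}
    {μ : Measure (Eu n)} [SFinite μ] (hf : Integrable f μ) :
    Integrable (fun q : Eu n × Eu n => p q.1 * f q.2) (volume.prod μ) :=
  hp.integrable.mul_prod hf

theorem opPsi_eq_integral {p : Eu n → Eu n → ℂ} {x : Eu n} (hp : RapidFn (p x))
    (f : SchwartzMap (Eu n) ℂ) :
    opPsi p f x = ∫ y, nfac n * four 1 (p x) (x - y) * f y := by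
  have h := integral_char_mul_integral (μ := (volume : Measure (Eu n))) (h := fun ξ _ => p x ξ)
    measurable_id (hp.integrable_mul_prod f.integrable) x
  simp only [id] at h
  simp only [mul_assoc, integral_const_mul, opPsi, fourier] at h ⊢
  rw [h]

/-- The Poisson operator is a pseudodifferential operator with a frozen normal variable. -/
theorem opPoisson_eq_integral {k : Eu (d + 1) → Eu d → ℝ → ℂ} {x : Eu (d + 1)}
    (hk : RapidFn fun ξ => k x ξ (nrm x)) (v : SchwartzMap (Eu d) ℂ) :
    opPoisson k v x = ∫ y, nfac d * four 1 (fun ξ => k x ξ (nrm x)) (tang x - y) * v y :=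
  opPsi_eq_integral (p := fun _ ξ => k x ξ (nrm x)) hk v

theorem continuous_nrm : Continuous (nrm (d := d)) := by
  unfold nrm; fun_prop

theorem measurableSet_halfSpace (d : ℕ) : MeasurableSet (halfSpace d) :=
  measurableSet_le measurable_const continuous_nrm.measurable

theorem fourier_extZero (f : Eu (d + 1) → ℂ) (ξ : Eu (d + 1)) :
    fourier (extZero f) ξ = ∫ y in halfSpace d, char (-y) ξ * f y := by
  rw [fourier, ← integral_indicator (measurableSet_halfSpace d)]
  refine integral_congr_ae (Eventually.of_forall fun y => ?_)
  simp only [extZero]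
  by_cases hy : y ∈ halfSpace d <;> simp [hy]

/-- For rapidly decreasing p x, Fubini's theorem shows that the integrand without cut-off is
integrable. As χ is bounded and χ(0) = 1, dominated convergence removes the cut-off. -/
theorem hasTruncValue_integral {p : Eu (d + 1) → Eu (d + 1) → ℂ} {x : Eu (d + 1)}
    (hp : RapidFn (p x)) (f : SchwartzMap (Eu (d + 1)) ℂ) :
    HasTruncValue p f x (∫ y in halfSpace d, nfac (d + 1) * four 1 (p x) (x - y) * f y) := by
  intro χ hχ
  have hint := hp.integrable_mul_prod (μ := volume.restrict (halfSpace d)) f.integrable.integrableOn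
  have h := integral_char_mul_integral (h := fun ξ _ => p x ξ) measurable_id hint x
  have hI := (integrable_char_mul_prod (h := fun ξ _ => p x ξ) measurable_id hint x).integral_prod_left
  have e : ∀ ξ, char x ξ * p x ξ * fourier (extZero f) ξ
      = ∫ y in halfSpace d, char x ξ * (p x ξ * char (-y) ξ * f y) := fun ξ => by
    simp only [fourier_extZero, mul_assoc, integral_const_mul]
  simp only [id] at h hI
  simp only [← e] at hI
  simp only [mul_assoc, integral_const_mul] at h ⊢
  rw [← h]
  refine Tendsto.const_mul _ ?_
  obtain ⟨C, hC⟩ : ∃ C, ∀ z, ‖χ z‖ ≤ C := ⟨_, χ.toBoundedContinuousFunction.norm_coe_le_norm⟩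
  simp only [mul_assoc] at hI
  have lim : Tendsto (fun ε : ℝ => ∫ ξ, χ (ε • ξ) * (char x ξ * (p x ξ * fourier (extZero f) ξ)))
      (𝓝[>] 0) (𝓝 (∫ ξ, char x ξ * (p x ξ * fourier (extZero f) ξ))) := by
    refine tendsto_integral_filter_of_dominated_convergence
      (fun ξ => C * ‖char x ξ * (p x ξ * fourier (extZero f) ξ)‖)
      (Eventually.of_forall fun ε => ?_) (Eventually.of_forall fun ε => Eventually.of_forall fun ξ => ?_)
      (hI.norm.const_mul C) (Eventually.of_forall fun ξ => ?_)
    · exact (χ.continuous.comp (continuous_const_smul ε)).aestronglyMeasurable.mul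
        hI.aestronglyMeasurable
    · rw [norm_mul]
      exact mul_le_mul_of_nonneg_right (hC _) (norm_nonneg _)
    · have hc : Continuous fun ε : ℝ => χ (ε • ξ) * (char x ξ * (p x ξ * fourier (extZero f) ξ)) :=
        (χ.continuous.comp (by fun_prop)).mul continuous_const
      have := hc.tendsto 0
      rw [zero_smul, hχ, one_mul] at this
      exact this.mono_left nhdsWithin_le_nhds
  convert lim using 2
  refine integral_congr_ae (Eventually.of_forall fun ξ => ?_)
  simp only [fourier_extZero]

end Psi

/-! ### Kernels of operators that integrate over a normal variable -/

section Normal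

variable {d : ℕ}

theorem norm_pt_sq (x' : Eu d) (t : ℝ) : ‖pt x' t‖ ^ 2 = ‖x'‖ ^ 2 + t ^ 2 := by
  rw [EuclideanSpace.norm_sq_eq, EuclideanSpace.norm_sq_eq, Fin.sum_univ_castSucc]
  simp [pt]

theorem continuous_pt : Continuous fun q : Eu d × ℝ => pt q.1 q.2 := by
  refine (PiLp.continuous_toLp 2 _).comp (continuous_pi fun i => ?_)
  refine Fin.lastCases ?_ (fun j => ?_) i
  · simpa using continuous_snd
  · simp only [Fin.snoc_castSucc]
    fun_prop

/-- The Schwartz seminorms with weight 2(d + 2) suffice: (1 + |(x', t)|)² dominates both 1 + |x'|²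
and 1 + t², and d + 1 of the d + 2 squares are spent on x', one on t. -/
theorem integrable_comp_pt (f : SchwartzMap (Eu (d + 1)) ℂ) :
    Integrable (fun q : Eu d × ℝ => f (pt q.1 q.2)) (volume.prod (volume.restrict (Ioi 0))) := by
  have h := ((integrable_inv_wt_pow d).mul_prod
    (integrable_inv_one_add_sq.restrict (s := Ioi (0 : ℝ)))).const_mul
    (2 ^ (2 * (d + 2)) * ((Finset.Iic (2 * (d + 2), 0)).sup
      fun m => SchwartzMap.seminorm ℝ m.1 m.2) f)
  refine h.mono' (f.continuous.comp continuous_pt).aestronglyMeasurable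
    (Eventually.of_forall fun q => ?_)
  have h1 := f.one_add_le_sup_seminorm_apply (𝕜 := ℝ) (m := (2 * (d + 2), 0)) le_rfl le_rfl
    (pt q.1 q.2)
  rw [norm_iteratedFDeriv_zero] at h1
  have hw := wt_pos q.1
  have hq : 0 < 1 + q.2 ^ 2 := by positivity
  rw [← mul_inv, ← div_eq_mul_inv, le_div_iff₀ (by positivity)]
  refine le_trans ?_ h1
  rw [mul_comm]
  refine mul_le_mul_of_nonneg_right ?_ (norm_nonneg _)
  have h2 : 1 + ‖pt q.1 q.2‖ ^ 2 ≤ (1 + ‖pt q.1 q.2‖) ^ 2 := by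
    nlinarith [norm_nonneg (pt q.1 q.2)]
  rw [norm_pt_sq] at h2
  rw [pow_mul, show d + 2 = (d + 1) + 1 from rfl, pow_succ _ (d + 1)]
  refine mul_le_mul (pow_le_pow_left₀ hw.le ?_ _) ?_ hq.le (by positivity)
  · rw [wt]; nlinarith [sq_nonneg q.2]
  · nlinarith [sq_nonneg ‖q.1‖]

/-- Common to trace operators and, with the first normal variable frozen at xₙ, to singular Green
operators. Decay of h is needed in ξ only, uniformly in w, because f provides integrability in (w',
w). -/
theorem integral_normal_eq {h : Eu d → ℝ → ℂ} {C : ℝ}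
    (hc : ContinuousOn (fun q : Eu d × ℝ => h q.1 q.2) (univ ×ˢ Ici 0))
    (hC : ∀ ξ, ∀ w ≥ (0 : ℝ), ‖h ξ w‖ ≤ C * (wt ξ ^ (d + 1))⁻¹)
    (f : SchwartzMap (Eu (d + 1)) ℂ) (x : Eu d) :
    nfac d * ∫ ξ, char x ξ * ∫ w in Ioi (0 : ℝ), h ξ w * fourier (fun w' => f (pt w' w)) ξ
      = ∫ w', ∫ w in Ioi (0 : ℝ), nfac d * four 1 (fun ξ => h ξ w) (x - w') * f (pt w' w) := by
  let ν : Measure ℝ := volume.restrict (Ioi 0)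
  have hf := integrable_comp_pt f
  have hmeas : AEStronglyMeasurable (fun q : Eu d × Eu d × ℝ => h q.1 q.2.2)
      (volume.prod (volume.prod ν)) := by
    have h1 : (volume.prod (volume.prod ν) : Measure (Eu d × Eu d × ℝ))
        = (volume.prod (volume.prod volume)).restrict (univ ×ˢ (univ ×ˢ Ioi 0)) := by
      rw [← Measure.prod_restrict, ← Measure.prod_restrict, Measure.restrict_univ]
    rw [h1]
    refine ContinuousOn.aestronglyMeasurable (hc.comp (f := fun q : Eu d × Eu d × ℝ => (q.1, q.2.2))
      (by fun_prop) fun q hq => ⟨trivial, (le_of_lt hq.2.2 : (0 : ℝ) ≤ q.2.2)⟩)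
      (MeasurableSet.univ.prod (MeasurableSet.univ.prod measurableSet_Ioi))
  have hae : ∀ᵐ q ∂(volume.prod (volume.prod ν) : Measure (Eu d × Eu d × ℝ)),
      ‖h q.1 q.2.2‖ ≤ C * (wt q.1 ^ (d + 1))⁻¹ := by
    have h1 : (volume.prod (volume.prod ν) : Measure (Eu d × Eu d × ℝ))
        = (volume.prod (volume.prod volume)).restrict (univ ×ˢ (univ ×ˢ Ioi 0)) := by
      rw [← Measure.prod_restrict, ← Measure.prod_restrict, Measure.restrict_univ]
    rw [h1]
    exact (ae_restrict_mem (MeasurableSet.univ.prod (MeasurableSet.univ.prod measurableSet_Ioi))).mono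
      fun q hq => hC _ _ (le_of_lt hq.2.2)
  have hint : Integrable (fun q : Eu d × Eu d × ℝ => h q.1 q.2.2 * f (pt q.2.1 q.2.2))
      (volume.prod (volume.prod ν)) :=
    integrable_mul_prod (h := fun ξ (q : Eu d × ℝ) => h ξ q.2) hmeas hae hf
  have key := integral_char_mul_integral (h := fun ξ (q : Eu d × ℝ) => h ξ q.2)
    (f := fun q => f (pt q.1 q.2)) measurable_fst hint x
  have hI := integrable_char_mul_prod (h := fun ξ (q : Eu d × ℝ) => h ξ q.2)
    (f := fun q => f (pt q.1 q.2)) measurable_fst hint x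
  have hR : Integrable (fun q : Eu d × ℝ => four 1 (fun ξ => h ξ q.2) (x - q.1) * f (pt q.1 q.2))
      (volume.prod ν) := by
    refine hI.integral_prod_right.congr (Eventually.of_forall fun q => ?_)
    simp only [four, ← integral_mul_const, one_smul, ← char_mul_char_neg]
    refine integral_congr_ae (Eventually.of_forall fun ξ => ?_)
    ring
  have hL : ∫ ξ, char x ξ * ∫ w in Ioi (0 : ℝ), h ξ w * fourier (fun w' => f (pt w' w)) ξ
      = ∫ ξ, char x ξ * ∫ q, h ξ q.2 * char (-q.1) ξ * f (pt q.1 q.2) ∂(volume.prod ν) := by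
    -- Integrability in (w', w) is known for almost every ξ, which suffices under the integral.
    refine integral_congr_ae (hI.prod_right_ae.mono fun ξ hξ => ?_)
    beta_reduce
    rw [← integral_const_mul, ← integral_const_mul, integral_prod_symm _ hξ]
    refine integral_congr_ae (Eventually.of_forall fun w => ?_)
    simp only [fourier, ← integral_const_mul, mul_assoc]
  rw [hL, key, integral_prod _ hR]
  simp only [mul_assoc, integral_const_mul]
  rfl

end Normal

open Smooth

/-! ### Test functions -/

section TestFunctions

variable {n d : ℕ}

/-- The Schwartz function is the inverse Fourier transform of the dilation of ψ by 2π, which matches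
the two normalizations. -/
theorem exists_schwartz_fourier_eq {ψ : Eu n → ℂ} (h1 : HasCompactSupport ψ)
    (h2 : ContDiff ℝ ∞ ψ) : ∃ v : SchwartzMap (Eu n) ℂ, fourier v = ψ := by
  have hπ : (2 * Real.pi : ℝ) ≠ 0 := by positivity
  let φ : SchwartzMap (Eu n) ℂ := (h1.comp_smul hπ).toSchwartzMap
    (h2.comp (contDiff_const_smul _))
  refine ⟨FourierTransformInv.fourierInv φ, funext fun ξ => ?_⟩
  have h := congrArg (fun f : SchwartzMap (Eu n) ℂ => f ((2 * Real.pi)⁻¹ • ξ))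
    (FourierTransform.fourier_fourierInv_eq (F := SchwartzMap (Eu n) ℂ) φ)
  simp only [SchwartzMap.fourier_coe] at h
  rw [fourierIntegral_eq_four, smul_inv_smul₀ hπ] at h
  rw [fourier_eq_four, h]
  change ψ ((2 * Real.pi) • (2 * Real.pi)⁻¹ • ξ) = ψ ξ
  rw [smul_inv_smul₀ hπ]

/-- Every compactly supported smooth function is some Fourier transform. The integrals thus
determine a continuous function times the character, which has no zeros. -/
theorem eq_of_forall_integral_fourier {f g : Eu n → ℂ} (hf : Continuous f) (hg : Continuous g)
    (x : Eu n) (H : ∀ v : SchwartzMap (Eu n) ℂ, HasCompactSupport (fourier v) →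
      ∫ ξ, char x ξ * f ξ * fourier v ξ = ∫ ξ, char x ξ * g ξ * fourier v ξ) : f = g := by
  have hc : Continuous fun ξ => char x ξ := Continuous.char continuous_const continuous_id
  have hF : Continuous fun ξ => char x ξ * (f ξ - g ξ) := hc.mul (hf.sub hg)
  have h0 := ae_eq_zero_of_integral_contDiff_smul_eq_zero (μ := volume)
    hF.locallyIntegrable fun ψ hψ hψs => by
      have hs : HasCompactSupport fun ξ => (ψ ξ : ℂ) := hψs.comp_left (g := fun t : ℝ => (t : ℂ)) rfl
      have hψc : ContDiff ℝ ∞ fun ξ => (ψ ξ : ℂ) := Complex.ofRealCLM.contDiff.comp hψ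
      obtain ⟨v, hv⟩ := exists_schwartz_fourier_eq hs hψc
      have h := H v (by rw [hv]; exact hs)
      rw [hv] at h
      have hI : ∀ {u : Eu n → ℂ}, Continuous u →
          Integrable fun ξ => char x ξ * u ξ * (ψ ξ : ℂ) := fun hu =>
        ((hc.mul hu).mul hψc.continuous).integrable_of_hasCompactSupport hs.mul_left
      rw [← sub_eq_zero, ← integral_sub (hI hf) (hI hg)] at h
      rw [← h]
      refine integral_congr_ae (Eventually.of_forall fun ξ => ?_)
      simp only [Complex.real_smul]
      ring
  have h1 := (hF.ae_eq_iff_eq volume continuous_const).1 h0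
  funext ξ
  have h2 := congrFun h1 ξ
  exact sub_eq_zero.1 ((mul_eq_zero.1 h2).resolve_left (Complex.exp_ne_zero _))

theorem symbol_eq_of_opPsi_eq {p q : Eu n → Eu n → ℂ} {x : Eu n} (hp : Continuous (p x))
    (hq : Continuous (q x)) (H : ∀ f, opPsi p f x = opPsi q f x) : p x = q x := by
  have hn : nfac n ≠ 0 := pow_ne_zero _ (inv_ne_zero (by exact_mod_cast (by positivity)))
  exact eq_of_forall_integral_fourier hp hq x fun v _ => mul_left_cancel₀ hn (H v)

/-- The projection to the tangential variables. -/
def tangL (d : ℕ) : Eu (d + 1) →L[ℝ] Eu d :=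
  (EuclideanSpace.equiv (Fin d) ℝ).symm.toContinuousLinearMap.comp
    (ContinuousLinearMap.pi fun i => EuclideanSpace.proj i.castSucc)

/-- The projection to the normal variable. -/
def nrmL (d : ℕ) : Eu (d + 1) →L[ℝ] ℝ := EuclideanSpace.proj (Fin.last d)

theorem tang_pt (x' : Eu d) (t : ℝ) : tang (pt x' t) = x' := by
  ext i
  simp [tang, pt]

theorem nrm_pt (x' : Eu d) (t : ℝ) : nrm (pt x' t) = t := by
  simp [nrm, pt]

theorem norm_le_tang_nrm (x : Eu (d + 1)) : ‖x‖ ≤ (1 + ‖tang x‖) * (1 + ‖nrm x‖) := by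
  have h : ‖x‖ ^ 2 = ‖tang x‖ ^ 2 + nrm x ^ 2 := by
    rw [EuclideanSpace.norm_sq_eq, EuclideanSpace.norm_sq_eq, Fin.sum_univ_castSucc]
    simp [tang, nrm]
  rw [Real.norm_eq_abs]
  rw [← sq_abs (nrm x)] at h
  have h1 := norm_nonneg (tang x)
  have h2 := abs_nonneg (nrm x)
  nlinarith [mul_nonneg h1 h2, norm_nonneg x]

theorem norm_iteratedFDeriv_comp_clm_le {E F G : Type*} [NormedAddCommGroup E] [NormedSpace ℝ E]
    [NormedAddCommGroup F] [NormedSpace ℝ F] [NormedAddCommGroup G] [NormedSpace ℝ G]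
    (L : G →L[ℝ] E) {f : E → F} (hf : ContDiff ℝ ∞ f) (x : G) (i : ℕ) :
    ‖iteratedFDeriv ℝ i (f ∘ L) x‖ ≤ ‖iteratedFDeriv ℝ i f (L x)‖ * ‖L‖ ^ i := by
  rw [L.iteratedFDeriv_comp_right hf x (by exact_mod_cast le_top)]
  refine (ContinuousMultilinearMap.norm_compContinuousLinearMap_le _ _).trans_eq ?_
  simp

/-- The tensor product of Schwartz functions of the tangential and of the normal variables. -/
def tensor (v : SchwartzMap (Eu d) ℂ) (φ : SchwartzMap ℝ ℂ) : SchwartzMap (Eu (d + 1)) ℂ where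
  toFun x := v (tang x) * φ (nrm x)
  smooth' := (v.smooth'.comp (tangL d).contDiff).mul (φ.smooth'.comp (nrmL d).contDiff)
  decay' := fun k m => by
    have h1 : ∀ i, ∃ C, ∀ z, (1 + ‖z‖) ^ k * ‖iteratedFDeriv ℝ i v z‖ ≤ C := fun i =>
      ⟨_, v.one_add_le_sup_seminorm_apply (𝕜 := ℝ) (m := (k, i)) le_rfl le_rfl⟩
    have h2 : ∀ i, ∃ C, ∀ z, (1 + ‖z‖) ^ k * ‖iteratedFDeriv ℝ i φ z‖ ≤ C := fun i =>
      ⟨_, φ.one_add_le_sup_seminorm_apply (𝕜 := ℝ) (m := (k, i)) le_rfl le_rfl⟩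
    choose C hC using h1
    choose D hD using h2
    refine ⟨∑ i ∈ Finset.range (m + 1), (m.choose i : ℝ) *
      ((C i * ‖tangL d‖ ^ i) * (D (m - i) * ‖nrmL d‖ ^ (m - i))), fun x => ?_⟩
    have h := norm_iteratedFDeriv_mul_le (N := ∞) (v.smooth'.comp (tangL d).contDiff)
      (φ.smooth'.comp (nrmL d).contDiff) x (n := m) (by exact_mod_cast le_top)
    refine (mul_le_mul_of_nonneg_left h (by positivity)).trans ?_
    rw [Finset.mul_sum]
    refine Finset.sum_le_sum fun i _ => ?_
    have e1 := norm_iteratedFDeriv_comp_clm_le (tangL d) v.smooth' x i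
    have e2 := norm_iteratedFDeriv_comp_clm_le (nrmL d) φ.smooth' x (m - i)
    have b1 := hC i (tangL d x)
    have b2 := hD (m - i) (nrmL d x)
    -- The weight is dominated by a product of a tangential and a normal weight, which are absorbed
    -- by the decay of v and φ.
    have b0 : ‖x‖ ^ k ≤ (1 + ‖tangL d x‖) ^ k * (1 + ‖nrmL d x‖) ^ k := by
      rw [← mul_pow]
      exact pow_le_pow_left₀ (norm_nonneg _) (norm_le_tang_nrm x) k
    calc _ ≤ ((1 + ‖tangL d x‖) ^ k * (1 + ‖nrmL d x‖) ^ k) * ((m.choose i : ℝ) *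
          (‖iteratedFDeriv ℝ i v (tangL d x)‖ * ‖tangL d‖ ^ i) *
          (‖iteratedFDeriv ℝ (m - i) φ (nrmL d x)‖ * ‖nrmL d‖ ^ (m - i))) := by
          gcongr
          · exact e1
          · exact e2
      _ = (m.choose i : ℝ) * ((((1 + ‖tangL d x‖) ^ k * ‖iteratedFDeriv ℝ i v (tangL d x)‖)
          * ‖tangL d‖ ^ i) * (((1 + ‖nrmL d x‖) ^ k * ‖iteratedFDeriv ℝ (m - i) φ (nrmL d x)‖)
          * ‖nrmL d‖ ^ (m - i))) := by ring
      _ ≤ _ := by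
          have c1 : 0 ≤ C i := le_trans (by positivity) b1
          gcongr

theorem fourier_tensor (v : SchwartzMap (Eu d) ℂ) (φ : SchwartzMap ℝ ℂ) (y : ℝ) (ξ : Eu d) :
    fourier (fun y' => tensor v φ (pt y' y)) ξ = φ y * fourier v ξ := by
  have h : ∀ y', tensor v φ (pt y' y) = v y' * φ y := fun y' => by
    change v (tang (pt y' y)) * φ (nrm (pt y' y)) = _
    rw [tang_pt, nrm_pt]
  simp only [fourier, h, ← mul_assoc, integral_mul_const]
  ring

theorem opTrace_tensor (t : Eu d → Eu d → ℝ → ℂ) (v : SchwartzMap (Eu d) ℂ) (φ : SchwartzMap ℝ ℂ)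
    (x : Eu d) : opTrace t (tensor v φ) x
      = nfac d * ∫ ξ, char x ξ * (∫ y in Ioi (0 : ℝ), t x ξ y * φ y) * fourier v ξ := by
  simp only [opTrace, fourier_tensor, ← mul_assoc, integral_mul_const]

/-- Compact support reduces the integral to a compact interval, and the substitution of max y 0 for
y makes the integrand continuous everywhere. -/
theorem continuous_integral_mul {h : Eu d → ℝ → ℂ}
    (hc : ContinuousOn (fun q : Eu d × ℝ => h q.1 q.2) (univ ×ˢ Ici 0)) {φ : ℝ → ℂ}
    (hφ : Continuous φ) (hs : HasCompactSupport φ) :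
    Continuous fun ξ => ∫ y in Ioi (0 : ℝ), h ξ y * φ y := by
  obtain ⟨R, hR⟩ := hs.isCompact.isBounded.subset_closedBall (0 : ℝ)
  have hext : Continuous fun q : Eu d × ℝ => h q.1 (max q.2 0) :=
    hc.comp_continuous (f := fun q : Eu d × ℝ => (q.1, max q.2 0)) (by fun_prop)
      fun q => ⟨trivial, mem_Ici.2 (le_max_right _ _)⟩
  have h1 : Continuous fun ξ => ∫ y in Icc 0 R, h ξ (max y 0) * φ y :=
    continuous_parametric_integral_of_continuous (f := fun ξ y => h ξ (max y 0) * φ y)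
      (hext.mul (hφ.comp continuous_snd)) isCompact_Icc
  convert h1 using 2 with ξ
  rw [integral_Icc_eq_integral_Ioc]
  refine (setIntegral_eq_of_subset_of_forall_sdiff_eq_zero measurableSet_Ioi
    (fun y hy => hy.1) fun y hy => ?_).trans
    (setIntegral_congr_fun measurableSet_Ioc fun y hy => ?_)
  · have : φ y = 0 := by
      refine image_eq_zero_of_notMem_tsupport fun h => hy.2 ⟨hy.1, ?_⟩
      have := hR h
      rw [mem_closedBall_zero_iff, Real.norm_eq_abs] at this
      exact (le_abs_self y).trans this
    rw [this, mul_zero]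
  · simp only [max_eq_left hy.1.le]

/-- On tensor products of v and φ the trace operator is a pseudodifferential operator on v, whose
symbol is the integral of t against φ. These symbols agree for every compactly supported φ, so the
symbol-kernels agree for almost every y > 0 and, by continuity, for all y ≥ 0. -/
theorem symbolKernel_eq_of_opTrace_eq {t u : Eu d → Eu d → ℝ → ℂ} {x : Eu d}
    (ht : ContinuousOn (fun q : Eu d × ℝ => t x q.1 q.2) (univ ×ˢ Ici 0))
    (hu : ContinuousOn (fun q : Eu d × ℝ => u x q.1 q.2) (univ ×ˢ Ici 0))
    (H : ∀ f, opTrace t f x = opTrace u f x) (ξ : Eu d) {y : ℝ} (hy : 0 ≤ y) :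
    t x ξ y = u x ξ y := by
  have hn : nfac d ≠ 0 := pow_ne_zero _ (inv_ne_zero (by exact_mod_cast (by positivity)))
  have slice : ∀ {h : Eu d → ℝ → ℂ},
      ContinuousOn (fun q : Eu d × ℝ => h q.1 q.2) (univ ×ˢ Ici 0) → ContinuousOn (h ξ) (Ici 0) :=
    fun hc => hc.comp (f := fun s : ℝ => (ξ, s)) (by fun_prop) fun s hs => ⟨trivial, hs⟩
  have hD : ContinuousOn (fun s => t x ξ s - u x ξ s) (Ici 0) := (slice ht).sub (slice hu)
  -- Values at negative s carry no information. Composition with max s 0 gives a continuous function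
  -- on ℝ, whose restriction to s > 0 is locally integrable, as the fundamental lemma requires.
  have hext : Continuous fun s => t x ξ (max s 0) - u x ξ (max s 0) :=
    hD.comp_continuous (f := fun s : ℝ => max s 0) (by fun_prop) fun s => mem_Ici.2 (le_max_right _ _)
  have h0 := ae_eq_zero_of_integral_contDiff_smul_eq_zero (μ := volume)
    (hext.locallyIntegrable.indicator measurableSet_Ioi (s := Ioi 0)) fun φ hφ hφs => by
      have hs : HasCompactSupport fun s => (φ s : ℂ) := hφs.comp_left (g := fun t : ℝ => (t : ℂ)) rfl
      have hφc : ContDiff ℝ ∞ fun s => (φ s : ℂ) := Complex.ofRealCLM.contDiff.comp hφ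
      have h1 := congrFun (eq_of_forall_integral_fourier
        (continuous_integral_mul ht hφc.continuous hs)
        (continuous_integral_mul hu hφc.continuous hs) x fun v _ => by
          have h := H (tensor v (hs.toSchwartzMap hφc))
          rw [opTrace_tensor, opTrace_tensor] at h
          exact mul_left_cancel₀ hn h) ξ
      have hI : ∀ {h : Eu d → ℝ → ℂ},
          ContinuousOn (fun q : Eu d × ℝ => h q.1 q.2) (univ ×ˢ Ici 0) →
          IntegrableOn (fun s => h ξ s * (φ s : ℂ)) (Ioi 0) := fun {h} hc => by
        have he : Continuous fun s => h ξ (max s 0) :=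
          (slice hc).comp_continuous (f := fun s : ℝ => max s 0) (by fun_prop)
            fun s => mem_Ici.2 (le_max_right _ _)
        refine IntegrableOn.congr_fun
          ((he.mul hφc.continuous).integrable_of_hasCompactSupport hs.mul_left).integrableOn
          (fun s hs => ?_) measurableSet_Ioi
        rw [Pi.mul_apply, max_eq_left (le_of_lt (mem_Ioi.1 hs))]
      beta_reduce at h1
      rw [← sub_eq_zero, ← integral_sub (hI ht) (hI hu)] at h1
      rw [← h1, ← integral_indicator measurableSet_Ioi]
      refine integral_congr_ae (Eventually.of_forall fun s => ?_)
      by_cases hs : s ∈ Ioi (0 : ℝ)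
      · simp only [indicator_of_mem hs, Complex.real_smul, max_eq_left (le_of_lt (mem_Ioi.1 hs))]
        ring
      · simp only [indicator_of_notMem hs, smul_zero]
  have h1 : (fun s => t x ξ s - u x ξ s) =ᵐ[volume.restrict (Ici 0)] fun _ => 0 := by
    rw [← restrict_Ioi_eq_restrict_Ici]
    refine (ae_restrict_iff' measurableSet_Ioi).2 (h0.mono fun s h hs => ?_)
    rwa [indicator_of_mem hs, max_eq_left (le_of_lt hs)] at h
  exact sub_eq_zero.1 (Measure.eqOn_of_ae_eq h1 hD continuousOn_const
    (by rw [interior_Ici, closure_Ioi]) hy)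

end TestFunctions

/-! ### Fourier inversion and operator kernels under kernel bounds -/

section Transfer

variable {N d : ℕ} {τ : ℝ} {U : Set (Eu N)}

/-- Needed for t, since a trace operator determines its symbol-kernel only for y ≥ 0. The estimates
involve one-sided derivatives and are insensitive to other values. -/
theorem IsSymbolKernel.congr {m : ℝ} {h h' : Eu N → Eu d → ℝ → ℂ} (H : IsSymbolKernel τ m U h)
    (e : ∀ x ∈ U, ∀ ξ, ∀ y ≥ (0 : ℝ), h' x ξ y = h x ξ y) :
    IsSymbolKernel τ m U h' := by
  refine ⟨fun x hx => (H.1 x hx).congr fun q hq => e x hx _ _ hq.2, fun ξ y hy => ?_,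
    fun r a l l' => ?_⟩
  · obtain ⟨B, hB⟩ := H.2.1 ξ y hy
    exact ⟨B, hB.congr fun x hx => e x hx ξ y hy⟩
  · obtain ⟨C, hC⟩ := H.2.2 r a l l'
    refine ⟨C, fun ξ => ?_⟩
    obtain ⟨Φ, hΦ, hB⟩ := hC ξ
    refine ⟨Φ, fun x hx => (hΦ x hx).trans ?_, hB⟩
    refine (ae_restrict_mem measurableSet_Ioi).mono fun y hy => ?_
    beta_reduce
    rw [mixedD_congr a l' (fun ξ y hy => e x hx ξ y hy) ξ (le_of_lt hy)]

theorem body_halfSpace (d : ℕ) : Body (halfSpace d) := by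
  refine ⟨(convex_Ici (0 : ℝ)).linear_preimage (nrmL d).toLinearMap, pt 0 1, ?_⟩
  refine mem_interior.2 ⟨{x | 0 < nrm x}, fun x (hx : 0 < nrm x) => hx.le,
    isOpen_lt continuous_const continuous_nrm, ?_⟩
  change 0 < nrm (pt 0 1)
  rw [nrm_pt]
  exact one_pos

theorem KernelBound.rapidFn {K : Eu d → Eu d → ℂ} (h : KernelBound τ K) (x : Eu d) :
    RapidFn (K x) :=
  (kernelBound_iff_rapidFam.1 h).rapidFn (body_univ d) () trivial

theorem KernelBound.nfac_mul_four_four {K : Eu d → Eu d → ℂ} (h : KernelBound τ K) (x z : Eu d) :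
    nfac d * NonsmoothGreen.four 1 (NonsmoothGreen.four (-1) (K x)) z = K x z :=
  NonsmoothGreen.nfac_mul_four_four (h.rapidFn x).integrable (h.rapidFn x).1.continuous
    ((h.four (by norm_num)).rapidFn x).integrable z

theorem KernelBound2.rapidFn (hU : Body U) {K : Eu N → Eu d → ℝ → ℝ → ℂ} (h : KernelBound2 τ U K)
    {x : Eu N} (hx : x ∈ U) {y w : ℝ} (hy : 0 ≤ y) (hw : 0 ≤ w) : RapidFn fun ξ => K x ξ y w := by
  refine ⟨(Smooth.of (h.1 x hx)).contDiff_x hy hw, fun M => ?_⟩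
  obtain ⟨C, -, hC⟩ := (h.rapid hU hx).bound M
  exact ⟨C, fun ξ => hC (ξ, y, w) (mem_quad.2 ⟨hy, hw⟩)⟩

/-- Inversion needs an integrable transform; it is integrable because the transform satisfies kernel
bounds again. -/
theorem KernelBound2.nfac_mul_four_four (hU : Body U) {K : Eu N → Eu d → ℝ → ℝ → ℂ}
    (h : KernelBound2 τ U K) {x : Eu N} (hx : x ∈ U) {y w : ℝ} (hy : 0 ≤ y) (hw : 0 ≤ w)
    (z : Eu d) : nfac d * NonsmoothGreen.four 1 (NonsmoothGreen.four (-1) fun ξ => K x ξ y w) z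
      = K x z y w :=
  NonsmoothGreen.nfac_mul_four_four (h.rapidFn hU hx hy hw).integrable
    (h.rapidFn hU hx hy hw).1.continuous
    ((h.four hU (by norm_num)).rapidFn hU hx hy hw).integrable z

theorem KernelBound1.exists_bound (hU : Body U) {K : Eu N → Eu d → ℝ → ℂ} (h : KernelBound1 τ U K)
    {x : Eu N} (hx : x ∈ U) (M : ℕ) : ∃ C, ∀ ξ, ∀ y ≥ (0 : ℝ), ‖K x ξ y‖ ≤ C * (wt ξ ^ M)⁻¹ := by
  obtain ⟨C, -, hC⟩ := h.weight_bound hU (Fin.elim0 : Fin 0 → Fin d) 0 0 M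
  refine ⟨C, fun ξ y hy => ?_⟩
  have := (hC ξ y hy).norm_le hx
  simpa [mixedD, partialD_zero] using this

theorem KernelBound1.rapidFn (hU : Body U) {K : Eu N → Eu d → ℝ → ℂ} (h : KernelBound1 τ U K)
    {x : Eu N} (hx : x ∈ U) {y : ℝ} (hy : 0 ≤ y) : RapidFn fun ξ => K x ξ y := by
  refine ⟨by simpa using contDiff_normal_slice (h.1 x hx) 0 hy, fun M => ?_⟩
  obtain ⟨C, hC⟩ := h.exists_bound hU hx M
  exact ⟨C, fun ξ => hC ξ y hy⟩

theorem KernelBound1.nfac_mul_four_four (hU : Body U) {K : Eu N → Eu d → ℝ → ℂ}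
    (h : KernelBound1 τ U K) {x : Eu N} (hx : x ∈ U) {y : ℝ} (hy : 0 ≤ y)
    (z : Eu d) : nfac d * NonsmoothGreen.four 1 (NonsmoothGreen.four (-1) fun ξ => K x ξ y) z
      = K x z y :=
  NonsmoothGreen.nfac_mul_four_four (h.rapidFn hU hx hy).integrable
    (h.rapidFn hU hx hy).1.continuous ((h.four hU (by norm_num)).rapidFn hU hx hy).integrable z

theorem opGreen_eq_integral {g : Eu (d + 1) → Eu d → ℝ → ℝ → ℂ}
    (h : KernelBound2 τ (halfSpace d) g) (f : SchwartzMap (Eu (d + 1)) ℂ) {x : Eu (d + 1)}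
    (hx : x ∈ halfSpace d) : opGreen g f x = ∫ w', ∫ w in Ioi (0 : ℝ),
      nfac d * four 1 (fun ξ => g x ξ (nrm x) w) (tang x - w') * f (pt w' w) := by
  obtain ⟨C, -, hC⟩ := (h.rapid (body_halfSpace d) hx).bound (d + 1)
  exact integral_normal_eq (h := fun ξ w => g x ξ (nrm x) w)
    ((h.1 x hx).continuousOn.comp (f := fun q : Eu d × ℝ => (q.1, nrm x, q.2)) (by fun_prop)
      fun q hq => ⟨trivial, hx, hq.2⟩)
    (fun ξ w hw => hC (ξ, nrm x, w) (mem_quad.2 ⟨hx, hw⟩)) f (tang x)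

theorem opTrace_eq_integral {t : Eu d → Eu d → ℝ → ℂ} (h : KernelBound1 τ univ t)
    (f : SchwartzMap (Eu (d + 1)) ℂ) (x : Eu d) : opTrace t f x = ∫ y', ∫ y in Ioi (0 : ℝ),
      nfac d * four 1 (fun ξ => t x ξ y) (x - y') * f (pt y' y) := by
  obtain ⟨C, hC⟩ := h.exists_bound (body_univ d) (mem_univ x) (d + 1)
  exact integral_normal_eq (h.1 x trivial).continuousOn hC f x

end Transfer

/-! ### The two implications -/

namespace GreenOperator

variable {d : ℕ} {τ m : ℝ} {A : GreenOperator d τ m}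

theorem IsOrderNegInfty.hasKernel (H : A.IsOrderNegInfty) : A.HasKernel := by
  have hU := body_halfSpace d
  obtain ⟨hp, ⟨g₀, hg, eg⟩, ⟨k₀, hk, ek⟩, ht, hs⟩ := H
  have bp := isSymbol_iff_kernelBound.1 hp
  have bs := isSymbol_iff_kernelBound.1 hs
  have bg := kernelBound2_of_isSymbolKernel2 hU hg
  have bk := kernelBound1_of_isSymbolKernel hU hk
  have bt := kernelBound1_of_isSymbolKernel (body_univ d) ht
  -- Each kernel is the inverse Fourier transform of its symbol; for g and k the symbol-kernels g₀
  -- and k₀ of order -∞ are transformed.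
  refine ⟨⟨fun x z => nfac (d + 1) * four 1 (A.p x) z,
      ⟨(bp.four one_ne_zero).const_mul _, fun f x => opPsi_eq_integral (bp.rapidFn x) f⟩,
      fun f x _ => hasTruncValue_integral (bp.rapidFn x) f⟩,
    ⟨fun x z y w => nfac d * four 1 (fun ξ => g₀ x ξ y w) z,
      (bg.four hU one_ne_zero).const_mul hU _, fun f x hx => ?_⟩,
    ⟨fun x z y => nfac d * four 1 (fun ξ => A.t x ξ y) z,
      (bt.four (body_univ d) one_ne_zero).const_mul (body_univ d) _,
      fun f x => opTrace_eq_integral bt f x⟩,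
    ⟨fun x z y => nfac d * four 1 (fun ξ => k₀ x ξ y) z,
      (bk.four hU one_ne_zero).const_mul hU _, fun v x hx => ?_⟩,
    ⟨fun x z => nfac d * four 1 (A.s x) z,
      (bs.four one_ne_zero).const_mul _, fun f x => opPsi_eq_integral (bs.rapidFn x) f⟩⟩
  · rw [eg f x hx, opGreen_eq_integral bg f hx]
  · rw [ek v x hx, opPoisson_eq_integral (bk.rapidFn hU hx hx)]

end GreenOperator

/-- The Fourier transform of K is a symbol of order -∞, and by inversion its operator has the kernel
K. A continuous symbol is determined by its operator, so p is this transform. -/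
theorem IsPsiKernel.isSymbol {n : ℕ} {τ m μ : ℝ} {p K : Eu n → Eu n → ℂ} (h : IsPsiKernel τ p K)
    (hp : IsSymbol τ m p) : IsSymbol τ μ p := by
  have hq := h.1.four (s := -1) (by norm_num)
  have e : p = fun x => four (-1) (K x) := by
    funext x
    refine symbol_eq_of_opPsi_eq (p := p) (q := fun x => four (-1) (K x)) (hp.1 x).continuous
      (hq.1 x).continuous fun f => ?_
    rw [h.2, opPsi_eq_integral (p := fun x => four (-1) (K x)) (hq.rapidFn x)]
    simp only [h.1.nfac_mul_four_four]
  rw [e]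
  exact isSymbol_iff_kernelBound.2 hq μ

namespace GreenOperator

variable {d : ℕ} {τ m : ℝ} {A : GreenOperator d τ m}

theorem HasKernel.isOrderNegInfty (H : A.HasKernel) : A.IsOrderNegInfty := by
  have hU := body_halfSpace d
  obtain ⟨⟨Kp, hp, -⟩, ⟨Kg, hg, eg⟩, ⟨Kt, ht, et⟩, ⟨Kk, hk, ek⟩, ⟨Ks, hs⟩⟩ := H
  have bg := hg.four hU (s := -1) (by norm_num)
  have bt := ht.four (body_univ d) (s := -1) (by norm_num)
  have bk := hk.four hU (s := -1) (by norm_num)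
  refine ⟨fun μ => hp.isSymbol A.p_mem, ⟨_, bg.isSymbolKernel2 hU, fun f x hx => ?_⟩,
    ⟨_, bk.isSymbolKernel hU, fun v x hx => ?_⟩, fun μ => ?_, fun μ => hs.isSymbol A.s_mem⟩
  · rw [eg f x hx, opGreen_eq_integral bg f hx]
    refine integral_congr_ae (Eventually.of_forall fun w' => ?_)
    refine setIntegral_congr_fun measurableSet_Ioi fun w hw => ?_
    beta_reduce
    rw [hg.nfac_mul_four_four hU hx hx (le_of_lt hw)]
  · rw [ek v x hx, opPoisson_eq_integral (bk.rapidFn hU hx hx)]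
    simp only [hk.nfac_mul_four_four hU hx hx]
  -- The Fourier transform of the trace kernel is of order -∞ and has the same operator as `A.t`;
  -- uniqueness of symbol-kernels for y ≥ 0 transfers the estimates.
  · refine (bt.isSymbolKernel (body_univ d) μ).congr fun x _ ξ y hy => ?_
    refine symbolKernel_eq_of_opTrace_eq
      (u := fun x z y => four (-1) (fun ξ => Kt x ξ y) z) (A.t_mem.1 x trivial).continuousOn
      (bt.1 x trivial).continuousOn (fun f => ?_) ξ hy
    rw [et f x, opTrace_eq_integral bt f x]
    refine integral_congr_ae (Eventually.of_forall fun w' => ?_)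
    refine setIntegral_congr_fun measurableSet_Ioi fun w hw => ?_
    beta_reduce
    rw [ht.nfac_mul_four_four (body_univ d) (mem_univ x) (le_of_lt hw)]

end GreenOperator

end NonsmoothGreen

end

theorem mainTheorem9 (d : ℕ) (τ m : ℝ) (hτ : 0 < τ)
    (A : NonsmoothGreen.GreenOperator d τ m) :
    A.IsOrderNegInfty ↔ A.HasKernel :=
  ⟨fun H => H.hasKernel, fun H => H.isOrderNegInfty⟩
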